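/- Let $G$ be a compact connected Lie group with Lie algebra $\mathfrak g=\mathrm T_eG$, let $M$ be a smooth connected manifold (not necessarily compact), let $\xi\colon P\to M$ be a smooth principal (right) $G$-bundle, and let $Q_P\in P$ and $Q=\xi(Q_P)$. Let $\mathcal A^1(M,\mathrm{ad}_\xi)$ be the Fréchet space (with the $C^\infty$-topology) of $1$-forms on $M$ with values in the adjoint bundle $P\times_G\mathfrak g$, viewed as the smooth $\mathfrak g$-valued $1$-forms $\vartheta$ on $P$ which are horizontal and satisfy $R_g^*\vartheta=\mathrm{Ad}(g^{-1})\vartheta$. Let $\mathcal A_\xi$ be the space of smooth connections on $\xi$, a Fréchet affine space over $\mathcal A^1(M,\mathrm{ad}_\xi)$: the connection $A+\vartheta$ is the one whose connection form is $\omega_{A+\vartheta}=\omega_A-\vartheta$ (connections being regarded as splittings $\mathrm TM\to \mathrm TP/G$ of the Atiyah sequence). Smoothness of maps between Fréchet spaces and Fréchet manifolds is meant in the sense of Michal–Bastiani (Hamilton, Milnor). (1) Let $w\colon[0,1]\to M$ be a smooth loop, $w(0)=w(1)=Q$. For each $A\in\mathcal A_\xi$ there is a unique smooth $A$-horizontal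 lift $w_A\colon[0,1]\to P$ of $w$ with $w_A(0)=Q_P$. The horizontal lift map $\mathrm{Hor}\colon\mathcal A_\xi\to\Gamma^\infty(w^*\xi)$, $A\mapsto w_A$, into the Fréchet manifold of smooth sections of $w^*\xi$ is smooth. When $\mathrm T_{w_A}\Gamma^\infty(w^*\xi)$ is identified with $C^\infty([0,1],\mathfrak g)$ through the trivialization $\sigma=w_A\cdot g$ ($g\in C^\infty([0,1],G)$) of $w^*\xi$ given by $w_A$, the derivative of $\mathrm{Hor}$ at $A$ sends $\vartheta\in\mathcal A^1(M,\mathrm{ad}_\xi)$ to the function $$f_\vartheta(t)=\int_0^t\vartheta_{w_A(\tau)}(\dot w_A(\tau))\,d\tau,\qquad t\in[0,1].$$ (2) Suppose that $M=\Sigma$ is a closed orientable surface of genus $\ell\ge1$, and let $u_1,v_1,\dots,u_\ell,v_\ell$ be a canonical system of smooth closed curves in $\Sigma$ starting at $Q$, that is, the curves are simple and meet only in $Q$, and cutting $\Sigma$ along them yields a disc whose boundary path is $u_1v_1u_1^{-1}v_1^{-1}\cdots u_\ell v_\ell u_\ell^{-1}v_\ell^{-1}$. For a smooth loop $w$ at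 $Q$ let $\mathrm{Hol}_w(A)\in G$ be the holonomy, characterized by $Q_P\,\mathrm{Hol}_w(A)=w_A(1)$. Then the Wilson loop mapping $$\rho\colon\mathcal A_\xi\to G^{2\ell},\qquad \rho(A)=(\mathrm{Hol}_{u_1}(A),\mathrm{Hol}_{v_1}(A),\dots,\mathrm{Hol}_{u_\ell}(A),\mathrm{Hol}_{v_\ell}(A)),$$ is well defined and smooth. If $\rho(A)=(a_1,b_1,\dots,a_\ell,b_\ell)$ and $\widehat u_{A,j},\widehat v_{A,j}$ denote the $A$-horizontal lifts of $u_j,v_j$ starting at $Q_P$, then the tangent map $\mathrm T_A\rho$ sends $\vartheta\in\mathcal A^1(\Sigma,\mathrm{ad}_\xi)=\mathrm T_A\mathcal A_\xi$ to $$\Bigl(L_{a_1}\!\int_{\widehat u_{A,1}}\!\vartheta,\ L_{b_1}\!\int_{\widehat v_{A,1}}\!\vartheta,\ \dots,\ L_{a_\ell}\!\int_{\widehat u_{A,\ell}}\!\vartheta,\ L_{b_\ell}\!\int_{\widehat v_{A,\ell}}\!\vartheta\Bigr)\in \mathrm T_{a_1}G\times \mathrm T_{b_1}G\times\dots\times\mathrm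 T_{a_\ell}G\times\mathrm T_{b_\ell}G,$$ where $L_q\colon\mathfrak g\to\mathrm T_qG$ is left translation. -/

import Mathlib

open Set Filter Topology Bundle
open scoped Manifold ContDiff UniformConvergence

noncomputable section

universe u

/-! ### Smooth maps between Fréchet spaces and into manifolds -/

section Bastiani

variable {F : Type*} [AddCommGroup F] [Module ℝ F] [TopologicalSpace F]

/-- `f` has directional derivative `y` at `x` in the direction `v`. -/
def HasDirDeriv {E : Type*} [AddCommGroup E] [Module ℝ E] (f : E → F) (x v : E) (y : F) : Prop :=
  Tendsto (fun s : ℝ => s⁻¹ • (f (x + s • v) - f x)) (𝓝[≠] 0) (𝓝 y)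

/-- `f` is of class `C^n` (in the sense of Michal, Bastiani, Hamilton, Milnor) on the open
set `U`: it is continuous and, for `n ≥ 1`, all directional derivatives `df (x, v)` exist
for `x ∈ U` and the map `df` is of class `C^(n-1)` on `U × E`. -/
def BastianiOn : ℕ → ∀ {E : Type u} [AddCommGroup E] [Module ℝ E] [TopologicalSpace E],
    (E → F) → Set E → Prop
  | 0, _, _, _, _, f, U => ContinuousOn f U
  | n + 1, E, _, _, _, f, U => ContinuousOn f U ∧ ∃ df : E × E → F,
      (∀ x ∈ U, ∀ v, HasDirDeriv f x v (df (x, v))) ∧ BastianiOn n df (U ×ˢ univ)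

/-- `f : E → X` is smooth with respect to an atlas of `X`, given by charts `chart i` with
domains `source i` and values in the topological vector space `F`: the preimages of the chart
domains are open and the local representatives of `f` are smooth there. -/
def BastianiSmoothInCharts {E : Type*} [AddCommGroup E] [Module ℝ E] [TopologicalSpace E]
    {X ι : Type*} (source : ι → Set X) (chart : ι → X → F) (f : E → X) : Prop :=
  ∀ i, IsOpen (f ⁻¹' source i) ∧ ∀ n, BastianiOn n (fun x => chart i (f x)) (f ⁻¹' source i)

end Bastiani

/-! ### The `C^∞` topologies -/

/-- The topology of uniform convergence, on compact subsets of charts, of all derivatives. It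
is the usual `C^∞` topology on the smooth `V`-valued functions on a manifold without boundary. -/
abbrev smoothTopology {E H : Type*} [NormedAddCommGroup E] [NormedSpace ℝ E] [TopologicalSpace H]
    (I : ModelWithCorners ℝ E H) (N : Type*) [TopologicalSpace N] [ChartedSpace H N]
    (V : Type*) [NormedAddCommGroup V] [NormedSpace ℝ V] : TopologicalSpace (N → V) :=
  ⨅ (x : N) (k : ℕ), TopologicalSpace.induced
    (fun f => UniformOnFun.ofFun {K : Set E | IsCompact K ∧ K ⊆ (extChartAt I x).target}
      (iteratedFDeriv ℝ k (f ∘ (extChartAt I x).symm))) inferInstance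

section Paths

/-- A path `[0,1] → N`, extended to `ℝ` by constants. Only its restriction to `[0,1]` and
one-sided derivatives at the end points will matter. -/
abbrev extPath {N : Type*} (w : unitInterval → N) : ℝ → N := IccExtend zero_le_one w

variable {E : Type*} [NormedAddCommGroup E] [NormedSpace ℝ E]
  {N : Type*} [TopologicalSpace N] [ChartedSpace E N]

variable (E) in
/-- Smoothness of a path `w : [0,1] → N`. -/
def IsSmoothPath (w : unitInterval → N) : Prop :=
  ContMDiffOn 𝓘(ℝ, ℝ) 𝓘(ℝ, E) ∞ (extPath w) (Icc 0 1)

variable (E) in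
/-- A smooth closed path `[0,1] → N` starting at `x`. -/
structure IsSmoothLoop (w : unitInterval → N) (x : N) : Prop where
  smooth : IsSmoothPath E w
  start : w 0 = x
  finish : w 1 = x

variable (E) in
/-- The velocity vector of a path at time `t ∈ [0,1]`. -/
def velocity (w : unitInterval → N) (t : ℝ) : TangentSpace 𝓘(ℝ, E) (extPath w t) :=
  mfderivWithin 𝓘(ℝ, ℝ) 𝓘(ℝ, E) (extPath w) (Icc 0 1) t (1 : ℝ)

variable (E) in
/-- The space `C^∞([0,1], E)` as a subspace of all functions. -/
def smoothPathSubmodule : Submodule ℝ (unitInterval → E) where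
  carrier := {f | ContDiffOn ℝ ∞ (extPath f) (Icc 0 1)}
  add_mem' ha hb := ContDiffOn.add ha hb
  zero_mem' := contDiffOn_const (c := (0 : E))
  smul_mem' c _ hf := ContDiffOn.const_smul c hf

variable (E) in
/-- The Fréchet space `C^∞([0,1], E)`. -/
def SmoothPaths : Type _ := smoothPathSubmodule E

instance : AddCommGroup (SmoothPaths E) := inferInstanceAs (AddCommGroup (smoothPathSubmodule E))
instance : Module ℝ (SmoothPaths E) := inferInstanceAs (Module ℝ (smoothPathSubmodule E))
instance : CoeFun (SmoothPaths E) (fun _ => unitInterval → E) := ⟨fun f => f.1⟩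

/-- The topology of uniform convergence of all derivatives on `[0,1]`. -/
instance : TopologicalSpace (SmoothPaths E) :=
  ⨅ k : ℕ, TopologicalSpace.induced
    (fun f => UniformFun.ofFun fun t : unitInterval =>
      iteratedDerivWithin k (extPath (f : unitInterval → E)) (Icc 0 1) (t : ℝ)) inferInstance

end Paths

/-! ### Principal bundles -/

variable {EG : Type*} [NormedAddCommGroup EG] [NormedSpace ℝ EG]
  {G : Type*} [TopologicalSpace G] [ChartedSpace EG G] [Group G]
  {EM : Type*} [NormedAddCommGroup EM] [NormedSpace ℝ EM]
  {M : Type*} [TopologicalSpace M] [ChartedSpace EM M]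
  {EP : Type*} [NormedAddCommGroup EP] [NormedSpace ℝ EP]
  {P : Type*} [TopologicalSpace P] [ChartedSpace EP P]

/-- The adjoint action of `g` on the Lie algebra `T_1 G`: the derivative at `1` of
`x ↦ g * x * g⁻¹`. The tangent space `T_1 G` is the model space `EG`, via the preferred
chart of `G` at `1`. -/
def lieAd (g : G) : EG →L[ℝ] EG :=
  mfderiv 𝓘(ℝ, EG) 𝓘(ℝ, EG) (fun x : G => g * x * g⁻¹) 1

variable (EG G EM M EP P) in
/-- A smooth principal (right) `G`-bundle `P → M`. Over a neighbourhood `U` of each point there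
are a smooth section `s` and a smooth `γ` such that `p ↦ (proj p, γ p)` is a trivialization
`proj ⁻¹' U ≃ U × G`, with inverse `(y, g) ↦ s y · g`. -/
structure PrincipalBundle where
  proj : P → M
  act : P → G → P
  smooth_proj : ContMDiff 𝓘(ℝ, EP) 𝓘(ℝ, EM) ∞ proj
  smooth_act : ContMDiff (𝓘(ℝ, EP).prod 𝓘(ℝ, EG)) 𝓘(ℝ, EP) ∞ (fun x : P × G => act x.1 x.2)
  act_one : ∀ p, act p 1 = p
  act_mul : ∀ p g h, act p (g * h) = act (act p g) h
  proj_act : ∀ p g, proj (act p g) = proj p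
  locally_trivial : ∀ x : M, ∃ U : Set M, IsOpen U ∧ x ∈ U ∧ ∃ (s : M → P) (γ : P → G),
    ContMDiffOn 𝓘(ℝ, EM) 𝓘(ℝ, EP) ∞ s U ∧ ContMDiffOn 𝓘(ℝ, EP) 𝓘(ℝ, EG) ∞ γ (proj ⁻¹' U) ∧
    (∀ y ∈ U, ∀ g, proj (act (s y) g) = y ∧ γ (act (s y) g) = g) ∧
    ∀ p ∈ proj ⁻¹' U, act (s (proj p)) (γ p) = p

namespace PrincipalBundle

variable (ξ : PrincipalBundle EG G EM M EP P)

/-- The fundamental vector at `p` of `X` in the Lie algebra: the derivative of `g ↦ p · g`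
at `1`. (It lies in the tangent space at `p · 1`, which is `p`.) -/
def fundamentalVector (p : P) (X : EG) : TangentSpace 𝓘(ℝ, EP) (ξ.act p 1) :=
  mfderiv 𝓘(ℝ, EG) 𝓘(ℝ, EP) (fun g : G => ξ.act p g) 1 X

/-- The derivative at `p` of right translation by `g`. -/
def translateVector (g : G) {p : P} (v : TangentSpace 𝓘(ℝ, EP) p) :
    TangentSpace 𝓘(ℝ, EP) (ξ.act p g) :=
  mfderiv 𝓘(ℝ, EP) 𝓘(ℝ, EP) (fun q : P => ξ.act q g) p v

end PrincipalBundle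

/-! ### Connections and tensorial forms -/

variable (EG EP P) in
/-- A (not necessarily smooth) 1-form on `P` with values in the Lie algebra `EG = T_1 G`. -/
abbrev LieForm : Type _ := ∀ p : P, TangentSpace 𝓘(ℝ, EP) p →L[ℝ] EG

section Forms

variable [IsManifold 𝓘(ℝ, EP) ∞ P] (ξ : PrincipalBundle EG G EM M EP P)

/-- A 1-form on `P` viewed as a function on the tangent bundle `TP`. -/
def LieForm.onTangent (θ : LieForm EG EP P) : TangentBundle 𝓘(ℝ, EP) P → EG :=
  fun v => θ v.proj v.snd

/-- Smoothness of a 1-form, as a function on `TP`. -/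
def LieForm.IsSmooth (θ : LieForm EG EP P) : Prop :=
  ContMDiff 𝓘(ℝ, EP).tangent 𝓘(ℝ, EG) ∞ θ.onTangent

/-- `R_g^* θ = Ad(g⁻¹) θ` for all `g`. -/
def LieForm.IsEquivariant (θ : LieForm EG EP P) : Prop :=
  ∀ (p : P) (g : G) (v : TangentSpace 𝓘(ℝ, EP) p),
    θ (ξ.act p g) (ξ.translateVector g v) = lieAd g⁻¹ (θ p v)

/-- Smooth equivariant horizontal `1`-forms on `P` with values in the Lie algebra. -/
def tensorialSubmodule : Submodule ℝ (LieForm EG EP P) where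
  carrier := {θ | θ.IsSmooth ∧ θ.IsEquivariant ξ ∧
    ∀ p X, θ (ξ.act p 1) (ξ.fundamentalVector p X) = 0}
  add_mem' {a b} ha hb := ⟨ContMDiff.add ha.1 hb.1,
    fun p g v => by
      change a _ _ + b _ _ = lieAd g⁻¹ (a p v + b p v)
      rw [ha.2.1, hb.2.1, map_add],
    fun p X => by
      change a _ _ + b _ _ = 0
      rw [ha.2.2, hb.2.2, add_zero]⟩
  zero_mem' := ⟨contMDiff_const (c := (0 : EG)),
    fun p g v => by
      change (0 : EG) = lieAd g⁻¹ (0 : EG)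
      rw [map_zero],
    fun p X => rfl⟩
  smul_mem' c a ha := ⟨by
      have h : ContMDiff 𝓘(ℝ, EP).tangent 𝓘(ℝ, ℝ) ∞ (fun _ : TangentBundle 𝓘(ℝ, EP) P => c) :=
        contMDiff_const
      exact h.smul ha.1,
    fun p g v => by
      change c • a _ _ = lieAd g⁻¹ (c • a p v)
      rw [ha.2.1, map_smul],
    fun p X => by
      change c • a _ _ = 0
      rw [ha.2.2, smul_zero]⟩

/-- The Fréchet space `𝒜¹(M, ad_ξ)` of 1-forms on `M` with values in the adjoint bundle,
realized as the smooth equivariant horizontal Lie algebra valued 1-forms on `P`. -/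
def AdForms : Type _ := tensorialSubmodule ξ

namespace AdForms

instance : AddCommGroup (AdForms ξ) := inferInstanceAs (AddCommGroup (tensorialSubmodule ξ))
instance : Module ℝ (AdForms ξ) := inferInstanceAs (Module ℝ (tensorialSubmodule ξ))

variable {ξ}

/-- The 1-form on `P` underlying an element of `𝒜¹(M, ad_ξ)`. -/
def form (ϑ : AdForms ξ) : LieForm EG EP P := ϑ.1

/-- The `C^∞` topology. -/
instance : TopologicalSpace (AdForms ξ) :=
  TopologicalSpace.induced (fun ϑ => ϑ.form.onTangent)
    (smoothTopology 𝓘(ℝ, EP).tangent (TangentBundle 𝓘(ℝ, EP) P) EG)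

end AdForms

/-- Smooth connections on `ξ`, given by their connection forms. -/
structure Connection where
  form : LieForm EG EP P
  smooth : form.IsSmooth
  equivariant : form.IsEquivariant ξ
  form_fundamental : ∀ p X, form (ξ.act p 1) (ξ.fundamentalVector p X) = X

/-- The affine action of `𝒜¹(M, ad_ξ)` on the space of connections. A connection is a splitting
of the Atiyah sequence `0 → P ×_G 𝔤 → TP/G → TM → 0`, and adding `ϑ` to the splitting
subtracts `ϑ` from the connection form. -/
instance : HAdd (Connection ξ) (AdForms ξ) (Connection ξ) where
  hAdd A ϑ :=
    { form := A.form - ϑ.form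
      smooth := ContMDiff.sub A.smooth ϑ.2.1
      equivariant := fun p g v => by
        change A.form _ _ - ϑ.form _ _ = lieAd g⁻¹ (A.form p v - ϑ.form p v)
        rw [A.equivariant, map_sub]
        congr 1
        exact ϑ.2.2.1 p g v
      form_fundamental := fun p X => by
        change A.form _ _ - ϑ.form _ _ = X
        rw [A.form_fundamental, show ϑ.form _ (ξ.fundamentalVector p X) = 0 from ϑ.2.2.2 p X,
          sub_zero] }

/-- Smoothness of a map from the Fréchet affine space of connections to a set `X` with an
atlas. -/
def SmoothOnConnections {F : Type*} [AddCommGroup F] [Module ℝ F] [TopologicalSpace F]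
    {X ι : Type*} (source : ι → Set X) (chart : ι → X → F) (f : Connection ξ → X) : Prop :=
  ∀ A : Connection ξ, BastianiSmoothInCharts source chart (fun ϑ : AdForms ξ => f (A + ϑ))

end Forms

/-! ### Sections of the pulled back bundle -/

/-- Smooth lifts of a path `w` in `M` to `P`, that is, smooth sections of `w^* ξ`. -/
structure PullbackSection (ξ : PrincipalBundle EG G EM M EP P) (w : unitInterval → M) where
  toFun : unitInterval → P
  smooth : IsSmoothPath EP toFun
  proj_eq : ∀ t, ξ.proj (toFun t) = w t

namespace PrincipalBundle

variable (ξ : PrincipalBundle EG G EM M EP P)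

/-- The element `g` of `G` with `p · g = q`, for `p` and `q` in the same fibre. -/
def div (p q : P) : G := Classical.epsilon fun g => ξ.act p g = q

theorem act_div {p q : P} (h : ξ.proj p = ξ.proj q) : ξ.act p (ξ.div p q) = q := by
  refine Classical.epsilon_spec (p := fun g => ξ.act p g = q) ?_
  obtain ⟨U, -, hxU, s, γ, -, -, -, h4⟩ := ξ.locally_trivial (ξ.proj p)
  refine ⟨(γ p)⁻¹ * γ q, ?_⟩
  have hp := h4 p hxU
  have hq := h4 q (by rw [mem_preimage, ← h]; exact hxU)
  calc ξ.act p ((γ p)⁻¹ * γ q)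
      = ξ.act (ξ.act (s (ξ.proj p)) (γ p)) ((γ p)⁻¹ * γ q) := by rw [hp]
    _ = q := by rw [← ξ.act_mul, mul_inv_cancel_left, h, hq]

end PrincipalBundle

namespace PullbackSection

variable {ξ : PrincipalBundle EG G EM M EP P} {w : unitInterval → M}

/-- The path `σ⁻¹ σ'` in `G`, determined by `σ t · (σ⁻¹ σ') t = σ' t`. -/
def ratio (σ σ' : PullbackSection ξ w) (t : unitInterval) : G := ξ.div (σ.toFun t) (σ'.toFun t)

theorem smooth_ratio [LieGroup 𝓘(ℝ, EG) ∞ G] (σ σ' : PullbackSection ξ w) :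
    IsSmoothPath EG (σ.ratio σ') := by
  intro t ht
  obtain ⟨U, hU, hxU, s, γ, -, h2, h3, h4⟩ := ξ.locally_trivial (ξ.proj (extPath σ.toFun t))
  have hproj : ∀ r, ξ.proj (extPath σ.toFun r) = ξ.proj (extPath σ'.toFun r) := fun r => by
    simp only [extPath, IccExtend, Function.comp_apply, σ.proj_eq, σ'.proj_eq]
  have key : ∀ τ : PullbackSection ξ w, ξ.proj (extPath τ.toFun t) ∈ U →
      ContMDiffWithinAt 𝓘(ℝ, ℝ) 𝓘(ℝ, EG) ∞ (γ ∘ extPath τ.toFun) (Icc 0 1) t := fun τ hτ =>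
    (h2.contMDiffAt ((hU.preimage ξ.smooth_proj.continuous).mem_nhds hτ)).comp_contMDiffWithinAt t
      (τ.smooth t ht)
  have hσ := key σ hxU
  have hσ' := key σ' (by rw [← hproj]; exact hxU)
  refine (hσ.inv.mul hσ').congr_of_eventuallyEq_of_mem ?_ ht
  have hev : ∀ᶠ r in 𝓝[Icc 0 1] t, ξ.proj (extPath σ.toFun r) ∈ U :=
    (ξ.smooth_proj.continuous.continuousAt.comp_continuousWithinAt
      (σ.smooth t ht).continuousWithinAt) (hU.mem_nhds hxU)
  filter_upwards [hev] with r hr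
  have h5 : ξ.act (extPath σ.toFun r) (extPath (σ.ratio σ') r) = extPath σ'.toFun r :=
    ξ.act_div (hproj r)
  have h6 : γ (extPath σ'.toFun r) = γ (extPath σ.toFun r) * extPath (σ.ratio σ') r := by
    rw [← h5]
    nth_rewrite 1 [← h4 _ hr]
    rw [← ξ.act_mul, (h3 _ hr _).2]
  simp [h6]

/-- The domain of the chart of `Γ^∞(w^* ξ)` around `σ`: the sections `σ'` such that `σ⁻¹ σ'`
stays in the domain of the preferred chart of `G` at `1`. -/
def chartSource (σ : PullbackSection ξ w) : Set (PullbackSection ξ w) :=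
  {σ' | ∀ t, σ.ratio σ' t ∈ (chartAt EG (1 : G)).source}

open Classical in
/-- The chart of the Fréchet manifold `Γ^∞(w^* ξ)` around `σ`, with values in
`C^∞([0,1], 𝔤)`: it sends `σ'` to the composite of `σ⁻¹ σ'` with the preferred chart of `G`
at `1` (with junk value `0` outside the chart domain). As the tangent space `T_1 G` is
identified with `EG` by the same chart, the derivative of this chart at `σ` is the identification
of `T_σ Γ^∞(w^* ξ)` with `C^∞([0,1], 𝔤)` in which `f` is the velocity at `s = 0` of every
family `σ · g_s` with `g_0 = 1` and `∂g_s(t)/∂s = f(t)` at `s = 0`. -/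
def chart [LieGroup 𝓘(ℝ, EG) ∞ G] (σ σ' : PullbackSection ξ w) : SmoothPaths EG :=
  if h : σ' ∈ σ.chartSource then
    ⟨fun t => extChartAt 𝓘(ℝ, EG) (1 : G) (σ.ratio σ' t), by
      have : IsManifold 𝓘(ℝ, EG) ∞ G := (inferInstance : ContMDiffMul 𝓘(ℝ, EG) ∞ G).toIsManifold
      exact contMDiffOn_iff_contDiffOn.1 (contMDiffOn_extChartAt.comp (σ.smooth_ratio σ')
        fun r _ => h (projIcc 0 1 zero_le_one r))⟩
  else 0

end PullbackSection

/-! ### Horizontal lifts and holonomy -/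

section Holonomy

variable [IsManifold 𝓘(ℝ, EP) ∞ P] {ξ : PrincipalBundle EG G EM M EP P}

/-- `σ` is the horizontal lift of `w` with respect to the connection `A`, starting at `p₀`. -/
structure IsHorizontalLift (A : Connection ξ) (p₀ : P) {w : unitInterval → M}
    (σ : PullbackSection ξ w) : Prop where
  start : σ.toFun 0 = p₀
  horizontal : ∀ t ∈ Icc (0 : ℝ) 1, A.form (extPath σ.toFun t) (velocity EP σ.toFun t) = 0

/-- `g` is the holonomy of `A` along the loop `w` with respect to the base point `p₀`. -/
def IsHolonomy (A : Connection ξ) (p₀ : P) (w : unitInterval → M) (g : G) : Prop :=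
  ∃ σ : PullbackSection ξ w, IsHorizontalLift A p₀ σ ∧ ξ.act p₀ g = σ.toFun 1

/-- The integral of `ϑ` along the path `σ` in `P`, restricted to `[0,t]`. -/
def lineIntegral (ϑ : AdForms ξ) (σ : unitInterval → P) (t : ℝ) : EG :=
  ∫ τ in (0 : ℝ)..t, ϑ.form (extPath σ τ) (velocity EP σ τ)

/-- Left translation `L_a : T_1 G → T_a G`. -/
def leftTranslate (a : G) (X : EG) : TangentSpace 𝓘(ℝ, EG) a :=
  mfderiv 𝓘(ℝ, EG) 𝓘(ℝ, EG) (fun x : G => a * x) 1 X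

/-- The family `u 0, v 0, …, u (ℓ-1), v (ℓ-1)`. -/
def interleave {X : Type*} {ℓ : ℕ} (u v : Fin ℓ → X) (i : Fin ℓ × Fin 2) : X :=
  ![u i.1, v i.1] i.2

/-- `ρ` is the Wilson loop mapping `A ↦ (Hol_{u_1}(A), Hol_{v_1}(A), …, Hol_{v_ℓ}(A))`. -/
def IsWilsonLoopMap {ℓ : ℕ} (p₀ : P) (u v : Fin ℓ → unitInterval → M)
    (ρ : Connection ξ → Fin ℓ × Fin 2 → G) : Prop :=
  ∀ A i g, IsHolonomy A p₀ (interleave u v i) g ↔ g = ρ A i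

end Holonomy

/-! ### Canonical systems of curves -/

variable (EM) in
/-- `u_1, v_1, …, u_ℓ, v_ℓ` is a canonical system of smooth closed curves at `Q` in the surface
`M`: the curves are simple and meet only in `Q`, and cutting `M` along them yields a disc whose
boundary reads `u_1 v_1 u_1⁻¹ v_1⁻¹ ⋯ u_ℓ v_ℓ u_ℓ⁻¹ v_ℓ⁻¹`. The disc is attached through `q`;
the circle is divided into `4ℓ` arcs of equal length. A closed surface that has such a
system is orientable and of genus `ℓ`. -/
structure IsCanonicalSystem {ℓ : ℕ} (Q : M) (u v : Fin ℓ → unitInterval → M) : Prop where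
  loop_u : ∀ j, IsSmoothLoop EM (u j) Q
  loop_v : ∀ j, IsSmoothLoop EM (v j) Q
  ne_base : ∀ i, ∀ t ∈ Ioo (0 : unitInterval) 1, interleave u v i t ≠ Q
  simple : ∀ i i', ∀ t ∈ Ioo (0 : unitInterval) 1, ∀ t' ∈ Ioo (0 : unitInterval) 1,
    interleave u v i t = interleave u v i' t' → i = i' ∧ t = t'
  disc : ∃ q : ℂ → M, ContinuousOn q (Metric.closedBall 0 1) ∧
    q '' Metric.closedBall 0 1 = univ ∧ InjOn q (Metric.ball 0 1) ∧
    Disjoint (q '' Metric.ball 0 1) (q '' Metric.sphere 0 1) ∧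
    ∀ (j : Fin ℓ) (t : unitInterval),
      let arc : ℝ → ℂ := fun r =>
        Complex.exp (2 * Real.pi * ((4 * (j : ℝ) + r) / (4 * ℓ) : ℝ) * Complex.I)
      q (arc t) = u j t ∧ q (arc (1 + t)) = v j t ∧
      q (arc (2 + t)) = u j (unitInterval.symm t) ∧ q (arc (3 + t)) = v j (unitInterval.symm t)

end

/-!
If `σ` is the horizontal lift of a path with respect to a connection `A`, then its horizontal lift
with respect to `A + ϑ` is `σ · g`, where the path `g` in `G` solves `ġ g⁻¹ = ϑ(σ̇)`, `g(0) = 1`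
(`IsHorizontalLift.translate_evol`). The pullback `ϑ ↦ ϑ(σ̇)` is a continuous linear map into
`C^∞([0,1], 𝔤)` (`AdForms.continuous_pull`), by the chain rule in charts of `TP`. So both parts of
the theorem follow from properties of the evolution map `evol`, which sends `f` in `C^∞([0,1], 𝔤)`
to the solution `g` of `ġ g⁻¹ = f`, `g(0) = 1`: it exists, it is smooth, also after evaluation at
the end point, and its derivative at `0` is `f ↦ ∫₀ᵗ f` (`exists_isEvolution`, `bastianiOn_evol`,
`bastianiOn_evol_end`, `hasDerivAt_evol`).

For `f` small in the supremum norm, `g` stays in the chart of `G` at `1`, where the equation reads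
`ẋ = V(x) f`. Superposition operators are smooth on the Banach space of continuous paths
(`contDiffOn_superpose`), so the inverse function theorem at `f = 0`, applied to the integral
equation, yields a solution that depends smoothly on `f` (`exists_controlled_solution`). Arbitrary
`f` are reached by the product rule: if `g` belongs to `f` and `h` to `Ad(g⁻¹) k`, then `g h` belongs
to `f + k`. As `Ad` is bounded on the compact group `G`, finitely many small steps suffice; the same
rule carries the smoothness at `0` to every `f`. Uniqueness holds because a path in `G` with
vanishing logarithmic derivative is constant.

Smoothness into a Fréchet space of smooth paths is reduced to Banach spaces: `C^∞([0,1], W)` is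
closed in the product of countably many copies of `C([0,1], W)`, by means of all derivatives
(`SmoothPaths.isClosedEmbedding_jet`), and the time derivatives of a solution are superpositions of
the solution and the derivatives of `f` (`PathSmoothOn.superpose`).

The existence of a single horizontal lift needs, in addition, a smooth section of the pulled back
bundle, which is extended step by step through trivializations (`exists_isLiftUpTo_one`).
-/

universe u'

noncomputable section

/-! ### Calculus of Michal–Bastiani smooth maps -/

section BastianiCalculus

section Algebraic

variable {E : Type*} [AddCommGroup E] [Module ℝ E]
  {F F' : Type*} [AddCommGroup F] [Module ℝ F] [TopologicalSpace F]
  [AddCommGroup F'] [Module ℝ F'] [TopologicalSpace F']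

theorem HasDirDeriv.unique [T2Space F] {f : E → F} {x v : E} {y z : F}
    (h : HasDirDeriv f x v y) (h' : HasDirDeriv f x v z) : y = z :=
  tendsto_nhds_unique h h'

theorem HasDirDeriv.clm_comp {f : E → F} {x v : E} {y : F} (L : F →L[ℝ] F')
    (h : HasDirDeriv f x v y) : HasDirDeriv (fun z => L (f z)) x v (L y) := by
  have := (L.continuous.tendsto y).comp h
  simpa [HasDirDeriv, Function.comp_def] using this

theorem HasDirDeriv.prodMk {f : E → F} {g : E → F'} {x v : E} {y : F} {z : F'}
    (hf : HasDirDeriv f x v y) (hg : HasDirDeriv g x v z) :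
    HasDirDeriv (fun a => (f a, g a)) x v (y, z) :=
  Tendsto.prodMk_nhds hf hg

theorem HasDirDeriv.pi {ι : Type*} {F : ι → Type*} [∀ i, AddCommGroup (F i)]
    [∀ i, Module ℝ (F i)] [∀ i, TopologicalSpace (F i)] {f : E → ∀ i, F i} {x v : E}
    {y : ∀ i, F i} (h : ∀ i, HasDirDeriv (fun a => f a i) x v (y i)) : HasDirDeriv f x v y :=
  tendsto_pi_nhds.2 fun i => h i

theorem hasDirDeriv_iff_hasDerivAt {W : Type*} [NormedAddCommGroup W] [NormedSpace ℝ W]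
    {f : E → W} {x v : E} {y : W} :
    HasDirDeriv f x v y ↔ HasDerivAt (fun s : ℝ => f (x + s • v)) y 0 := by
  rw [hasDerivAt_iff_tendsto_slope]
  simp [HasDirDeriv, slope_fun_def]

theorem HasDirDeriv.congr_of_eventually {f g : E → F} {x v : E} {y : F}
    (h : HasDirDeriv f x v y) (he : ∀ᶠ s : ℝ in 𝓝 0, f (x + s • v) = g (x + s • v)) :
    HasDirDeriv g x v y := by
  have h0 := he.self_of_nhds
  simp only [zero_smul, add_zero] at h0
  refine Tendsto.congr' ?_ h
  filter_upwards [he.filter_mono nhdsWithin_le_nhds] with s hs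
  rw [hs, h0]

end Algebraic

section Lines

variable {E : Type*} [AddCommGroup E] [Module ℝ E] [TopologicalSpace E] [ContinuousAdd E]
  [ContinuousSMul ℝ E]

theorem IsOpen.eventually_line_mem {U : Set E} (hU : IsOpen U) {x : E} (hx : x ∈ U) (v : E) :
    ∀ᶠ s : ℝ in 𝓝 0, x + s • v ∈ U := by
  have h : Continuous fun s : ℝ => x + s • v := by fun_prop
  exact (h.tendsto 0).eventually (hU.mem_nhds (by simpa using hx))

end Lines

section General

variable {F : Type*} [AddCommGroup F] [Module ℝ F] [TopologicalSpace F]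

theorem BastianiOn.continuousOn {E : Type u} [AddCommGroup E] [Module ℝ E] [TopologicalSpace E]
    {n : ℕ} {f : E → F} {U : Set E} (h : BastianiOn n f U) : ContinuousOn f U := by
  cases n with
  | zero => exact h
  | succ n => exact h.1

theorem BastianiOn.of_succ {n : ℕ} : ∀ {E : Type u} [AddCommGroup E] [Module ℝ E]
    [TopologicalSpace E] {f : E → F} {U : Set E}, BastianiOn (n + 1) f U → BastianiOn n f U := by
  induction n with
  | zero => intro E _ _ _ f U h; exact h.1
  | succ n ih =>
    intro E _ _ _ f U ⟨h1, df, h2, h3⟩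
    exact ⟨h1, df, h2, ih h3⟩

theorem BastianiOn.mono {n : ℕ} : ∀ {E : Type u} [AddCommGroup E] [Module ℝ E]
    [TopologicalSpace E] {f : E → F} {U V : Set E}, BastianiOn n f U → V ⊆ U →
    BastianiOn n f V := by
  induction n with
  | zero => intro E _ _ _ f U V h hV; exact ContinuousOn.mono h hV
  | succ n ih =>
    intro E _ _ _ f U V ⟨h1, df, h2, h3⟩ hV
    exact ⟨h1.mono hV, df, fun x hx v => h2 x (hV hx) v, ih h3 (prod_mono hV subset_rfl)⟩

/-- Precomposition with a continuous linear map. Addition and scalar multiplication need not be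
continuous in the domain. -/
theorem BastianiOn.comp_clm {n : ℕ} : ∀ {E : Type u} [AddCommGroup E] [Module ℝ E]
    [TopologicalSpace E] {E' : Type u'} [AddCommGroup E'] [Module ℝ E'] [TopologicalSpace E']
    {f : E → F} {U : Set E}, BastianiOn n f U → ∀ L : E' →L[ℝ] E,
    BastianiOn n (fun x => f (L x)) (L ⁻¹' U) := by
  induction n with
  | zero =>
    intro E _ _ _ E' _ _ _ f U h L
    exact ContinuousOn.comp h L.continuous.continuousOn fun x hx => hx
  | succ n ih =>
    intro E _ _ _ E' _ _ _ f U ⟨h1, df, h2, h3⟩ L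
    refine ⟨ContinuousOn.comp h1 L.continuous.continuousOn fun x hx => hx,
      fun p => df (L p.1, L p.2), fun x hx v => ?_, ih h3 (L.prodMap L)⟩
    have := h2 _ hx (L v)
    simpa [HasDirDeriv] using this

theorem BastianiOn.clm_comp {F' : Type*} [AddCommGroup F'] [Module ℝ F'] [TopologicalSpace F']
    (L : F →L[ℝ] F') {n : ℕ} : ∀ {E : Type u} [AddCommGroup E] [Module ℝ E]
    [TopologicalSpace E] {f : E → F} {U : Set E}, BastianiOn n f U →
    BastianiOn n (fun x => L (f x)) U := by
  induction n with
  | zero => intro E _ _ _ f U h; exact L.continuous.comp_continuousOn h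
  | succ n ih =>
    intro E _ _ _ f U ⟨h1, df, h2, h3⟩
    exact ⟨L.continuous.comp_continuousOn h1, fun p => L (df p),
      fun x hx v => (h2 x hx v).clm_comp L, ih h3⟩

theorem BastianiOn.prodMk {F' : Type*} [AddCommGroup F'] [Module ℝ F'] [TopologicalSpace F']
    {n : ℕ} : ∀ {E : Type u} [AddCommGroup E] [Module ℝ E] [TopologicalSpace E] {f : E → F}
    {g : E → F'} {U : Set E}, BastianiOn n f U → BastianiOn n g U →
    BastianiOn n (fun x => (f x, g x)) U := by
  induction n with
  | zero => intro E _ _ _ f g U h h'; exact ContinuousOn.prodMk h h'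
  | succ n ih =>
    intro E _ _ _ f g U ⟨h1, df, h2, h3⟩ ⟨h1', df', h2', h3'⟩
    exact ⟨h1.prodMk h1', fun p => (df p, df' p),
      fun x hx v => (h2 x hx v).prodMk (h2' x hx v), ih h3 h3'⟩

theorem BastianiOn.pi {ι : Type*} {F : ι → Type*} [∀ i, AddCommGroup (F i)]
    [∀ i, Module ℝ (F i)] [∀ i, TopologicalSpace (F i)] {n : ℕ} :
    ∀ {E : Type u} [AddCommGroup E] [Module ℝ E] [TopologicalSpace E] {f : E → ∀ i, F i}
    {U : Set E}, (∀ i, BastianiOn n (fun x => f x i) U) → BastianiOn n f U := by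
  induction n with
  | zero => intro E _ _ _ f U h; exact continuousOn_pi.2 h
  | succ n ih =>
    intro E _ _ _ f U h
    choose h1 df h2 h3 using h
    exact ⟨continuousOn_pi.2 h1, fun p i => df i p,
      fun x hx v => HasDirDeriv.pi fun i => h2 i x hx v, ih h3⟩

theorem ContinuousLinearMap.bastianiOn {n : ℕ} : ∀ {E : Type u} [AddCommGroup E] [Module ℝ E]
    [TopologicalSpace E] (L : E →L[ℝ] F) (U : Set E), BastianiOn n L U := by
  induction n with
  | zero => intro E _ _ _ L U; exact L.continuous.continuousOn
  | succ n ih =>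
    intro E _ _ _ L U
    refine ⟨L.continuous.continuousOn, fun p => L p.2, fun x hx v => ?_,
      ih (L.comp (ContinuousLinearMap.snd ℝ E E)) _⟩
    refine Tendsto.congr' ?_ tendsto_const_nhds
    filter_upwards [self_mem_nhdsWithin] with s hs
    rw [map_add, add_sub_cancel_left, map_smul, smul_smul, inv_mul_cancel₀ hs, one_smul]

/-- The chain rule for a smooth map between normed spaces after a Bastiani smooth map. -/
theorem ContDiffOn.comp_bastianiOn {W W' : Type*} [NormedAddCommGroup W] [NormedSpace ℝ W]
    [NormedAddCommGroup W'] [NormedSpace ℝ W'] {n : ℕ} {N : W → W'} {O : Set W}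
    (hN : ContDiffOn ℝ ∞ N O) (hO : IsOpen O) :
    ∀ {E : Type u} [AddCommGroup E] [Module ℝ E] [TopologicalSpace E] {f : E → W} {U : Set E},
    BastianiOn n f U → MapsTo f U O → BastianiOn n (fun x => N (f x)) U := by
  induction n generalizing W with
  | zero => intro E _ _ _ f U h hU; exact hN.continuousOn.comp h hU
  | succ n ih =>
    intro E _ _ _ f U h hU
    have hmono := h.of_succ
    obtain ⟨h1, df, h2, h3⟩ := h
    refine ⟨hN.continuousOn.comp h1 hU, fun p => fderiv ℝ N (f p.1) (df p), fun x hx v => ?_, ?_⟩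
    · have hd := hasDirDeriv_iff_hasDerivAt.1 (h2 x hx v)
      have hNd : HasFDerivAt N (fderiv ℝ N (f x)) (f (x + (0 : ℝ) • v)) := by
        rw [zero_smul, add_zero]
        exact ((hN.contDiffAt (hO.mem_nhds (hU hx))).differentiableAt (by simp)).hasFDerivAt
      exact hasDirDeriv_iff_hasDerivAt.2 (hNd.comp_hasDerivAt (0 : ℝ) hd)
    · have hpair : BastianiOn n (fun p : E × E => (f p.1, df p)) (U ×ˢ univ) :=
        ((hmono.comp_clm (ContinuousLinearMap.fst ℝ E E)).mono fun p hp => hp.1).prodMk h3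
      have hder : ContDiffOn ℝ ∞ (fun p : W × W => fderiv ℝ N p.1 p.2) (O ×ˢ univ) := by
        have : ContDiffOn ℝ ∞ (fderiv ℝ N) O := hN.fderiv_of_isOpen hO (by simp)
        exact (this.comp contDiffOn_fst fun p hp => hp.1).clm_apply contDiffOn_snd
      exact ih hder (hO.prod isOpen_univ) hpair fun p hp => ⟨hU hp.1, mem_univ _⟩

theorem BastianiOn.congr {n : ℕ} : ∀ {E : Type u} [AddCommGroup E] [Module ℝ E]
    [TopologicalSpace E] [ContinuousAdd E] [ContinuousSMul ℝ E] {f g : E → F} {U : Set E},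
    BastianiOn n f U → IsOpen U → EqOn f g U → BastianiOn n g U := by
  intro E _ _ _ _ _ f g U h hU he
  cases n with
  | zero => exact ContinuousOn.congr h he.symm
  | succ n =>
    obtain ⟨h1, df, h2, h3⟩ := h
    refine ⟨h1.congr he.symm, df, fun x hx v => (h2 x hx v).congr_of_eventually ?_, h3⟩
    exact (hU.eventually_line_mem hx v).mono fun s hs => he hs

/-- Bastiani smoothness is a local property: the derivatives found locally agree on overlaps, since
limits are unique. -/
theorem BastianiOn.of_locally [T2Space F] {n : ℕ} : ∀ {E : Type u} [AddCommGroup E] [Module ℝ E]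
    [TopologicalSpace E] [ContinuousAdd E] [ContinuousSMul ℝ E] {f : E → F} {U : Set E},
    (∀ x ∈ U, ∃ V ⊆ U, IsOpen V ∧ x ∈ V ∧ BastianiOn n f V) → BastianiOn n f U := by
  induction n with
  | zero =>
    intro E _ _ _ _ _ f U h x hx
    obtain ⟨V, -, hV, hxV, hf⟩ := h x hx
    exact (ContinuousOn.continuousAt hf (hV.mem_nhds hxV)).continuousWithinAt
  | succ n ih =>
    intro E _ _ _ _ _ f U h
    have hex : ∀ p : E × E, ∃ y, p.1 ∈ U → HasDirDeriv f p.1 p.2 y := fun p => by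
      by_cases hp : p.1 ∈ U
      · obtain ⟨V, -, hV, hxV, -, df, h2, -⟩ := h _ hp
        exact ⟨df p, fun _ => h2 p.1 hxV p.2⟩
      · exact ⟨0, fun h => absurd h hp⟩
    choose df hdf using hex
    refine ⟨fun x hx => ?_, df, fun x hx v => hdf (x, v) hx, ih fun p hp => ?_⟩
    · obtain ⟨V, -, hV, hxV, hf⟩ := h x hx
      exact (hf.1.continuousAt (hV.mem_nhds hxV)).continuousWithinAt
    · obtain ⟨V, hVU, hV, hxV, -, df', h2, h3⟩ := h p.1 hp.1
      refine ⟨V ×ˢ univ, prod_mono hVU subset_rfl, hV.prod isOpen_univ, ⟨hxV, mem_univ _⟩,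
        h3.congr (hV.prod isOpen_univ) fun q hq => ?_⟩
      exact (h2 q.1 hq.1 q.2).unique (hdf q (hVU hq.1))

/-- A map into a closed subspace is Bastiani smooth if it is so as a map into the ambient
space: the difference quotients converge in the ambient space, hence in the subspace. -/
theorem BastianiOn.of_isClosedEmbedding {F' : Type*} [AddCommGroup F'] [Module ℝ F']
    [TopologicalSpace F'] {J : F →ₗ[ℝ] F'} (hJ : IsClosedEmbedding J) {n : ℕ} :
    ∀ {E : Type u} [AddCommGroup E] [Module ℝ E]
    [TopologicalSpace E] [ContinuousAdd E] [ContinuousSMul ℝ E] {f : E → F} {U : Set E},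
    IsOpen U → BastianiOn n (fun x => J (f x)) U → BastianiOn n f U := by
  induction n with
  | zero => intro E _ _ _ _ _ f U _ h; exact hJ.isInducing.continuousOn_iff.2 h
  | succ n ih =>
    intro E _ _ _ _ _ f U hU ⟨h1, df, h2, h3⟩
    have hquot : ∀ x v (s : ℝ), s⁻¹ • (J (f (x + s • v)) - J (f x)) =
        J (s⁻¹ • (f (x + s • v) - f x)) := fun x v s => by rw [map_smul, map_sub]
    have hmem : ∀ p : E × E, ∃ y, p.1 ∈ U → J y = df p := fun p => by
      by_cases hp : p.1 ∈ U
      · have : df p ∈ range J := hJ.isClosed_range.mem_of_tendsto (h2 p.1 hp p.2)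
          (Eventually.of_forall fun s => ⟨_, (hquot p.1 p.2 s).symm⟩)
        exact this.imp fun y hy _ => hy
      · exact ⟨0, fun h => absurd h hp⟩
    choose df' hdf' using hmem
    refine ⟨hJ.isInducing.continuousOn_iff.2 h1, df', fun x hx v => ?_,
      ih (hU.prod isOpen_univ) (h3.congr (hU.prod isOpen_univ) fun p hp => (hdf' p hp.1).symm)⟩
    have := h2 x hx v
    rw [← hdf' (x, v) hx] at this
    simp only [HasDirDeriv, hquot] at this
    exact hJ.isInducing.tendsto_nhds_iff.2 this

end General

end BastianiCalculus

/-! ### The Fréchet space of smooth paths in a vector space -/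

section SmoothPathSpace

local notation "I01" => unitInterval

theorem extPath_coe {X : Type*} (q : I01 → X) (t : I01) : extPath q t = q t := by
  simp [extPath]

theorem extPath_of_mem {X : Type*} (q : I01 → X) {t : ℝ} (ht : t ∈ Icc (0 : ℝ) 1) :
    extPath q t = q ⟨t, ht⟩ := IccExtend_of_mem _ _ ht

theorem uniqueDiffOn_unitInterval : UniqueDiffOn ℝ (Icc (0 : ℝ) 1) :=
  uniqueDiffOn_Icc zero_lt_one

variable {W : Type*} [NormedAddCommGroup W] [NormedSpace ℝ W]

theorem continuous_extPath {X : Type*} [TopologicalSpace X] (q : C(I01, X)) :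
    Continuous (extPath q) :=
  q.continuous.Icc_extend'

variable (W) in
/-- The operator `q ↦ ∫₀ᵗ q` on continuous paths. -/
def pathPrimitive : C(I01, W) →L[ℝ] C(I01, W) :=
  LinearMap.mkContinuous
    { toFun := fun q => ⟨fun t => ∫ τ in (0 : ℝ)..t, extPath q τ, by
        exact (intervalIntegral.continuous_primitive
          (fun a b => (continuous_extPath q).intervalIntegrable a b) 0).comp continuous_subtype_val⟩
      map_add' := fun q r => by
        ext t
        exact intervalIntegral.integral_add ((continuous_extPath q).intervalIntegrable _ _)
          ((continuous_extPath r).intervalIntegrable _ _)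
      map_smul' := fun c q => by
        ext t
        exact intervalIntegral.integral_smul c _ } 1 fun q => by
    rw [one_mul]
    refine (ContinuousMap.norm_le _ (norm_nonneg _)).2 fun t => ?_
    refine (intervalIntegral.norm_integral_le_of_norm_le_const (C := ‖q‖) fun τ _ =>
      q.norm_coe_le_norm _).trans ?_
    rw [sub_zero, abs_of_nonneg t.2.1]
    exact mul_le_of_le_one_right (norm_nonneg _) t.2.2

theorem pathPrimitive_apply (q : C(I01, W)) (t : I01) :
    pathPrimitive W q t = ∫ τ in (0 : ℝ)..t, extPath q τ := rfl

theorem hasDerivWithinAt_pathPrimitive [CompleteSpace W] (q : C(I01, W)) (t : I01) :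
    HasDerivWithinAt (extPath (pathPrimitive W q)) (q t) (Icc 0 1) t := by
  have h : HasDerivAt (fun s => ∫ τ in (0 : ℝ)..s, extPath q τ) (extPath q t) t :=
    ((continuous_extPath q).integral_hasStrictDerivAt 0 t).hasDerivAt
  rw [extPath_coe] at h
  exact h.hasDerivWithinAt.congr (fun s hs => extPath_of_mem _ hs) (extPath_of_mem _ t.2)

/-- The fundamental theorem of calculus, as an equation between continuous paths. -/
theorem hasDerivWithinAt_extPath_iff [CompleteSpace W] {q q' : C(I01, W)} :
    (∀ t : I01, HasDerivWithinAt (extPath q) (q' t) (Icc 0 1) t) ↔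
      ∀ t : I01, q t = q 0 + pathPrimitive W q' t := by
  constructor
  · intro h t
    rw [pathPrimitive_apply, intervalIntegral.integral_eq_sub_of_hasDeriv_right_of_le t.2.1
      (continuous_extPath q).continuousOn (fun x hx => ?_)
      ((continuous_extPath q').intervalIntegrable _ _) (f := extPath q)]
    · have := extPath_coe q 0
      rw [Icc.coe_zero] at this
      rw [extPath_coe, this]; abel
    · have hx1 : x ∈ Icc (0 : ℝ) 1 := ⟨hx.1.le, hx.2.le.trans t.2.2⟩
      rw [extPath_of_mem _ hx1]
      refine (h ⟨x, hx1⟩).mono_of_mem_nhdsWithin ?_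
      exact mem_nhdsWithin.2 ⟨Ioo 0 1, isOpen_Ioo, ⟨hx.1, hx.2.trans_le t.2.2⟩,
        fun y hy => ⟨hy.1.1.le, hy.1.2.le⟩⟩
  · intro h t
    refine ((hasDerivWithinAt_pathPrimitive q' t).const_add (q 0)).congr (fun s hs => ?_) ?_
    · rw [extPath_of_mem _ hs, h, extPath_of_mem _ hs]
    · rw [extPath_coe, h, extPath_coe]

theorem continuous_path_of_smooth {f : I01 → W} (hf : ContDiffOn ℝ ∞ (extPath f) (Icc 0 1))
    (k : ℕ) : Continuous fun t : I01 => iteratedDerivWithin k (extPath f) (Icc 0 1) (t : ℝ) :=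
  (hf.continuousOn_iteratedDerivWithin (by exact_mod_cast le_top) uniqueDiffOn_unitInterval)
    |>.comp_continuous continuous_subtype_val fun t => t.2

/-- A path with continuous successive derivatives `q 0, q 1, …` is smooth. -/
theorem smooth_of_derivatives {q : ℕ → C(I01, W)}
    (h : ∀ k, ∀ t : I01, HasDerivWithinAt (extPath (q k)) (q (k + 1) t) (Icc 0 1) t) :
    ContDiffOn ℝ ∞ (extPath (q 0)) (Icc 0 1) ∧
      ∀ k, EqOn (iteratedDerivWithin k (extPath (q 0)) (Icc 0 1)) (extPath (q k)) (Icc 0 1) := by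
  have key : ∀ k, EqOn (iteratedDerivWithin k (extPath (q 0)) (Icc 0 1)) (extPath (q k))
      (Icc 0 1) := by
    intro k
    induction k with
    | zero => intro t _; rw [iteratedDerivWithin_zero]
    | succ k ih =>
      intro t ht
      rw [iteratedDerivWithin_succ, derivWithin_congr ih (ih ht), extPath_of_mem _ ht]
      exact (h k ⟨t, ht⟩).derivWithin (uniqueDiffOn_unitInterval t ht)
  refine ⟨contDiffOn_of_differentiableOn_deriv fun k _ => ?_, key⟩
  refine DifferentiableOn.congr (fun t ht => ?_) (key k)
  exact (h k ⟨t, ht⟩).differentiableWithinAt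

variable (W)

/-- The embedding of `C^∞([0,1], W)` into a product of Banach spaces by all derivatives. -/
def SmoothPaths.jet : SmoothPaths W →ₗ[ℝ] ℕ → C(I01, W) where
  toFun f k := ⟨fun t => iteratedDerivWithin k (extPath f) (Icc 0 1) (t : ℝ),
    continuous_path_of_smooth f.2 k⟩
  map_add' f g := by
    funext k
    ext t
    have hk : ((k : ℕ) : ℕ∞ω) ≤ ∞ := by exact_mod_cast le_top
    exact iteratedDerivWithin_add t.2 uniqueDiffOn_unitInterval
      ((f.2.contDiffWithinAt t.2).of_le hk) ((g.2.contDiffWithinAt t.2).of_le hk)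
  map_smul' c f := by
    funext k
    ext t
    have hk : ((k : ℕ) : ℕ∞ω) ≤ ∞ := by exact_mod_cast le_top
    exact iteratedDerivWithin_const_smul t.2 uniqueDiffOn_unitInterval c
      ((f.2.contDiffWithinAt t.2).of_le hk)

variable {W}

theorem SmoothPaths.jet_apply (f : SmoothPaths W) (k : ℕ) (t : I01) :
    jet W f k t = iteratedDerivWithin k (extPath f) (Icc 0 1) (t : ℝ) := rfl

theorem SmoothPaths.jet_zero_apply (f : SmoothPaths W) (t : I01) : jet W f 0 t = f t := by
  rw [jet_apply, iteratedDerivWithin_zero, extPath_coe]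

theorem SmoothPaths.ext {f g : SmoothPaths W} (h : ∀ t, f t = g t) : f = g :=
  Subtype.ext (funext h)

theorem SmoothPaths.hasDerivWithinAt_jet (f : SmoothPaths W) (k : ℕ) (t : I01) :
    HasDerivWithinAt (extPath (jet W f k)) (jet W f (k + 1) t) (Icc 0 1) t := by
  have h1 := ((f.2.differentiableOn_iteratedDerivWithin (m := k)
    (by exact_mod_cast ENat.natCast_lt_top k) uniqueDiffOn_unitInterval) t t.2).hasDerivWithinAt
  rw [← iteratedDerivWithin_succ] at h1
  exact h1.congr (fun s hs => extPath_of_mem _ hs) (extPath_of_mem _ t.2)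

theorem isInducing_toUniformFun {X : Type*} [UniformSpace X] :
    IsInducing (fun q : C(I01, X) => UniformFun.ofFun (q : I01 → X)) := by
  rw [isInducing_iff_nhds]
  intro q
  apply le_antisymm
  · rw [← tendsto_iff_comap, UniformFun.tendsto_iff_tendstoUniformly]
    exact ContinuousMap.tendsto_iff_tendstoUniformly.1 tendsto_id
  · rw [← tendsto_id', ContinuousMap.tendsto_iff_tendstoUniformly]
    exact UniformFun.tendsto_iff_tendstoUniformly.1 tendsto_comap

theorem SmoothPaths.isInducing_jet : IsInducing (jet W) := by
  refine ⟨?_⟩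
  rw [Pi.topologicalSpace, induced_iInf]
  refine iInf_congr fun k => ?_
  rw [isInducing_toUniformFun.eq_induced, induced_compose, induced_compose]
  rfl

/-- The range of `jet` consists of the sequences `q` with `q k t = q k 0 + ∫₀ᵗ q (k + 1)`, which is a
closed condition. -/
theorem SmoothPaths.isClosedEmbedding_jet [CompleteSpace W] : IsClosedEmbedding (jet W) := by
  refine ⟨⟨isInducing_jet, fun f g h => ext fun t => ?_⟩, ?_⟩
  · rw [← jet_zero_apply, h, jet_zero_apply]
  · have : range (jet W) = ⋂ k, {q : ℕ → C(I01, W) |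
        ∀ t, q k t = q k 0 + pathPrimitive W (q (k + 1)) t} := by
      ext q
      simp only [mem_iInter, mem_ofPred_eq]
      simp_rw [← hasDerivWithinAt_extPath_iff]
      constructor
      · rintro ⟨f, rfl⟩ k t
        exact f.hasDerivWithinAt_jet k t
      · intro h
        obtain ⟨h1, h2⟩ := smooth_of_derivatives h
        refine ⟨⟨q 0, h1⟩, ?_⟩
        funext k
        ext t
        exact (h2 k t.2).trans (extPath_coe _ t)
    rw [this]
    refine isClosed_iInter fun k => ?_
    simp only [ofPred_forall]
    refine isClosed_iInter fun t => isClosed_eq ?_ ?_ <;> fun_prop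

instance : IsTopologicalAddGroup (SmoothPaths W) := by
  rw [SmoothPaths.isInducing_jet.eq_induced]
  exact topologicalAddGroup_induced (SmoothPaths.jet W)

instance : ContinuousSMul ℝ (SmoothPaths W) := by
  rw [SmoothPaths.isInducing_jet.eq_induced]
  exact continuousSMul_induced (SmoothPaths.jet W)

instance [CompleteSpace W] : T2Space (SmoothPaths W) :=
  SmoothPaths.isClosedEmbedding_jet.isEmbedding.t2Space

end SmoothPathSpace

/-! ### Superposition operators on continuous paths -/

section Superposition

local notation "I01" => unitInterval

/-- The part of `Ω ⊆ ℝ × W` over the time interval `[0,1]`. -/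
def timeSlab {W : Type*} (Ω : Set (ℝ × W)) : Set (ℝ × W) := Ω ∩ Icc (0 : ℝ) 1 ×ˢ univ

/-- The paths whose graph lies in `Ω`. -/
def graphIn {W : Type*} [TopologicalSpace W] (Ω : Set (ℝ × W)) : Set C(I01, W) :=
  {q | ∀ t : I01, ((t : ℝ), q t) ∈ Ω}

open Classical in
/-- The superposition operator `q ↦ Ψ(·, q(·))` on continuous paths, with junk value `0` where
the resulting path is not continuous. -/
def superpose {W W' : Type*} [TopologicalSpace W] [NormedAddCommGroup W'] (Ψ : ℝ × W → W')
    (q : C(I01, W)) : C(I01, W') :=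
  if h : Continuous fun t : I01 => Ψ (t, q t) then ⟨_, h⟩ else 0

theorem uniqueDiffOn_timeSlab {W : Type*} [NormedAddCommGroup W] [NormedSpace ℝ W]
    {Ω : Set (ℝ × W)} (hΩ : IsOpen Ω) : UniqueDiffOn ℝ (timeSlab Ω) := by
  rw [timeSlab, inter_comm]
  exact (uniqueDiffOn_unitInterval.prod uniqueDiffOn_univ).inter hΩ

theorem mem_timeSlab {W : Type*} [TopologicalSpace W] {Ω : Set (ℝ × W)} {q : C(I01, W)}
    (hq : q ∈ graphIn Ω) (t : I01) : ((t : ℝ), q t) ∈ timeSlab Ω := ⟨hq t, t.2, mem_univ _⟩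

theorem isOpen_graphIn {W : Type*} [TopologicalSpace W] {Ω : Set (ℝ × W)} (hΩ : IsOpen Ω) :
    IsOpen (graphIn Ω) := by
  have h : Continuous fun q : C(I01, W) =>
      ContinuousMap.prodMk (⟨((↑) : I01 → ℝ), continuous_subtype_val⟩ : C(I01, ℝ)) q :=
    ContinuousMap.continuous_of_continuous_uncurry _ (by
      change Continuous fun p : C(I01, W) × I01 => ((p.2 : ℝ), p.1 p.2)
      fun_prop)
  have := (ContinuousMap.isOpen_setOfPred_mapsTo (isCompact_univ : IsCompact (univ : Set I01))
    hΩ).preimage h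
  convert this using 1
  ext q
  simp [graphIn, MapsTo]

variable {W W' : Type u} [NormedAddCommGroup W] [NormedSpace ℝ W]
  [NormedAddCommGroup W'] [NormedSpace ℝ W']

theorem superpose_apply {W W' : Type*} [TopologicalSpace W] [NormedAddCommGroup W']
    {Ψ : ℝ × W → W'} {Ω : Set (ℝ × W)} (hΨ : ContinuousOn Ψ (timeSlab Ω))
    {q : C(I01, W)} (hq : q ∈ graphIn Ω) (t : I01) : superpose Ψ q t = Ψ (t, q t) := by
  have h : Continuous fun t : I01 => Ψ (t, q t) :=
    hΨ.comp_continuous (by fun_prop) fun t => mem_timeSlab hq t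
  rw [superpose, dif_pos h]
  rfl

theorem continuousOn_superpose {W W' : Type*} [TopologicalSpace W] [NormedAddCommGroup W']
    {Ψ : ℝ × W → W'} {Ω : Set (ℝ × W)}
    (hΨ : ContinuousOn Ψ (timeSlab Ω)) : ContinuousOn (superpose Ψ) (graphIn Ω) := by
  rw [continuousOn_iff_continuous_domRestrict]
  refine ContinuousMap.continuous_of_continuous_uncurry _ ?_
  have : (Function.uncurry fun (x : graphIn Ω) (y : I01) =>
      (graphIn Ω).domRestrict (superpose Ψ) x y) = fun p : graphIn Ω × I01 => Ψ (p.2, p.1.1 p.2) := by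
    funext p
    exact superpose_apply hΨ p.1.2 p.2
  rw [this]
  exact hΨ.comp_continuous (by fun_prop) fun p => mem_timeSlab p.1.2 p.2

/-- A shortcut: the general instance is found only after a long search. -/
instance : NormedAddCommGroup C(I01, W →L[ℝ] W') :=
  ContinuousMap.instNormedAddCommGroup (α := I01) (E := W →L[ℝ] W')

variable (W W') in
/-- Pointwise application of a path of operators to a path of vectors. -/
def pathApply : C(I01, W →L[ℝ] W') →L[ℝ] C(I01, W) →L[ℝ] C(I01, W') :=
  LinearMap.mkContinuous₂
    (LinearMap.mk₂ ℝ (fun (a : C(I01, W →L[ℝ] W')) (q : C(I01, W)) =>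
        (⟨fun t => a t (q t), by fun_prop⟩ : C(I01, W')))
      (fun a b q => by ext t; simp) (fun c a q => by ext t; simp)
      (fun a q r => by ext t; simp) (fun c a q => by ext t; simp)) 1 fun a q => by
    rw [one_mul]
    refine (ContinuousMap.norm_le _ (by positivity)).2 fun t => ?_
    exact ((a t).le_opNorm _).trans (mul_le_mul (a.norm_coe_le_norm t) (q.norm_coe_le_norm t)
      (norm_nonneg _) (norm_nonneg _))

@[simp] theorem pathApply_apply (a : C(I01, W →L[ℝ] W')) (q : C(I01, W)) (t : I01) :
    pathApply W W' a q t = a t (q t) := rfl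

/-- The partial derivative of `Ψ` in the space direction. -/
def spaceDeriv (Ψ : ℝ × W → W') (Ω : Set (ℝ × W)) (p : ℝ × W) : W →L[ℝ] W' :=
  (fderivWithin ℝ Ψ (timeSlab Ω) p).comp (ContinuousLinearMap.inr ℝ ℝ W)

theorem contDiffOn_spaceDeriv {Ψ : ℝ × W → W'} {Ω : Set (ℝ × W)} (hΩ : IsOpen Ω)
    (hΨ : ContDiffOn ℝ ∞ Ψ (timeSlab Ω)) : ContDiffOn ℝ ∞ (spaceDeriv Ψ Ω) (timeSlab Ω) :=
  (hΨ.fderivWithin (uniqueDiffOn_timeSlab hΩ) (by simp)).clm_comp contDiffOn_const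

theorem hasFDerivAt_slice {Ψ : ℝ × W → W'} {Ω : Set (ℝ × W)} (hΩ : IsOpen Ω)
    (hΨ : ContDiffOn ℝ ∞ Ψ (timeSlab Ω)) {t : ℝ} (ht : t ∈ Icc (0 : ℝ) 1) {w : W}
    (hw : (t, w) ∈ Ω) : HasFDerivAt (fun x => Ψ (t, x)) (spaceDeriv Ψ Ω (t, w)) w := by
  have h1 : HasFDerivWithinAt Ψ (fderivWithin ℝ Ψ (timeSlab Ω) (t, w)) (timeSlab Ω) (t, w) :=
    ((hΨ.differentiableOn (by simp)) (t, w) ⟨hw, ht, mem_univ _⟩).hasFDerivWithinAt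
  have h2 : HasFDerivAt (fun x : W => (t, x)) (ContinuousLinearMap.inr ℝ ℝ W) w :=
    hasFDerivAt_prodMk_right t w
  have hO : {x | (t, x) ∈ Ω} ∈ 𝓝 w :=
    (hΩ.preimage (by fun_prop : Continuous fun x : W => (t, x))).mem_nhds hw
  exact (h1.comp w (h2.hasFDerivWithinAt (s := {x | (t, x) ∈ Ω}))
    (fun x hx => ⟨hx, ht, mem_univ _⟩)).hasFDerivAt hO

/-- The mean value inequality at each time bounds the remainder, uniformly in the time because
`q ↦ ∂Ψ(·, q(·))` is continuous for the supremum norm. -/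
theorem hasFDerivAt_superpose {Ψ : ℝ × W → W'} {Ω : Set (ℝ × W)} (hΩ : IsOpen Ω)
    (hΨ : ContDiffOn ℝ ∞ Ψ (timeSlab Ω)) {q : C(I01, W)} (hq : q ∈ graphIn Ω) :
    HasFDerivAt (superpose Ψ) (pathApply W W' (superpose (spaceDeriv Ψ Ω) q)) q := by
  rw [hasFDerivAt_iff_isLittleO_nhds_zero, Asymptotics.isLittleO_iff]
  intro ε hε
  have hD := (contDiffOn_spaceDeriv hΩ hΨ).continuousOn
  have hcont := (continuousOn_superpose hD).continuousAt ((isOpen_graphIn hΩ).mem_nhds hq)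
  obtain ⟨δ, hδ, hball⟩ := Metric.eventually_nhds_iff_ball.1
    (((isOpen_graphIn hΩ).eventually_mem hq).and (hcont.eventually (Metric.ball_mem_nhds _ hε)))
  filter_upwards [Metric.ball_mem_nhds (0 : C(I01, W)) hδ] with v hv
  rw [mem_ball_zero_iff] at hv
  refine (ContinuousMap.norm_le _ (by positivity)).2 fun t => ?_
  -- Every point near `q t` is the value at `t` of a path near `q`.
  have hpt : ∀ x ∈ Metric.ball (q t) δ, ((t : ℝ), x) ∈ Ω ∧
      ‖spaceDeriv Ψ Ω (t, x) - spaceDeriv Ψ Ω (t, q t)‖ ≤ ε := by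
    intro x hx
    obtain ⟨h1, h2⟩ := hball (q + ContinuousMap.const I01 (x - q t)) (by
      rw [mem_ball_iff_norm, add_sub_cancel_left, ContinuousMap.norm_lt_iff _ hδ]
      intro s
      simpa using mem_ball_iff_norm.1 hx)
    refine ⟨by simpa using h1 t, ?_⟩
    have h3 := (ContinuousMap.norm_coe_le_norm _ t).trans (mem_ball_iff_norm.1 h2).le
    rw [ContinuousMap.sub_apply, superpose_apply hD h1, superpose_apply hD hq] at h3
    simpa using h3
  have hvt : ‖v t‖ < δ := (v.norm_coe_le_norm t).trans_lt hv
  have hqv : q + v ∈ graphIn Ω := (hball (q + v) (by simpa [mem_ball_iff_norm] using hv)).1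
  have := Convex.norm_image_sub_le_of_norm_hasFDerivWithin_le' (𝕜 := ℝ)
    (f := fun x => Ψ (t, x)) (s := Metric.ball (q t) δ) (φ := spaceDeriv Ψ Ω (t, q t))
    (fun x hx => (hasFDerivAt_slice hΩ hΨ t.2 (hpt x hx).1).hasFDerivWithinAt)
    (fun x hx => (hpt x hx).2) (convex_ball _ _) (Metric.mem_ball_self hδ)
    (y := q t + v t) (by simpa [mem_ball_iff_norm] using hvt)
  rw [add_sub_cancel_left] at this
  simp only [ContinuousMap.sub_apply, pathApply_apply, superpose_apply hD hq,
    superpose_apply hΨ.continuousOn hq, superpose_apply hΨ.continuousOn hqv,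
    ContinuousMap.add_apply]
  exact this.trans (by gcongr; exact v.norm_coe_le_norm t)

theorem differentiableAt_superpose {Ψ : ℝ × W → W'} {Ω : Set (ℝ × W)} (hΩ : IsOpen Ω)
    (hΨ : ContDiffOn ℝ ∞ Ψ (timeSlab Ω)) {q : C(I01, W)} (hq : q ∈ graphIn Ω) :
    DifferentiableAt ℝ (superpose Ψ) q :=
  (hasFDerivAt_superpose hΩ hΨ hq).differentiableAt

theorem fderiv_superpose_apply {Ψ : ℝ × W → W'} {Ω : Set (ℝ × W)} (hΩ : IsOpen Ω)
    (hΨ : ContDiffOn ℝ ∞ Ψ (timeSlab Ω)) {q : C(I01, W)} (hq : q ∈ graphIn Ω) (v : C(I01, W))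
    (t : I01) : fderiv ℝ (superpose Ψ) q v t = fderiv ℝ (fun x => Ψ (t, x)) (q t) (v t) := by
  rw [(hasFDerivAt_superpose hΩ hΨ hq).fderiv, pathApply_apply,
    superpose_apply (contDiffOn_spaceDeriv hΩ hΨ).continuousOn hq,
    (hasFDerivAt_slice hΩ hΨ t.2 (hq t)).fderiv]

set_option synthInstance.maxHeartbeats 200000 in
/-- Superposition with a smooth map is a smooth operator on continuous paths. -/
theorem contDiffOn_superpose {Ψ : ℝ × W → W'} {Ω : Set (ℝ × W)} (hΩ : IsOpen Ω)
    (hΨ : ContDiffOn ℝ ∞ Ψ (timeSlab Ω)) : ContDiffOn ℝ ∞ (superpose Ψ) (graphIn Ω) := by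
  refine contDiffOn_infty.2 fun n => ?_
  induction n generalizing W' with
  | zero => exact contDiffOn_zero.2 (continuousOn_superpose hΨ.continuousOn)
  | succ n ih =>
    rw [Nat.cast_add, Nat.cast_one, contDiffOn_succ_iff_fderiv_of_isOpen (isOpen_graphIn hΩ)]
    refine ⟨fun q hq => (hasFDerivAt_superpose hΩ hΨ hq).differentiableAt.differentiableWithinAt,
      by simp, ?_⟩
    refine ((pathApply W W').contDiff.comp_contDiffOn (ih (contDiffOn_spaceDeriv hΩ hΨ))).congr ?_
    exact fun q hq => (hasFDerivAt_superpose hΩ hΨ hq).fderiv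

end Superposition

/-! ### Smooth families of smooth paths -/

section PathFamilies

local notation "I01" => unitInterval

variable {E : Type u'} [AddCommGroup E] [Module ℝ E] [TopologicalSpace E]

/-- The family of paths `Q f`, `f ∈ U`, is Bastiani smooth as a family of continuous paths, and so
are the families of its first `m` time derivatives. -/
def PathSmoothOn {W : Type*} [NormedAddCommGroup W] [NormedSpace ℝ W] :
    ℕ → (E → C(I01, W)) → Set E → Prop
  | 0, Q, U => ∀ n, BastianiOn n Q U
  | m + 1, Q, U => (∀ n, BastianiOn n Q U) ∧ ∃ Q' : E → C(I01, W), PathSmoothOn m Q' U ∧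
      ∀ f ∈ U, ∀ t : I01, HasDerivWithinAt (extPath (Q f)) (Q' f t) (Icc 0 1) t

theorem PathSmoothOn.bastianiOn {W : Type*} [NormedAddCommGroup W] [NormedSpace ℝ W]
    {m : ℕ} {Q : E → C(I01, W)} {U : Set E} (h : PathSmoothOn m Q U) (n : ℕ) :
    BastianiOn n Q U := by
  cases m with
  | zero => exact h n
  | succ m => exact h.1 n

theorem PathSmoothOn.of_succ {W : Type*} [NormedAddCommGroup W] [NormedSpace ℝ W]
    {m : ℕ} : ∀ {Q : E → C(I01, W)} {U : Set E}, PathSmoothOn (m + 1) Q U →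
    PathSmoothOn m Q U := by
  induction m with
  | zero => intro Q U h; exact h.1
  | succ m ih =>
    intro Q U ⟨h, Q', h1, h2⟩
    exact ⟨h, Q', ih h1, h2⟩

theorem PathSmoothOn.mono {W : Type*} [NormedAddCommGroup W] [NormedSpace ℝ W]
    {m : ℕ} : ∀ {Q : E → C(I01, W)} {U V : Set E}, PathSmoothOn m Q U → V ⊆ U →
    PathSmoothOn m Q V := by
  induction m with
  | zero => intro Q U V h hV n; exact (h n).mono hV
  | succ m ih =>
    intro Q U V ⟨h, Q', h1, h2⟩ hV
    exact ⟨fun n => (h n).mono hV, Q', ih h1 hV, fun f hf => h2 f (hV hf)⟩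

/-- The path of pairs formed by two paths. -/
def pathPair (W W' : Type*) [NormedAddCommGroup W] [NormedSpace ℝ W]
    [NormedAddCommGroup W'] [NormedSpace ℝ W'] : C(I01, W) × C(I01, W') →L[ℝ] C(I01, W × W') :=
  LinearMap.mkContinuous
    { toFun := fun p => p.1.prodMk p.2
      map_add' := fun _ _ => rfl
      map_smul' := fun _ _ => rfl } 1 fun p => by
    rw [one_mul]
    refine (ContinuousMap.norm_le _ (norm_nonneg _)).2 fun t => ?_
    exact max_le_max (p.1.norm_coe_le_norm t) (p.2.norm_coe_le_norm t)

theorem PathSmoothOn.pair {W W' : Type*} [NormedAddCommGroup W] [NormedSpace ℝ W]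
    [NormedAddCommGroup W'] [NormedSpace ℝ W'] {m : ℕ} :
    ∀ {Q : E → C(I01, W)} {R : E → C(I01, W')} {U : Set E}, PathSmoothOn m Q U →
    PathSmoothOn m R U → PathSmoothOn m (fun f => pathPair W W' (Q f, R f)) U := by
  induction m with
  | zero => intro Q R U h h' n; exact ((h n).prodMk (h' n)).clm_comp _
  | succ m ih =>
    intro Q R U ⟨h, Q', h1, h2⟩ ⟨h', R', h1', h2'⟩
    exact ⟨fun n => ((h n).prodMk (h' n)).clm_comp _, _, ih h1 h1',
      fun f hf t => (h2 f hf t).prodMk (h2' f hf t)⟩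

/-- Smooth families of paths are stable under superposition with a smooth map. -/
theorem PathSmoothOn.superpose {W W' : Type u} [NormedAddCommGroup W] [NormedSpace ℝ W]
    [NormedAddCommGroup W'] [NormedSpace ℝ W'] {m : ℕ} {Ψ : ℝ × W → W'} {Ω : Set (ℝ × W)}
    (hΩ : IsOpen Ω) (hΨ : ContDiffOn ℝ ∞ Ψ (timeSlab Ω)) {Q : E → C(I01, W)} {U : Set E}
    (hQ : PathSmoothOn m Q U) (hU : MapsTo Q U (graphIn Ω)) :
    PathSmoothOn m (fun f => superpose Ψ (Q f)) U := by
  have h0 : ∀ n, BastianiOn n (fun f => _root_.superpose Ψ (Q f)) U := fun n =>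
    (contDiffOn_superpose hΩ hΨ).comp_bastianiOn (isOpen_graphIn hΩ) (hQ.bastianiOn n) hU
  induction m generalizing W with
  | zero => exact h0
  | succ m ih =>
    have hQm := hQ.of_succ
    obtain ⟨-, Q', h1, h2⟩ := hQ
    -- The time derivative of `Ψ(t, q)` is the superposition of `DΨ(t, q)(1, q')` with `(q, q')`.
    let Ω' : Set (ℝ × (W × W)) := {p | (p.1, p.2.1) ∈ Ω}
    have hΩ' : IsOpen Ω' :=
      hΩ.preimage (by fun_prop : Continuous fun p : ℝ × (W × W) => (p.1, p.2.1))
    let Ψ' : ℝ × (W × W) → W' := fun p =>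
      fderivWithin ℝ Ψ (timeSlab Ω) (p.1, p.2.1) ((1 : ℝ), p.2.2)
    have hΨ' : ContDiffOn ℝ ∞ Ψ' (timeSlab Ω') := by
      have hD := hΨ.fderivWithin (uniqueDiffOn_timeSlab hΩ) (m := ∞) (by simp)
      refine ContDiffOn.clm_apply (hD.comp (by fun_prop) fun p hp => ?_) (by fun_prop)
      exact ⟨hp.1, hp.2.1, mem_univ _⟩
    have hmaps : MapsTo (fun f => pathPair W W (Q f, Q' f)) U (graphIn Ω') := fun f hf t => hU hf t
    refine ⟨h0, _, ih hΩ' hΨ' (hQm.pair h1) hmaps fun n =>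
      (contDiffOn_superpose hΩ' hΨ').comp_bastianiOn (isOpen_graphIn hΩ')
        ((hQm.pair h1).bastianiOn n) hmaps, fun f hf t => ?_⟩
    rw [superpose_apply hΨ'.continuousOn (hmaps hf)]
    have hd : HasFDerivWithinAt Ψ (fderivWithin ℝ Ψ (timeSlab Ω) (t, Q f t)) (timeSlab Ω)
        ((t : ℝ), extPath (Q f) t) := by
      rw [extPath_coe]
      exact ((hΨ.differentiableOn (by simp)) _ (mem_timeSlab (hU hf) t)).hasFDerivWithinAt
    have hc : HasDerivWithinAt (fun s : ℝ => (s, extPath (Q f) s)) ((1 : ℝ), Q' f t) (Icc 0 1) t :=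
      (hasDerivWithinAt_id _ _).prodMk (h2 f hf t)
    have := hd.comp_hasDerivWithinAt (t : ℝ) hc fun s hs => by
      rw [extPath_of_mem _ hs]
      exact mem_timeSlab (hU hf) ⟨s, hs⟩
    refine this.congr (fun s hs => ?_) ?_
    · rw [extPath_of_mem _ hs, superpose_apply hΨ.continuousOn (hU hf), Function.comp_apply,
        extPath_of_mem _ hs]
    · rw [extPath_coe, superpose_apply hΨ.continuousOn (hU hf), Function.comp_apply, extPath_coe]

theorem PathSmoothOn.exists_iteratedDeriv {W : Type*} [NormedAddCommGroup W] [NormedSpace ℝ W]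
    {k : ℕ} : ∀ {Q : E → C(I01, W)} {U : Set E}, PathSmoothOn k Q U →
    ∃ R : E → C(I01, W), (∀ n, BastianiOn n R U) ∧ ∀ f ∈ U,
      EqOn (iteratedDerivWithin k (extPath (Q f)) (Icc 0 1)) (extPath (R f)) (Icc 0 1) := by
  induction k with
  | zero => intro Q U h; exact ⟨Q, h, fun f _ t _ => by rw [iteratedDerivWithin_zero]⟩
  | succ k ih =>
    intro Q U ⟨_, Q', h1, h2⟩
    obtain ⟨R, hR, hR'⟩ := ih h1
    refine ⟨R, hR, fun f hf t ht => ?_⟩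
    rw [iteratedDerivWithin_succ', ← hR' f hf ht]
    refine iteratedDerivWithin_congr (fun s hs => ?_) ht
    rw [(h2 f hf ⟨s, hs⟩).derivWithin (uniqueDiffOn_unitInterval s hs), extPath_of_mem _ hs]

/-- Families of paths all of whose time derivatives are smooth as families of continuous paths are
smooth as maps into the Fréchet space of smooth paths, as that is closed in a product of spaces of
continuous paths. -/
theorem bastianiOn_smoothPaths [ContinuousAdd E] [ContinuousSMul ℝ E] {W : Type*}
    [NormedAddCommGroup W] [NormedSpace ℝ W] [CompleteSpace W] {Q : E → C(I01, W)} {U : Set E}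
    (hU : IsOpen U) (hQ : ∀ m, PathSmoothOn m Q U) {F : E → SmoothPaths W}
    (hF : ∀ f ∈ U, ∀ t, F f t = Q f t) (n : ℕ) : BastianiOn n F U := by
  refine BastianiOn.of_isClosedEmbedding SmoothPaths.isClosedEmbedding_jet hU
    (BastianiOn.pi fun k => ?_)
  obtain ⟨R, hR, hR'⟩ := (hQ k).exists_iteratedDeriv
  refine (hR n).congr hU fun f hf => ?_
  ext t
  rw [SmoothPaths.jet_apply, show (F f : I01 → W) = Q f from funext (hF f hf), hR' f hf t.2,
    extPath_coe]

variable (W : Type*) [NormedAddCommGroup W] [NormedSpace ℝ W]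

/-- The continuous linear map sending a smooth path to its `k`-th derivative. -/
def SmoothPaths.deriv (k : ℕ) : SmoothPaths W →L[ℝ] C(I01, W) where
  toLinearMap := LinearMap.proj k ∘ₗ SmoothPaths.jet W
  cont := (continuous_apply k).comp SmoothPaths.isInducing_jet.continuous

variable {W}

theorem SmoothPaths.deriv_zero_apply (f : SmoothPaths W) (t : I01) : deriv W 0 f t = f t :=
  f.jet_zero_apply t

theorem SmoothPaths.pathSmoothOn_deriv (m k : ℕ) :
    PathSmoothOn m (SmoothPaths.deriv W k) univ := by
  induction m generalizing k with
  | zero => exact fun n => (deriv W k).bastianiOn _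
  | succ m ih => exact ⟨fun n => (deriv W k).bastianiOn _, _, ih (k + 1),
      fun f _ t => f.hasDerivWithinAt_jet k t⟩

end PathFamilies

/-! ### Velocities of paths in manifolds -/

section Velocity

variable {E : Type*} [NormedAddCommGroup E] [NormedSpace ℝ E]
  {N : Type*} [TopologicalSpace N] [ChartedSpace E N]
  {E' : Type*} [NormedAddCommGroup E'] [NormedSpace ℝ E']
  {N' : Type*} [TopologicalSpace N'] [ChartedSpace E' N']
  {E'' : Type*} [NormedAddCommGroup E''] [NormedSpace ℝ E'']
  {N'' : Type*} [TopologicalSpace N''] [ChartedSpace E'' N'']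

variable (E) in
/-- The path `c`, restricted to `[0,1]`, has velocity `v` at time `t`. All tangent spaces are
identified with the model space, by the preferred charts. -/
def HasVelocity (c : ℝ → N) (v : E) (t : ℝ) : Prop :=
  HasMFDerivWithinAt 𝓘(ℝ, ℝ) 𝓘(ℝ, E) c (Icc 0 1) t
    (ContinuousLinearMap.toSpanSingleton ℝ v : ℝ →L[ℝ] E)

theorem uniqueMDiffOn_unitInterval : UniqueMDiffOn 𝓘(ℝ, ℝ) (Icc (0 : ℝ) 1) :=
  uniqueDiffOn_unitInterval.uniqueMDiffOn

theorem MDifferentiableWithinAt.hasVelocity {c : ℝ → N} {t : ℝ}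
    (h : MDifferentiableWithinAt 𝓘(ℝ, ℝ) 𝓘(ℝ, E) c (Icc 0 1) t) :
    HasVelocity E c (mfderivWithin 𝓘(ℝ, ℝ) 𝓘(ℝ, E) c (Icc 0 1) t (1 : ℝ) : E) t := by
  have := h.hasMFDerivWithinAt
  refine this.congr_mfderiv ?_
  ext
  exact (one_smul ℝ _).symm

theorem HasVelocity.mfderivWithin_apply {c : ℝ → N} {v : E} {t : ℝ} (h : HasVelocity E c v t)
    (ht : t ∈ Icc (0 : ℝ) 1) : mfderivWithin 𝓘(ℝ, ℝ) 𝓘(ℝ, E) c (Icc 0 1) t (1 : ℝ) = v := by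
  rw [HasMFDerivWithinAt.mfderivWithin h (uniqueMDiffOn_unitInterval t ht)]
  exact one_smul ℝ v

theorem HasVelocity.unique {c : ℝ → N} {v v' : E} {t : ℝ} (h : HasVelocity E c v t)
    (h' : HasVelocity E c v' t) (ht : t ∈ Icc (0 : ℝ) 1) : v = v' :=
  (h.mfderivWithin_apply ht).symm.trans (h'.mfderivWithin_apply ht)

variable (E E') in
/-- The derivative of a map between manifolds, as a linear map between the model spaces. -/
def tderiv (F : N → N') (x : N) : E →L[ℝ] E' := mfderiv 𝓘(ℝ, E) 𝓘(ℝ, E') F x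

theorem tderiv_id (x : N) : tderiv E E (id : N → N) x = ContinuousLinearMap.id ℝ E := mfderiv_id

theorem tderiv_comp {F : N' → N''} {F' : N → N'} {x : N}
    (hF : MDifferentiableAt 𝓘(ℝ, E') 𝓘(ℝ, E'') F (F' x))
    (hF' : MDifferentiableAt 𝓘(ℝ, E) 𝓘(ℝ, E') F' x) :
    tderiv E E'' (fun y => F (F' y)) x = (tderiv E' E'' F (F' x)).comp (tderiv E E' F' x) :=
  mfderiv_comp x hF hF'

theorem HasVelocity.comp {c : ℝ → N} {v : E} {t : ℝ} {F : N → N'}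
    (hF : MDifferentiableAt 𝓘(ℝ, E) 𝓘(ℝ, E') F (c t)) (h : HasVelocity E c v t) :
    HasVelocity E' (fun s => F (c s)) (tderiv E E' F (c t) v) t := by
  refine (HasMFDerivAt.comp_hasMFDerivWithinAt t hF.hasMFDerivAt h).congr_mfderiv ?_
  ext
  change tderiv E E' F (c t) ((1 : ℝ) • v) = (1 : ℝ) • _
  rw [one_smul, one_smul]

theorem HasVelocity.comp₂ {c : ℝ → N} {c' : ℝ → N'} {v : E} {v' : E'} {t : ℝ} {F : N × N' → N''}
    (hF : MDifferentiableAt (𝓘(ℝ, E).prod 𝓘(ℝ, E')) 𝓘(ℝ, E'') F (c t, c' t))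
    (h : HasVelocity E c v t) (h' : HasVelocity E' c' v' t) :
    HasVelocity E'' (fun s => F (c s, c' s))
      (tderiv E E'' (fun x => F (x, c' t)) (c t) v +
        tderiv E' E'' (fun y => F (c t, y)) (c' t) v') t := by
  have hp := HasMFDerivWithinAt.prodMk h h'
  refine (HasMFDerivAt.comp_hasMFDerivWithinAt t (f := fun s => (c s, c' s))
    hF.hasMFDerivAt hp).congr_mfderiv ?_
  ext
  change (show E × E' →L[ℝ] E'' from
    mfderiv (𝓘(ℝ, E).prod 𝓘(ℝ, E')) 𝓘(ℝ, E'') F (c t, c' t)) ((1 : ℝ) • v, (1 : ℝ) • v') =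
      (1 : ℝ) • _
  rw [one_smul, one_smul, one_smul]
  exact mfderiv_prod_eq_add_apply hF

theorem hasVelocity_const (x : N) (t : ℝ) : HasVelocity E (fun _ => x) (0 : E) t := by
  refine (hasMFDerivWithinAt_const x (Icc 0 1) t).congr_mfderiv ?_
  ext
  exact (smul_zero (1 : ℝ)).symm

theorem hasVelocity_iff_hasDerivWithinAt {c : ℝ → E} {v : E} {t : ℝ} :
    HasVelocity E c v t ↔ HasDerivWithinAt c v (Icc 0 1) t := by
  rw [hasDerivWithinAt_iff_hasFDerivWithinAt]
  exact hasMFDerivWithinAt_iff_hasFDerivWithinAt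

theorem IsSmoothPath.hasVelocity {w : unitInterval → N} (hw : IsSmoothPath E w) {t : ℝ}
    (ht : t ∈ Icc (0 : ℝ) 1) : HasVelocity E (extPath w) (velocity E w t : E) t :=
  MDifferentiableWithinAt.hasVelocity ((hw t ht).mdifferentiableWithinAt (by simp))

/-- A path with vanishing velocity is constant. -/
theorem eq_of_hasVelocity_zero [T2Space N] [IsManifold 𝓘(ℝ, E) ∞ N] {c : ℝ → N}
    (h : ∀ t ∈ Icc (0 : ℝ) 1, HasVelocity E c (0 : E) t) {t : ℝ} (ht : t ∈ Icc (0 : ℝ) 1) :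
    c t = c 0 := by
  have hloc : IsLocallyConstant (fun t : unitInterval => c t) := by
    rw [IsLocallyConstant.iff_eventually_eq]
    intro t
    have hcont : ContinuousWithinAt c (Icc 0 1) t := (h t t.2).continuousWithinAt
    have hsrc : ∀ᶠ s in 𝓝[Icc 0 1] (t : ℝ), c s ∈ (chartAt E (c t)).source :=
      hcont ((chartAt E (c t)).open_source.mem_nhds (mem_chart_source E (c t)))
    obtain ⟨ε, hε, hball⟩ := Metric.mem_nhdsWithin_iff.1 hsrc
    have hder : ∀ s ∈ Metric.ball (t : ℝ) ε ∩ Icc 0 1,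
        HasDerivWithinAt (fun s => extChartAt 𝓘(ℝ, E) (c t) (c s)) 0
          (Metric.ball (t : ℝ) ε ∩ Icc 0 1) s := by
      intro s hs
      have hd := (h s hs.2).comp (F := extChartAt 𝓘(ℝ, E) (c t))
        (((contMDiffAt_extChartAt' (n := ∞) (hball hs))).mdifferentiableAt (by simp))
      rw [map_zero, hasVelocity_iff_hasDerivWithinAt] at hd
      exact hd.mono inter_subset_right
    have hconv : Convex ℝ (Metric.ball (t : ℝ) ε ∩ Icc 0 1) :=
      (convex_ball _ _).inter (convex_Icc _ _)
    have hnear : ∀ᶠ s : unitInterval in 𝓝 t, (s : ℝ) ∈ Metric.ball (t : ℝ) ε :=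
      continuous_subtype_val.continuousAt (Metric.ball_mem_nhds _ hε)
    filter_upwards [hnear] with s hs
    have hs' : (s : ℝ) ∈ Metric.ball (t : ℝ) ε ∩ Icc 0 1 := ⟨hs, s.2⟩
    have ht' : (t : ℝ) ∈ Metric.ball (t : ℝ) ε ∩ Icc 0 1 := ⟨Metric.mem_ball_self hε, t.2⟩
    have heq := hconv.norm_image_sub_le_of_norm_hasDerivWithin_le (C := 0) hder (by simp) ht' hs'
    rw [zero_mul, norm_le_zero_iff, sub_eq_zero] at heq
    exact (extChartAt 𝓘(ℝ, E) (c t)).injOn (by rw [extChartAt_source]; exact hball hs')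
      (mem_extChartAt_source (c t)) heq
  exact hloc.apply_eq_of_preconnectedSpace ⟨t, ht⟩ 0

end Velocity

/-! ### The right logarithmic derivative of paths in a Lie group -/

section LogDerivative

variable {EG : Type*} [NormedAddCommGroup EG] [NormedSpace ℝ EG]
  {G : Type*} [TopologicalSpace G] [ChartedSpace EG G] [Group G]

/-- The right logarithmic derivative `ġ(t) g(t)⁻¹`, an element of the Lie algebra: the velocity at
time `t` of `s ↦ g(s) g(t)⁻¹`, which passes through `1`. -/
def rlog (g : ℝ → G) (t : ℝ) : EG :=
  mfderivWithin 𝓘(ℝ, ℝ) 𝓘(ℝ, EG) (fun s => g s * (g t)⁻¹) (Icc 0 1) t (1 : ℝ)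

theorem HasVelocity.rlog_eq {g : ℝ → G} {t : ℝ} {x : EG} (ht : t ∈ Icc (0 : ℝ) 1)
    (h : HasVelocity EG (fun s => g s * (g t)⁻¹) x t) : rlog g t = x :=
  h.mfderivWithin_apply ht

theorem rlog_const (a : G) (t : ℝ) (ht : t ∈ Icc (0 : ℝ) 1) : (rlog (fun _ => a) t : EG) = 0 :=
  HasVelocity.rlog_eq ht (hasVelocity_const _ _)

theorem lieAd_one : (lieAd (1 : G) : EG →L[ℝ] EG) = ContinuousLinearMap.id ℝ EG := by
  have : (fun x : G => 1 * x * 1⁻¹) = id := by funext x; simp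
  rw [lieAd, this]
  exact mfderiv_id

variable [LieGroup 𝓘(ℝ, EG) ∞ G]

theorem LieGroup.isManifold : IsManifold 𝓘(ℝ, EG) ∞ G :=
  (inferInstance : ContMDiffMul 𝓘(ℝ, EG) ∞ G).toIsManifold

theorem mdifferentiable_group_mul_left (a : G) :
    MDifferentiable 𝓘(ℝ, EG) 𝓘(ℝ, EG) (fun x : G => a * x) :=
  (contMDiff_mul_left (n := ∞)).mdifferentiable (by simp)

theorem mdifferentiable_group_mul_right (a : G) :
    MDifferentiable 𝓘(ℝ, EG) 𝓘(ℝ, EG) (fun x : G => x * a) :=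
  (contMDiff_mul_right (n := ∞)).mdifferentiable (by simp)

theorem contMDiff_conj (a : G) :
    ContMDiff 𝓘(ℝ, EG) 𝓘(ℝ, EG) ∞ (fun x : G => a * x * a⁻¹) :=
  (contMDiff_const.mul contMDiff_id).mul contMDiff_const

theorem hasVelocity_rlog {g : ℝ → G} {t : ℝ}
    (hg : MDifferentiableWithinAt 𝓘(ℝ, ℝ) 𝓘(ℝ, EG) g (Icc 0 1) t) :
    HasVelocity EG (fun s => g s * (g t)⁻¹) (rlog g t : EG) t :=
  MDifferentiableWithinAt.hasVelocity
    (((mdifferentiable_group_mul_right (g t)⁻¹) (g t)).comp_mdifferentiableWithinAt t hg)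

theorem hasVelocity_of_rlog {g : ℝ → G} {t : ℝ}
    (hg : MDifferentiableWithinAt 𝓘(ℝ, ℝ) 𝓘(ℝ, EG) g (Icc 0 1) t) :
    HasVelocity EG g (tderiv EG EG (fun x : G => x * g t) 1 (rlog g t)) t := by
  have h := (hasVelocity_rlog hg).comp (F := fun x : G => x * g t)
    (mdifferentiable_group_mul_right _ _)
  simpa only [inv_mul_cancel_right, mul_inv_cancel] using h

/-- The velocity of a product of two paths through the unit element. -/
theorem HasVelocity.mul_of_eq_one {a b : ℝ → G} {x y : EG} {t : ℝ} (ha : HasVelocity EG a x t)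
    (hb : HasVelocity EG b y t) (ha1 : a t = 1) (hb1 : b t = 1) :
    HasVelocity EG (fun s => a s * b s) (x + y) t := by
  have hF : MDifferentiableAt (𝓘(ℝ, EG).prod 𝓘(ℝ, EG)) 𝓘(ℝ, EG) (fun p : G × G => p.1 * p.2)
      (a t, b t) := (contMDiff_mul 𝓘(ℝ, EG) ∞).mdifferentiableAt (by simp)
  have h := ha.comp₂ hF hb
  have h1 : (fun x : G => x * b t) = id := by funext x; simp [hb1]
  have h2 : (fun x : G => a t * x) = id := by funext x; simp [ha1]
  simpa only [h1, h2, tderiv_id, ContinuousLinearMap.id_apply] using h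

theorem lieAd_apply_of_hasVelocity {a : ℝ → G} {x : EG} {t : ℝ} (g : G) (ha : HasVelocity EG a x t)
    (ha1 : a t = 1) : HasVelocity EG (fun s => g * a s * g⁻¹) (lieAd g x : EG) t := by
  have h := ha.comp (F := fun x : G => g * x * g⁻¹) ((contMDiff_conj g).mdifferentiableAt (by simp))
  rw [ha1] at h
  exact h

theorem rlog_mul {g h : ℝ → G} {t : ℝ} (ht : t ∈ Icc (0 : ℝ) 1)
    (hg : MDifferentiableWithinAt 𝓘(ℝ, ℝ) 𝓘(ℝ, EG) g (Icc 0 1) t)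
    (hh : MDifferentiableWithinAt 𝓘(ℝ, ℝ) 𝓘(ℝ, EG) h (Icc 0 1) t) :
    (rlog (fun s => g s * h s) t : EG) = rlog g t + lieAd (g t) (rlog h t) := by
  refine HasVelocity.rlog_eq ht ?_
  have h1 := lieAd_apply_of_hasVelocity (g t) (hasVelocity_rlog hh) (mul_inv_cancel _)
  have h2 := (hasVelocity_rlog hg).mul_of_eq_one h1 (mul_inv_cancel _) (by simp)
  convert h2 using 2 with s
  group

theorem lieAd_mul (g h : G) : (lieAd (g * h) : EG →L[ℝ] EG) = (lieAd g).comp (lieAd h) := by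
  have h1 : (fun x : G => g * h * x * (g * h)⁻¹) =
      (fun x : G => g * x * g⁻¹) ∘ fun x => h * x * h⁻¹ := by
    funext x; simp only [Function.comp_apply]; group
  have h2 := tderiv_comp (F := fun x : G => g * x * g⁻¹) (F' := fun x => h * x * h⁻¹) (x := 1)
    ((contMDiff_conj (EG := EG) g).mdifferentiableAt (by simp))
    ((contMDiff_conj (EG := EG) h).mdifferentiableAt (by simp))
  have h3 : h * 1 * h⁻¹ = 1 := by simp
  rw [h3] at h2
  rw [lieAd, h1]
  exact h2

theorem lieAd_inv_apply (g : G) (x : EG) : lieAd g⁻¹ (lieAd g x) = x := by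
  have := congrArg (fun L : EG →L[ℝ] EG => L x) (lieAd_mul (EG := EG) g⁻¹ g)
  simp only [inv_mul_cancel, lieAd_one] at this
  exact this.symm

theorem lieAd_apply_inv (g : G) (x : EG) : lieAd g (lieAd g⁻¹ x) = x := by
  simpa using lieAd_inv_apply g⁻¹ x

/-- A path in a Lie group is determined by its logarithmic derivative and its starting point, since
`g⁻¹ h` has vanishing velocity. -/
theorem eq_of_rlog_eq [T2Space G] {g h : ℝ → G}
    (hg : MDifferentiableOn 𝓘(ℝ, ℝ) 𝓘(ℝ, EG) g (Icc 0 1))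
    (hh : MDifferentiableOn 𝓘(ℝ, ℝ) 𝓘(ℝ, EG) h (Icc 0 1)) (h0 : g 0 = h 0)
    (hlog : ∀ t ∈ Icc (0 : ℝ) 1, (rlog g t : EG) = rlog h t) {t : ℝ} (ht : t ∈ Icc (0 : ℝ) 1) :
    g t = h t := by
  have := LieGroup.isManifold (EG := EG) (G := G)
  have hinv : MDifferentiableOn 𝓘(ℝ, ℝ) 𝓘(ℝ, EG) (fun s => (g s)⁻¹) (Icc 0 1) := fun s hs =>
    ((contMDiff_inv 𝓘(ℝ, EG) ∞).mdifferentiableAt (x := g s) (by simp)).comp_mdifferentiableWithinAt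
      s (hg s hs)
  have hprod : MDifferentiableOn 𝓘(ℝ, ℝ) 𝓘(ℝ, EG) (fun s => (g s)⁻¹ * h s) (Icc 0 1) := fun s hs =>
    ((contMDiff_mul 𝓘(ℝ, EG) ∞).mdifferentiableAt (x := ((g s)⁻¹, h s)) (by simp)
      ).comp_mdifferentiableWithinAt s ((hinv s hs).prodMk (hh s hs))
  have hzero : ∀ s ∈ Icc (0 : ℝ) 1, HasVelocity EG (fun s => (g s)⁻¹ * h s) (0 : EG) s := by
    intro s hs
    have h1 := rlog_mul hs (hinv s hs) (hg s hs)
    have h2 := rlog_mul hs (hinv s hs) (hh s hs)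
    simp only [inv_mul_cancel] at h1
    rw [rlog_const _ _ hs, hlog s hs] at h1
    rw [← h1] at h2
    have h3 := hasVelocity_of_rlog (hprod s hs)
    rw [h2, map_zero] at h3
    exact h3
  have := eq_of_hasVelocity_zero hzero ht
  rw [h0, inv_mul_cancel] at this
  exact (inv_mul_eq_one.1 this)

/-- The adjoint representation is smooth. -/
theorem contMDiff_lieAd :
    ContMDiff 𝓘(ℝ, EG) 𝓘(ℝ, EG →L[ℝ] EG) ∞ (lieAd : G → EG →L[ℝ] EG) := by
  have := LieGroup.isManifold (EG := EG) (G := G)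
  intro g₀
  let e := extChartAt 𝓘(ℝ, EG) (1 : G)
  have he : ContMDiffAt 𝓘(ℝ, EG) 𝓘(ℝ, EG) ∞ e.symm (e 1) :=
    (contMDiffOn_extChartAt_symm (1 : G)).contMDiffAt (extChartAt_target_mem_nhds (1 : G))
  let f : G → EG → EG := fun g y => e (g * e.symm y * g⁻¹)
  have hf : ContMDiffAt (𝓘(ℝ, EG).prod 𝓘(ℝ, EG)) 𝓘(ℝ, EG) ∞ (Function.uncurry f) (g₀, e 1) := by
    have h1 : ContMDiffAt (𝓘(ℝ, EG).prod 𝓘(ℝ, EG)) 𝓘(ℝ, EG) ∞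
        (fun p : G × EG => p.1 * e.symm p.2 * p.1⁻¹) (g₀, e 1) :=
      (contMDiffAt_fst.mul (he.comp (g₀, e 1) contMDiffAt_snd)).mul contMDiffAt_fst.inv
    have h2 : g₀ * e.symm (e 1) * g₀⁻¹ = 1 := by
      rw [extChartAt_to_inv, mul_one, mul_inv_cancel]
    refine ContMDiffAt.comp (g₀, e 1) (I' := 𝓘(ℝ, EG)) (g := e) ?_ h1
    simp only [h2]
    exact contMDiffAt_extChartAt
  have hD := ContMDiffAt.mfderiv (m := ∞) f (fun _ => e 1) hf contMDiffAt_const (by simp)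
  erw [inTangentCoordinates_model_space] at hD
  refine hD.congr_of_eventuallyEq (Eventually.of_forall fun g => ?_)
  have hdiff := (contMDiff_conj (EG := EG) g).mdifferentiableAt (x := 1) (by simp)
  have h2 : g * 1 * g⁻¹ = 1 := by simp
  have h3 : lieAd g = fderiv ℝ (f g) (e 1) := by
    have h4 := hdiff.mfderiv
    simp only [writtenInExtChartAt, h2, modelWithCornersSelf_coe, range_id, fderivWithin_univ] at h4
    exact h4
  rw [h3]
  exact mfderiv_eq_fderiv.symm

end LogDerivative

/-! ### Solving `ẋ = V(x) k` for small controls `k` -/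

section LocalSolution

local notation "I01" => unitInterval

variable {W : Type u} [NormedAddCommGroup W] [NormedSpace ℝ W]

/-- The inverse function theorem, as a statement about a whole neighbourhood. -/
theorem exists_contDiffOn_localInverse {X Y : Type*} [NormedAddCommGroup X] [NormedSpace ℝ X]
    [CompleteSpace X] [NormedAddCommGroup Y] [NormedSpace ℝ Y] [CompleteSpace Y] {F : X → Y}
    {U : Set X} (hU : IsOpen U) (hF : ContDiffOn ℝ ∞ F U) {a : X} (ha : a ∈ U) {L : X ≃L[ℝ] Y}
    (hL : HasFDerivAt F (L : X →L[ℝ] Y) a) :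
    ∃ (N : Set Y) (S : Y → X), IsOpen N ∧ F a ∈ N ∧ ContDiffOn ℝ ∞ S N ∧ S (F a) = a ∧
      HasFDerivAt S (L.symm : Y →L[ℝ] X) (F a) ∧ ∀ y ∈ N, S y ∈ U ∧ F (S y) = y := by
  have hFa : ContDiffAt ℝ ∞ F a := hF.contDiffAt (hU.mem_nhds ha)
  let e := hFa.toOpenPartialHomeomorph F hL (by simp)
  have hea : a ∈ e.source := hFa.mem_toOpenPartialHomeomorph_source hL (by simp)
  have hinv : ∀ᶠ x in 𝓝 a, x ∈ U ∧ fderiv ℝ F x ∈ range ((↑) : (X ≃L[ℝ] Y) → X →L[ℝ] Y) := by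
    refine (hU.eventually_mem ha).and ?_
    have hc : ContinuousAt (fderiv ℝ F) a :=
      ((hF.fderiv_of_isOpen hU (m := ∞) (by simp)).continuousOn).continuousAt (hU.mem_nhds ha)
    refine hc.eventually_mem ?_
    rw [hL.fderiv]
    exact L.nhds
  obtain ⟨U', hU'sub, hU', haU'⟩ := mem_nhds_iff.1 hinv
  refine ⟨e.target ∩ e.symm ⁻¹' U', e.symm, e.isOpen_inter_preimage_symm hU',
    ⟨e.map_source hea, ?_⟩, fun y hy => ?_, e.left_inv hea, ?_, fun y hy =>
      ⟨(hU'sub hy.2).1, e.right_inv hy.1⟩⟩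
  · change e.symm (e a) ∈ U'
    rwa [e.left_inv hea]
  · obtain ⟨h1, L', hL'⟩ := hU'sub hy.2
    have h2 : ContDiffAt ℝ ∞ F (e.symm y) := hF.contDiffAt (hU.mem_nhds h1)
    refine (e.contDiffAt_symm hy.1 (f₀' := L') ?_ h2).contDiffWithinAt
    rw [hL']
    exact (h2.differentiableAt (by simp)).hasFDerivAt
  · refine e.hasFDerivAt_symm (e.map_source hea) ?_
    rw [show e.symm (F a) = a from e.left_inv hea]
    exact hL

/-- For small controls `k`, the equation `ẋ = V(x) k` with `x(0) = x₀` has a solution on `[0,1]`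
which depends smoothly on `k`. By the inverse function theorem, applied to the integral equation at
`k = 0`. -/
theorem exists_controlled_solution [CompleteSpace W] {O : Set W} (hO : IsOpen O)
    {V : W → W →L[ℝ] W} (hV : ContDiffOn ℝ ∞ V O) {x₀ : W} (hx₀ : x₀ ∈ O)
    (hV0 : V x₀ = ContinuousLinearMap.id ℝ W) :
    ∃ (N : Set C(I01, W)) (S : C(I01, W) → C(I01, W)), IsOpen N ∧ 0 ∈ N ∧
      ContDiffOn ℝ ∞ S N ∧ S 0 = ContinuousMap.const I01 x₀ ∧ HasFDerivAt S (pathPrimitive W) 0 ∧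
      ∀ k ∈ N, (∀ t, S k t ∈ O) ∧ S k 0 = x₀ ∧
        ∀ t : I01, HasDerivWithinAt (extPath (S k)) (V (S k t) (k t)) (Icc 0 1) t := by
  -- The equation is `x = x₀ + ∫ Ψ(x, k)` with `Ψ(w, v) = V(w) v`.
  let Ω : Set (ℝ × (W × W)) := {p | p.2.1 ∈ O}
  have hΩ : IsOpen Ω := hO.preimage (by fun_prop : Continuous fun p : ℝ × (W × W) => p.2.1)
  let Ψ : ℝ × (W × W) → W := fun p => V p.2.1 p.2.2
  have hΨ : ContDiffOn ℝ ∞ Ψ (timeSlab Ω) :=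
    (hV.comp (by fun_prop) fun p hp => hp.1).clm_apply (by fun_prop)
  let c₀ : C(I01, W) := ContinuousMap.const I01 x₀
  let Q : C(I01, W) × C(I01, W) →L[ℝ] C(I01, W × W) :=
    (pathPair W W).comp ((ContinuousLinearMap.snd ℝ _ _).prod (ContinuousLinearMap.fst ℝ _ _))
  have hQ : ∀ p t, Q p t = (p.2 t, p.1 t) := fun p t => rfl
  let U : Set (C(I01, W) × C(I01, W)) := Q ⁻¹' graphIn Ω
  have hU : IsOpen U := (isOpen_graphIn hΩ).preimage Q.continuous
  let R : C(I01, W) × C(I01, W) → C(I01, W) := fun p => pathPrimitive W (superpose Ψ (Q p))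
  -- `F (k, x) = (k, x - x₀ - ∫ Ψ(x, k))` has the unipotent derivative `(k, x) ↦ (k, x - ∫ k)` at
  -- `(0, x₀)`, since `Ψ` is linear in `k` and `V(x₀)` is the identity.
  let F : C(I01, W) × C(I01, W) → C(I01, W) × C(I01, W) := fun p => (p.1, p.2 - c₀ - R p)
  have hR : ContDiffOn ℝ ∞ R U :=
    (pathPrimitive W).contDiff.comp_contDiffOn
      ((contDiffOn_superpose hΩ hΨ).comp Q.contDiff.contDiffOn fun p hp => hp)
  have hF : ContDiffOn ℝ ∞ F U :=
    contDiffOn_fst.prodMk ((contDiffOn_snd.sub contDiffOn_const).sub hR)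
  have ha : ((0, c₀) : C(I01, W) × C(I01, W)) ∈ U := fun t => hx₀
  have hRd : HasFDerivAt R ((pathPrimitive W).comp (ContinuousLinearMap.fst ℝ _ _)) (0, c₀) := by
    have h2 := (pathPrimitive W).hasFDerivAt.comp ((0, c₀) : C(I01, W) × C(I01, W))
      ((differentiableAt_superpose hΩ hΨ ha).hasFDerivAt.comp _ Q.hasFDerivAt)
    refine h2.congr_fderiv ?_
    have hVd : HasFDerivAt (fun p : W × W => V p.1 p.2) (ContinuousLinearMap.snd ℝ W W)
        (x₀, (0 : W)) := by
      have h3 : DifferentiableAt ℝ (fun p : W × W => V p.1) (x₀, (0 : W)) :=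
        DifferentiableAt.comp (x₀, (0 : W)) (g := V)
          ((hV.contDiffAt (hO.mem_nhds hx₀)).differentiableAt (by simp)) differentiableAt_fst
      refine (h3.hasFDerivAt.clm_apply hasFDerivAt_snd).congr_fderiv ?_
      ext v <;> simp [hV0]
    have h4 : (fderiv ℝ (superpose Ψ) (Q (0, c₀))).comp Q = ContinuousLinearMap.fst ℝ _ _ := by
      refine ContinuousLinearMap.ext fun p => ContinuousMap.ext fun t => ?_
      rw [ContinuousLinearMap.comp_apply, fderiv_superpose_apply hΩ hΨ ha]
      exact congrArg (fun L : W × W →L[ℝ] W => L (p.2 t, p.1 t)) hVd.fderiv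
    rw [← h4]
  have hL : HasFDerivAt F ((ContinuousLinearEquiv.equivOfInverse
      ((ContinuousLinearMap.fst ℝ C(I01, W) C(I01, W)).prod
        (ContinuousLinearMap.snd ℝ _ _ - (pathPrimitive W).comp (ContinuousLinearMap.fst ℝ _ _)))
      ((ContinuousLinearMap.fst ℝ C(I01, W) C(I01, W)).prod
        (ContinuousLinearMap.snd ℝ _ _ + (pathPrimitive W).comp (ContinuousLinearMap.fst ℝ _ _)))
      (fun p => by ext <;> simp) (fun p => by ext <;> simp) :
      (C(I01, W) × C(I01, W)) ≃L[ℝ] (C(I01, W) × C(I01, W))) :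
      (C(I01, W) × C(I01, W)) →L[ℝ] (C(I01, W) × C(I01, W))) (0, c₀) :=
    hasFDerivAt_fst.prodMk ((hasFDerivAt_snd.sub_const c₀).sub hRd)
  have hF0 : F (0, c₀) = 0 := by
    have h1 : superpose Ψ (Q (0, c₀)) = 0 := by
      ext t
      rw [superpose_apply hΨ.continuousOn ha]
      exact map_zero (V x₀)
    have : R (0, c₀) = 0 := by
      change pathPrimitive W (superpose Ψ (Q (0, c₀))) = 0
      rw [h1, map_zero]
    change (0, c₀ - c₀ - R (0, c₀)) = 0
    rw [this, sub_self, sub_zero]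
    rfl
  obtain ⟨N, T, hNo, h0N, hT, hT0, hTd, hTU⟩ := exists_contDiffOn_localInverse hU hF ha hL
  rw [hF0] at h0N hT0 hTd
  have hj : Continuous fun k : C(I01, W) => ((k, 0) : C(I01, W) × C(I01, W)) := by fun_prop
  refine ⟨(fun k => (k, 0)) ⁻¹' N, fun k => (T (k, 0)).2, hNo.preimage hj, h0N,
    contDiff_snd.comp_contDiffOn (hT.comp (by fun_prop) fun k hk => hk), ?_, ?_, fun k hk => ?_⟩
  · change (T 0).2 = _
    rw [hT0]
  · have h1 : HasFDerivAt (fun k : C(I01, W) => ((k, 0) : C(I01, W) × C(I01, W)))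
        (ContinuousLinearMap.inl ℝ _ _) 0 := hasFDerivAt_prodMk_left 0 0
    refine (hasFDerivAt_snd.comp (0 : C(I01, W)) (HasFDerivAt.comp (0 : C(I01, W)) (g := T)
      (f := fun k => ((k, 0) : C(I01, W) × C(I01, W))) hTd h1)).congr_fderiv ?_
    ext k t
    change 0 + pathPrimitive W k t = _
    rw [zero_add]
  · obtain ⟨h1, h2⟩ := hTU _ hk
    have h3 : (T (k, 0)).1 = k := congrArg Prod.fst h2
    have h4 : (T (k, 0)).2 = c₀ + R (T (k, 0)) := by
      have := congrArg Prod.snd h2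
      change (T (k, 0)).2 - c₀ - R (T (k, 0)) = 0 at this
      rw [sub_eq_zero] at this
      rw [← this, add_sub_cancel]
    have h5 : ∀ t, (T (k, 0)).2 t =
        x₀ + pathPrimitive W (superpose Ψ (Q (T (k, 0)))) t := fun t => by
      conv_lhs => rw [h4]
      rfl
    have h6 : (T (k, 0)).2 0 = x₀ := by
      rw [h5, pathPrimitive_apply]
      simp
    refine ⟨fun t => h1 t, h6, fun t => ?_⟩
    have h7 := (hasDerivWithinAt_extPath_iff (q := (T (k, 0)).2)
      (q' := superpose Ψ (Q (T (k, 0))))).2 (fun t => by rw [h6]; exact h5 t) t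
    rw [superpose_apply hΨ.continuousOn h1, hQ, h3] at h7
    exact h7

end LocalSolution

/-! ### The evolution equation in a chart of the group -/

section GroupChart

variable (EG : Type u) [NormedAddCommGroup EG] [NormedSpace ℝ EG]
  (G : Type*) [TopologicalSpace G] [ChartedSpace EG G] [Group G] [LieGroup 𝓘(ℝ, EG) ∞ G]

/-- The right logarithmic derivative in the preferred chart at the unit element: it sends the
velocity of a path of coordinates at `x` to the logarithmic derivative of the path in the group. -/
def chartRlog (x : EG) : EG →L[ℝ] EG :=
  tderiv EG EG (fun y => (extChartAt 𝓘(ℝ, EG) (1 : G)).symm y *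
    ((extChartAt 𝓘(ℝ, EG) (1 : G)).symm x)⁻¹) x

variable {EG G}

theorem contMDiffAt_chart_symm {x : EG} (hx : x ∈ (extChartAt 𝓘(ℝ, EG) (1 : G)).target) :
    ContMDiffAt 𝓘(ℝ, EG) 𝓘(ℝ, EG) ∞ (extChartAt 𝓘(ℝ, EG) (1 : G)).symm x := by
  have := LieGroup.isManifold (EG := EG) (G := G)
  exact (contMDiffOn_extChartAt_symm (1 : G)).contMDiffAt ((isOpen_extChartAt_target 1).mem_nhds hx)

theorem chartRlog_eq_fderiv {x : EG} (hx : x ∈ (extChartAt 𝓘(ℝ, EG) (1 : G)).target) :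
    chartRlog EG G x = fderiv ℝ (fun y => extChartAt 𝓘(ℝ, EG) (1 : G)
      ((extChartAt 𝓘(ℝ, EG) (1 : G)).symm y * ((extChartAt 𝓘(ℝ, EG) (1 : G)).symm x)⁻¹)) x := by
  have h1 : ContMDiffAt 𝓘(ℝ, EG) 𝓘(ℝ, EG) ∞ (fun y => (extChartAt 𝓘(ℝ, EG) (1 : G)).symm y *
    ((extChartAt 𝓘(ℝ, EG) (1 : G)).symm x)⁻¹) x := (contMDiffAt_chart_symm hx).mul contMDiffAt_const
  have h2 := (h1.mdifferentiableAt (by simp)).mfderiv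
  simp only [writtenInExtChartAt, mul_inv_cancel, modelWithCornersSelf_coe, range_id,
    fderivWithin_univ] at h2
  exact h2

theorem contDiffOn_chartRlog :
    ContDiffOn ℝ ∞ (chartRlog EG G) (extChartAt 𝓘(ℝ, EG) (1 : G)).target := by
  have := LieGroup.isManifold (EG := EG) (G := G)
  let e := extChartAt 𝓘(ℝ, EG) (1 : G)
  intro x hx
  let f : EG → EG → EG := fun x y => e (e.symm y * (e.symm x)⁻¹)
  have hf : ContDiffAt ℝ ∞ (Function.uncurry f) (x, x) := by
    rw [← contMDiffAt_iff_contDiffAt]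
    have h1 : ContMDiffAt 𝓘(ℝ, EG × EG) 𝓘(ℝ, EG) ∞
        (fun p : EG × EG => e.symm p.2 * (e.symm p.1)⁻¹) (x, x) :=
      ((contMDiffAt_chart_symm hx).comp (x, x) (contDiffAt_snd.contMDiffAt)).mul
        ((contMDiffAt_chart_symm hx).comp (x, x) (contDiffAt_fst.contMDiffAt)).inv
    refine ContMDiffAt.comp (x, x) (I' := 𝓘(ℝ, EG)) (g := e) ?_ h1
    simp only [mul_inv_cancel]
    exact contMDiffAt_extChartAt
  have hD : ContDiffAt ℝ ∞ (fun x => fderiv ℝ (f x) x) x :=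
    hf.fderiv contDiffAt_id (by simp)
  refine (hD.congr_of_eventuallyEq ?_).contDiffWithinAt
  filter_upwards [(isOpen_extChartAt_target (1 : G)).mem_nhds hx] with y hy
  exact chartRlog_eq_fderiv hy

theorem chartRlog_one :
    chartRlog EG G (extChartAt 𝓘(ℝ, EG) (1 : G) 1) = ContinuousLinearMap.id ℝ EG := by
  have ht := mem_extChartAt_target (I := 𝓘(ℝ, EG)) (1 : G)
  rw [chartRlog_eq_fderiv ht]
  have : (fun y => extChartAt 𝓘(ℝ, EG) (1 : G) ((extChartAt 𝓘(ℝ, EG) (1 : G)).symm y *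
      ((extChartAt 𝓘(ℝ, EG) (1 : G)).symm (extChartAt 𝓘(ℝ, EG) (1 : G) 1))⁻¹))
      =ᶠ[𝓝 (extChartAt 𝓘(ℝ, EG) (1 : G) 1)] id := by
    filter_upwards [(isOpen_extChartAt_target (1 : G)).mem_nhds ht] with y hy
    rw [extChartAt_to_inv, inv_one, mul_one]
    exact (extChartAt 𝓘(ℝ, EG) (1 : G)).right_inv hy
  rw [this.fderiv_eq, fderiv_id]

/-- In the chart at the unit element, `ġ g⁻¹ = k` reads `ẋ = V(x) k`. -/
theorem exists_chart_equation [CompleteSpace EG] :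
    ∃ (O : Set EG) (V : EG → EG →L[ℝ] EG), IsOpen O ∧
      O ⊆ (extChartAt 𝓘(ℝ, EG) (1 : G)).target ∧ extChartAt 𝓘(ℝ, EG) (1 : G) 1 ∈ O ∧
      ContDiffOn ℝ ∞ V O ∧
      V (extChartAt 𝓘(ℝ, EG) (1 : G) 1) = ContinuousLinearMap.id ℝ EG ∧
      ∀ (x : ℝ → EG) (k : EG), ∀ t ∈ Icc (0 : ℝ) 1, x t ∈ O →
        HasDerivWithinAt x (V (x t) k) (Icc 0 1) t →
        rlog (fun s => (extChartAt 𝓘(ℝ, EG) (1 : G)).symm (x s)) t = k := by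
  have ht := mem_extChartAt_target (I := 𝓘(ℝ, EG)) (1 : G)
  have hop := isOpen_extChartAt_target (I := 𝓘(ℝ, EG)) (1 : G)
  -- `V` is the inverse of the logarithmic derivative in the chart, on the open set where it exists.
  refine ⟨(extChartAt 𝓘(ℝ, EG) (1 : G)).target ∩ chartRlog EG G ⁻¹' {L | IsUnit L},
    fun x => Ring.inverse (chartRlog EG G x),
    (contDiffOn_chartRlog.continuousOn).isOpen_inter_preimage hop Units.isOpen,
    inter_subset_left, ⟨ht, ?_⟩, ?_, ?_, ?_⟩
  · change IsUnit _
    rw [chartRlog_one]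
    exact isUnit_one
  · rintro x ⟨hx, u, hu⟩
    have h1 : ContDiffAt ℝ ∞ Ring.inverse (chartRlog EG G x) := by
      rw [← hu]
      exact contDiffAt_ringInverse ℝ u
    exact (h1.comp x (contDiffOn_chartRlog.contDiffAt (hop.mem_nhds hx))).contDiffWithinAt
  · change Ring.inverse (chartRlog EG G (extChartAt 𝓘(ℝ, EG) (1 : G) 1)) = _
    rw [chartRlog_one]
    exact Ring.inverse_one _
  · rintro x k t ht ⟨hx, hu⟩ hd
    refine HasVelocity.rlog_eq ht ?_
    have h1 : ContMDiffAt 𝓘(ℝ, EG) 𝓘(ℝ, EG) ∞ (fun y => (extChartAt 𝓘(ℝ, EG) (1 : G)).symm y *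
      ((extChartAt 𝓘(ℝ, EG) (1 : G)).symm (x t))⁻¹) (x t) :=
      (contMDiffAt_chart_symm hx).mul contMDiffAt_const
    have h2 := (hasVelocity_iff_hasDerivWithinAt.2 hd).comp (h1.mdifferentiableAt (by simp))
    have h3 : chartRlog EG G (x t) (Ring.inverse (chartRlog EG G (x t)) k) = k := by
      have := congrArg (fun L : EG →L[ℝ] EG => L k) (Ring.mul_inverse_cancel _ hu)
      exact this
    change HasVelocity EG _ (chartRlog EG G (x t) (Ring.inverse (chartRlog EG G (x t)) k)) t at h2
    rwa [h3] at h2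

end GroupChart

/-! ### The evolution of a path in the Lie algebra -/

section Evolution

local notation "I01" => unitInterval

theorem PathSmoothOn.contDiffOn {E : Type u'} [AddCommGroup E] [Module ℝ E] [TopologicalSpace E]
    {W : Type*} [NormedAddCommGroup W] [NormedSpace ℝ W] {m : ℕ} : ∀ {Q : E → C(I01, W)}
    {U : Set E}, PathSmoothOn m Q U → ∀ f ∈ U, ContDiffOn ℝ m (extPath (Q f)) (Icc 0 1) := by
  induction m with
  | zero =>
    intro Q U _ f _
    exact contDiffOn_zero.2 (continuous_extPath (Q f)).continuousOn
  | succ m ih =>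
    intro Q U ⟨_, Q', h1, h2⟩ f hf
    rw [Nat.cast_add, Nat.cast_one, contDiffOn_succ_iff_derivWithin uniqueDiffOn_unitInterval]
    refine ⟨fun t ht => (h2 f hf ⟨t, ht⟩).differentiableWithinAt, by simp, ?_⟩
    refine (ih h1 f hf).congr fun t ht => ?_
    rw [(h2 f hf ⟨t, ht⟩).derivWithin (uniqueDiffOn_unitInterval t ht), extPath_of_mem _ ht]

variable {EG : Type u} [NormedAddCommGroup EG] [NormedSpace ℝ EG]
  {G : Type*} [TopologicalSpace G] [ChartedSpace EG G] [Group G]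

/-- `g` is the path in `G` with `g(0) = 1` and `ġ g⁻¹ = f`. -/
structure IsEvolution (f : SmoothPaths EG) (g : I01 → G) : Prop where
  smooth : IsSmoothPath EG g
  start : g 0 = 1
  rlog_eq : ∀ t : I01, rlog (extPath g) t = f t

variable [LieGroup 𝓘(ℝ, EG) ∞ G]

theorem IsSmoothPath.mdifferentiableOn {E N : Type*} [NormedAddCommGroup E] [NormedSpace ℝ E]
    [TopologicalSpace N] [ChartedSpace E N] {g : I01 → N} (hg : IsSmoothPath E g) :
    MDifferentiableOn 𝓘(ℝ, ℝ) 𝓘(ℝ, E) (extPath g) (Icc 0 1) :=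
  ContMDiffOn.mdifferentiableOn hg (by simp)

theorem IsEvolution.unique [T2Space G] {f : SmoothPaths EG} {g h : I01 → G} (hg : IsEvolution f g)
    (hh : IsEvolution f h) : g = h := by
  funext t
  have h0 : extPath g 0 = extPath h 0 := by
    have h1 := extPath_coe g 0
    have h2 := extPath_coe h 0
    rw [Icc.coe_zero] at h1 h2
    rw [h1, h2, hg.start, hh.start]
  have := eq_of_rlog_eq (EG := EG) hg.smooth.mdifferentiableOn hh.smooth.mdifferentiableOn h0
    (fun t ht => by rw [hg.rlog_eq ⟨t, ht⟩, hh.rlog_eq ⟨t, ht⟩]) t.2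
  rwa [extPath_coe, extPath_coe] at this

theorem contDiffOn_lieAd_inv {g : I01 → G} (hg : IsSmoothPath EG g) :
    ContDiffOn ℝ ∞ (fun t => (lieAd (extPath g t)⁻¹ : EG →L[ℝ] EG)) (Icc 0 1) := by
  rw [← contMDiffOn_iff_contDiffOn]
  exact contMDiff_lieAd.comp_contMDiffOn (ContMDiffOn.inv hg)

/-- The path `t ↦ Ad(g(t)⁻¹) k(t)`. -/
def twist {g : I01 → G} (hg : IsSmoothPath EG g) (k : SmoothPaths EG) : SmoothPaths EG :=
  ⟨fun t => lieAd (g t)⁻¹ (k t), (contDiffOn_lieAd_inv hg).clm_apply k.2⟩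

theorem twist_apply {g : I01 → G} (hg : IsSmoothPath EG g) (k : SmoothPaths EG) (t : I01) :
    twist hg k t = lieAd (g t)⁻¹ (k t) := rfl

/-- If `g` is the evolution of `f` and `h` that of `Ad(g⁻¹) k`, then `g h` is the evolution of
`f + k`. -/
theorem IsEvolution.mul {f k : SmoothPaths EG} {g h : I01 → G} (hg : IsEvolution f g)
    (hh : IsEvolution (twist hg.smooth k) h) : IsEvolution (f + k) (fun t => g t * h t) where
  smooth := ContMDiffOn.mul hg.smooth hh.smooth
  start := by rw [hg.start, hh.start, one_mul]
  rlog_eq t := by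
    have h1 := rlog_mul t.2 (hg.smooth.mdifferentiableOn t t.2) (hh.smooth.mdifferentiableOn t t.2)
    rw [hg.rlog_eq, hh.rlog_eq, twist_apply, extPath_coe, lieAd_apply_inv] at h1
    exact h1

variable (EG G) in
/-- The evolution of small paths, in the chart of `G` at the unit element. It is smooth for the
supremum norm, and it sends smooth families of smooth paths to such families, as the time derivative
of the solution is again a superposition. -/
theorem exists_local_evolution [CompleteSpace EG] :
    ∃ (N : Set C(I01, EG)) (S : C(I01, EG) → C(I01, EG)), IsOpen N ∧ 0 ∈ N ∧
      S 0 = ContinuousMap.const I01 (extChartAt 𝓘(ℝ, EG) (1 : G) 1) ∧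
      HasFDerivAt S (pathPrimitive EG) 0 ∧
      (∀ k ∈ N, ∀ t, S k t ∈ (extChartAt 𝓘(ℝ, EG) (1 : G)).target) ∧
      (∀ (K : SmoothPaths EG → C(I01, EG)) (U : Set (SmoothPaths EG)), MapsTo K U N →
        (∀ m, PathSmoothOn m K U) → ∀ m, PathSmoothOn m (fun f => S (K f)) U) ∧
      ∀ f : SmoothPaths EG, SmoothPaths.deriv EG 0 f ∈ N →
        IsEvolution f fun t =>
          (extChartAt 𝓘(ℝ, EG) (1 : G)).symm (S (SmoothPaths.deriv EG 0 f) t) := by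
  obtain ⟨O, V, hO, hOt, hO1, hV, hV1, hlog⟩ := exists_chart_equation (EG := EG) (G := G)
  obtain ⟨N, S, hN, h0N, hS, hS0, hSd, hsol⟩ := exists_controlled_solution hO hV hO1 hV1
  have hps : ∀ (K : SmoothPaths EG → C(I01, EG)) (U : Set (SmoothPaths EG)), MapsTo K U N →
      (∀ m, PathSmoothOn m K U) → ∀ m, PathSmoothOn m (fun f => S (K f)) U := by
    intro K U hKU hK m
    have h0 : ∀ n, BastianiOn n (fun f => S (K f)) U := fun n =>
      hS.comp_bastianiOn hN ((hK 0).bastianiOn n) hKU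
    induction m with
    | zero => exact h0
    | succ m ih =>
      let Ω : Set (ℝ × (EG × EG)) := {p | p.2.1 ∈ O}
      have hΩ : IsOpen Ω := hO.preimage (by fun_prop : Continuous fun p : ℝ × (EG × EG) => p.2.1)
      let Ψ : ℝ × (EG × EG) → EG := fun p => V p.2.1 p.2.2
      have hΨ : ContDiffOn ℝ ∞ Ψ (timeSlab Ω) :=
        (hV.comp (by fun_prop) fun p hp => hp.1).clm_apply (by fun_prop)
      have hmaps : MapsTo (fun f => pathPair EG EG (S (K f), K f)) U (graphIn Ω) :=
        fun f hf t => (hsol _ (hKU hf)).1 t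
      refine ⟨h0, _, (ih.pair (hK m)).superpose hΩ hΨ hmaps, fun f hf t => ?_⟩
      rw [superpose_apply hΨ.continuousOn (hmaps hf)]
      exact (hsol _ (hKU hf)).2.2 t
  refine ⟨N, S, hN, h0N, hS0, hSd, fun k hk t => hOt ((hsol k hk).1 t), hps, fun f hf => ?_⟩
  have hsm := hps (SmoothPaths.deriv EG 0) {f} (fun k hk => by rw [hk]; exact hf)
    fun m => (SmoothPaths.pathSmoothOn_deriv m 0).mono (subset_univ _)
  set x := S (SmoothPaths.deriv EG 0 f) with hx
  obtain ⟨h1, h2, h3⟩ := hsol _ hf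
  have hxs : ContDiffOn ℝ ∞ (extPath x) (Icc 0 1) :=
    contDiffOn_infty.2 fun m => (hsm m).contDiffOn f rfl
  refine ⟨fun t ht => ?_, ?_, fun t => ?_⟩
  · have h4 : ContMDiffAt 𝓘(ℝ, EG) 𝓘(ℝ, EG) ∞ (extChartAt 𝓘(ℝ, EG) (1 : G)).symm (extPath x t) := by
      rw [extPath_of_mem _ ht]
      exact contMDiffAt_chart_symm (hOt (h1 _))
    exact h4.comp_contMDiffWithinAt t ((hxs t ht).contMDiffWithinAt)
  · rw [h2]
    exact extChartAt_to_inv 1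
  · refine hlog (extPath x) (f t) t t.2 ?_ ?_
    · rw [extPath_coe]; exact h1 t
    · rw [extPath_coe]
      have := h3 t
      rwa [SmoothPaths.deriv_zero_apply] at this

theorem norm_twist_le {g : I01 → G} (hg : IsSmoothPath EG g) {C : ℝ}
    (hC : ∀ a : G, ‖(lieAd a : EG →L[ℝ] EG)‖ ≤ C) (k : SmoothPaths EG) :
    ‖SmoothPaths.deriv EG 0 (twist hg k)‖ ≤ C * ‖SmoothPaths.deriv EG 0 k‖ := by
  have hC0 : 0 ≤ C := (norm_nonneg _).trans (hC 1)
  refine (ContinuousMap.norm_le _ (by positivity)).2 fun t => ?_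
  rw [SmoothPaths.deriv_zero_apply, twist_apply, ← SmoothPaths.deriv_zero_apply]
  exact (ContinuousLinearMap.le_opNorm _ _).trans
    (mul_le_mul (hC _) (ContinuousMap.norm_coe_le_norm _ t) (norm_nonneg _) hC0)

/-- Every path in the Lie algebra of a compact group has an evolution. It is reached from `0`
in finitely many small steps: `f + k` is treated with the help of `Ad(g⁻¹) k`, where `g` is the
evolution of `f`, and `Ad` is bounded. -/
theorem exists_isEvolution [CompleteSpace EG] [CompactSpace G] (f : SmoothPaths EG) :
    ∃ g : I01 → G, IsEvolution f g := by
  obtain ⟨N, S, hN, h0N, -, -, -, -, hev⟩ := exists_local_evolution EG G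
  obtain ⟨ε, hε, hball⟩ := Metric.isOpen_iff.1 hN 0 h0N
  obtain ⟨C, hC⟩ : ∃ C, ∀ a : G, ‖(lieAd a : EG →L[ℝ] EG)‖ ≤ C := by
    obtain ⟨C, hC⟩ := (isCompact_range
      (contMDiff_lieAd (EG := EG) (G := G)).continuous.norm).bddAbove
    exact ⟨C, fun a => hC ⟨a, rfl⟩⟩
  obtain ⟨n, hn⟩ := exists_nat_gt (C * ‖SmoothPaths.deriv EG 0 f‖ / ε)
  have hC0 : 0 ≤ C := (norm_nonneg _).trans (hC 1)
  have hn0 : (0 : ℝ) < n := lt_of_le_of_lt (by positivity) hn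
  have hsmall : ∀ {g : I01 → G} (hg : IsSmoothPath EG g),
      SmoothPaths.deriv EG 0 (twist hg ((n : ℝ)⁻¹ • f)) ∈ N := fun hg => by
    refine hball (mem_ball_zero_iff.2 ((norm_twist_le hg hC _).trans_lt ?_))
    rw [map_smul, norm_smul, norm_inv, Real.norm_natCast]
    rw [div_lt_iff₀ hε] at hn
    rw [show C * ((n : ℝ)⁻¹ * ‖SmoothPaths.deriv EG 0 f‖) =
      C * ‖SmoothPaths.deriv EG 0 f‖ / n by ring, div_lt_iff₀ hn0]
    linarith
  have hstep : ∀ i : ℕ, ∃ g : I01 → G, IsEvolution ((i : ℝ) • (n : ℝ)⁻¹ • f) g := by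
    intro i
    induction i with
    | zero =>
      refine ⟨fun _ => 1, contMDiffOn_const, rfl, fun t => ?_⟩
      rw [Nat.cast_zero, zero_smul]
      exact rlog_const 1 t t.2
    | succ i ih =>
      obtain ⟨g, hg⟩ := ih
      have := hg.mul (hev _ (hsmall hg.smooth))
      rw [Nat.cast_add, Nat.cast_one, add_smul, one_smul]
      exact ⟨_, this⟩
  have := hstep n
  rwa [smul_smul, mul_inv_cancel₀ hn0.ne', one_smul] at this

variable [CompactSpace G]

variable (G) in
/-- The evolution of a path `f` in the Lie algebra: the solution of `ġ g⁻¹ = f`, `g(0) = 1`. -/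
def evol [CompleteSpace EG] (f : SmoothPaths EG) : I01 → G := (exists_isEvolution f).choose

variable [CompleteSpace EG]

theorem isEvolution_evol (f : SmoothPaths EG) : IsEvolution f (evol G f) :=
  (exists_isEvolution f).choose_spec

variable [T2Space G]

theorem evol_eq {f : SmoothPaths EG} {g : I01 → G} (h : IsEvolution f g) : evol G f = g :=
  (isEvolution_evol f).unique h

/-- Near `f₀`, the evolution is the product of the evolution of `f₀` and a path near the unit
element, whose coordinates form a smooth family. -/
theorem exists_local_coordinates (f₀ : SmoothPaths EG) :
    ∃ (V : Set (SmoothPaths EG)) (X : SmoothPaths EG → C(I01, EG)), IsOpen V ∧ f₀ ∈ V ∧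
      (∀ m, PathSmoothOn m X V) ∧
      ∀ f ∈ V, ∀ t, X f t ∈ (extChartAt 𝓘(ℝ, EG) (1 : G)).target ∧
        evol G f t = evol G f₀ t * (extChartAt 𝓘(ℝ, EG) (1 : G)).symm (X f t) := by
  obtain ⟨N, S, hN, h0N, -, -, hSt, hps, hev⟩ := exists_local_evolution EG G
  have hg₀ := isEvolution_evol (G := G) f₀
  -- The evolution of `f` is that of `f₀` times that of `K f = Ad(g₀⁻¹) (f - f₀)`.
  let Ψ : ℝ × EG → EG := fun p => lieAd (extPath (evol G f₀) p.1)⁻¹ (p.2 - extPath f₀ p.1)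
  have hΨ : ContDiffOn ℝ ∞ Ψ (timeSlab univ) := by
    refine ContDiffOn.clm_apply ((contDiffOn_lieAd_inv hg₀.smooth).comp contDiffOn_fst
      fun p hp => hp.2.1) (contDiffOn_snd.sub ?_)
    exact ContDiffOn.comp (t := Icc (0 : ℝ) 1) f₀.2 contDiffOn_fst fun p hp => hp.2.1
  let K : SmoothPaths EG → C(I01, EG) := fun f => superpose Ψ (SmoothPaths.deriv EG 0 f)
  have hgraph : ∀ q : C(I01, EG), q ∈ graphIn univ := fun q t => mem_univ _
  have hK : ∀ m, PathSmoothOn m K univ := fun m =>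
    (SmoothPaths.pathSmoothOn_deriv m 0).superpose isOpen_univ hΨ fun f _ => hgraph _
  have hK' : ∀ f, K f = SmoothPaths.deriv EG 0 (twist hg₀.smooth (f - f₀)) := fun f => by
    ext t
    rw [superpose_apply hΨ.continuousOn (hgraph _), SmoothPaths.deriv_zero_apply (twist _ _)]
    refine congrArg₂ (fun (b : G) (v : EG) => lieAd b⁻¹ v) (extPath_coe _ t) ?_
    exact congrArg₂ (· - ·) (SmoothPaths.deriv_zero_apply f t) (extPath_coe _ t)
  have hKc : Continuous K := continuousOn_univ.1 ((hK 0).bastianiOn 0)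
  have hK0 : K f₀ = 0 := by
    ext t
    rw [hK', sub_self, SmoothPaths.deriv_zero_apply, twist_apply]
    exact map_zero _
  refine ⟨K ⁻¹' N, fun f => S (K f), hN.preimage hKc, ?_, ?_, fun f hf t =>
    ⟨hSt _ hf t, ?_⟩⟩
  · rw [mem_preimage, hK0]; exact h0N
  · exact hps K _ (fun f hf => hf) fun m => (hK m).mono (subset_univ _)
  · rw [mem_preimage, hK'] at hf
    have := hg₀.mul (hev _ hf)
    rw [add_sub_cancel] at this
    rw [evol_eq this]
    change _ = evol G f₀ t * (extChartAt 𝓘(ℝ, EG) (1 : G)).symm (S (K f) t)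
    rw [hK']

/-- The evolution is a smooth map into the Fréchet manifold of smooth paths in the group, in the
coordinates given by left translation with a smooth path and a chart of the group. -/
theorem bastianiOn_evol {h : I01 → G} (hh : IsSmoothPath EG h) (a : G) :
    IsOpen {f : SmoothPaths EG | ∀ t, h t * evol G f t ∈ (chartAt EG a).source} ∧
    ∀ F : SmoothPaths EG → SmoothPaths EG,
      (∀ f, (∀ t, h t * evol G f t ∈ (chartAt EG a).source) →
        ∀ t, F f t = extChartAt 𝓘(ℝ, EG) a (h t * evol G f t)) →
      ∀ n, BastianiOn n F {f | ∀ t, h t * evol G f t ∈ (chartAt EG a).source} := by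
  have := LieGroup.isManifold (EG := EG) (G := G)
  have := topologicalGroup_of_lieGroup 𝓘(ℝ, EG) ∞ (G := G)
  set U := {f : SmoothPaths EG | ∀ t, h t * evol G f t ∈ (chartAt EG a).source} with hU
  have key : ∀ f₀ ∈ U, ∃ (V : Set (SmoothPaths EG)) (Q : SmoothPaths EG → C(I01, EG)), V ⊆ U ∧
      IsOpen V ∧ f₀ ∈ V ∧ (∀ m, PathSmoothOn m Q V) ∧
      ∀ f ∈ V, ∀ t, Q f t = extChartAt 𝓘(ℝ, EG) a (h t * evol G f t) := by
    intro f₀ hf₀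
    obtain ⟨V, X, hV, hf₀V, hX, hXe⟩ := exists_local_coordinates (G := G) f₀
    have hg₀ := isEvolution_evol (G := G) f₀
    let e := extChartAt 𝓘(ℝ, EG) (1 : G)
    -- `b (t, x) = h(t) g₀(t) e⁻¹(x)` recovers `h t * evol G f t` from the coordinates of `f`.
    let b : ℝ × EG → G := fun p => extPath h p.1 * extPath (evol G f₀) p.1 * e.symm p.2
    have hcont : ∀ {p : I01 → G}, IsSmoothPath EG p → Continuous (extPath p) := fun {p} hp => by
      refine Continuous.Icc_extend' ?_
      have := (ContMDiffOn.continuousOn hp).comp_continuous continuous_subtype_val fun t : I01 => t.2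
      exact this.congr fun t => extPath_coe p t
    have hbc : ContinuousOn b (univ ×ˢ e.target) := by
      refine ContinuousOn.mul ?_ ?_
      · exact (((hcont hh).comp continuous_fst).mul
          ((hcont hg₀.smooth).comp continuous_fst)).continuousOn
      · exact (continuousOn_extChartAt_symm (1 : G)).comp continuousOn_snd fun p hp => hp.2
    let Ω : Set (ℝ × EG) := univ ×ˢ e.target ∩ b ⁻¹' (chartAt EG a).source
    have hΩ : IsOpen Ω := hbc.isOpen_inter_preimage
      (isOpen_univ.prod (isOpen_extChartAt_target (1 : G))) (chartAt EG a).open_source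
    let Ψ : ℝ × EG → EG := fun p => extChartAt 𝓘(ℝ, EG) a (b p)
    have hΨ : ContDiffOn ℝ ∞ Ψ (timeSlab Ω) := by
      rw [← contMDiffOn_iff_contDiffOn]
      refine contMDiffOn_extChartAt.comp (t := (chartAt EG a).source) (f := b) ?_ fun p hp => hp.1.2
      have h1 : ContMDiffOn 𝓘(ℝ, ℝ × EG) 𝓘(ℝ, ℝ) ∞ Prod.fst (timeSlab Ω) :=
        contDiffOn_fst.contMDiffOn
      have h2 : ContMDiffOn 𝓘(ℝ, ℝ × EG) 𝓘(ℝ, EG) ∞ Prod.snd (timeSlab Ω) :=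
        contDiffOn_snd.contMDiffOn
      refine ((ContMDiffOn.comp hh h1 fun p hp => hp.2.1).mul
        (ContMDiffOn.comp hg₀.smooth h1 fun p hp => hp.2.1)).mul ?_
      exact (contMDiffOn_extChartAt_symm (1 : G)).comp h2 fun p hp => hp.1.1.2
    have hval : ∀ f ∈ V, ∀ t : I01, b (t, X f t) = h t * evol G f t := fun f hf t => by
      rw [(hXe f hf t).2]
      simp only [b, extPath_coe, e, mul_assoc]
    have hmem : ∀ f ∈ V, X f ∈ graphIn Ω ↔ f ∈ U := fun f hf => by
      refine forall_congr' fun t => ?_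
      rw [← hval f hf t]
      exact ⟨fun hp => hp.2, fun hp => ⟨⟨mem_univ _, (hXe f hf t).1⟩, hp⟩⟩
    refine ⟨V ∩ X ⁻¹' graphIn Ω, fun f => superpose Ψ (X f), fun f hf => (hmem f hf.1).1 hf.2,
      ((hX 0).bastianiOn 0).continuousOn.isOpen_inter_preimage hV (isOpen_graphIn hΩ),
      ⟨hf₀V, (hmem f₀ hf₀V).2 hf₀⟩, fun m => ?_, fun f hf t => ?_⟩
    · exact ((hX m).mono inter_subset_left).superpose hΩ hΨ fun f hf => hf.2
    · rw [superpose_apply hΨ.continuousOn hf.2]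
      simp only [Ψ]
      rw [hval f hf.1]
  refine ⟨isOpen_iff_mem_nhds.2 fun f hf => ?_, fun F hF n => BastianiOn.of_locally fun f hf => ?_⟩
  · obtain ⟨V, -, hVU, hV, hfV, -⟩ := key f hf
    exact mem_of_superset (hV.mem_nhds hfV) hVU
  · obtain ⟨V, Q, hVU, hV, hfV, hQ, hQe⟩ := key f hf
    refine ⟨V, hVU, hV, hfV, bastianiOn_smoothPaths hV hQ (fun k hk t => ?_) n⟩
    rw [hF k (hVU hk), hQe k hk]

end Evolution

/-! ### End points and derivatives of evolutions -/

section EvolutionDerivative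

local notation "I01" => unitInterval

variable {EG : Type u} [NormedAddCommGroup EG] [NormedSpace ℝ EG] [CompleteSpace EG]
  {G : Type*} [TopologicalSpace G] [ChartedSpace EG G] [Group G] [LieGroup 𝓘(ℝ, EG) ∞ G]
  [CompactSpace G] [T2Space G]

/-- The end point of the evolution is a smooth map into the group. -/
theorem bastianiOn_evol_end (c a : G) :
    IsOpen {f : SmoothPaths EG | c * evol G f 1 ∈ (chartAt EG a).source} ∧
    ∀ n, BastianiOn n (fun f : SmoothPaths EG => extChartAt 𝓘(ℝ, EG) a (c * evol G f 1))
      {f | c * evol G f 1 ∈ (chartAt EG a).source} := by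
  have := LieGroup.isManifold (EG := EG) (G := G)
  have := topologicalGroup_of_lieGroup 𝓘(ℝ, EG) ∞ (G := G)
  set U := {f : SmoothPaths EG | c * evol G f 1 ∈ (chartAt EG a).source} with hU
  have key : ∀ f₀ ∈ U, ∃ V ⊆ U, IsOpen V ∧ f₀ ∈ V ∧ ∀ n,
      BastianiOn n (fun f : SmoothPaths EG => extChartAt 𝓘(ℝ, EG) a (c * evol G f 1)) V := by
    intro f₀ hf₀
    obtain ⟨V, X, hV, hf₀V, hX, hXe⟩ := exists_local_coordinates (G := G) f₀
    let e := extChartAt 𝓘(ℝ, EG) (1 : G)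
    let b : EG → G := fun x => c * evol G f₀ 1 * e.symm x
    have hb : ContMDiffOn 𝓘(ℝ, EG) 𝓘(ℝ, EG) ∞ b e.target :=
      contMDiffOn_const.mul (contMDiffOn_extChartAt_symm (1 : G))
    let O : Set EG := e.target ∩ b ⁻¹' (chartAt EG a).source
    have hO : IsOpen O := hb.continuousOn.isOpen_inter_preimage (isOpen_extChartAt_target (1 : G))
      (chartAt EG a).open_source
    have hN : ContDiffOn ℝ ∞ (fun x => extChartAt 𝓘(ℝ, EG) a (b x)) O := by
      rw [← contMDiffOn_iff_contDiffOn]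
      exact contMDiffOn_extChartAt.comp (t := (chartAt EG a).source) (f := b)
        (hb.mono inter_subset_left) fun p hp => hp.2
    have hval : ∀ f ∈ V, b (X f 1) = c * evol G f 1 := fun f hf => by
      rw [(hXe f hf 1).2]
      simp only [b, e, mul_assoc]
    have hmem : ∀ f ∈ V, X f 1 ∈ O ↔ f ∈ U := fun f hf => by
      change (X f 1 ∈ e.target ∧ b (X f 1) ∈ (chartAt EG a).source) ↔
        c * evol G f 1 ∈ (chartAt EG a).source
      rw [hval f hf]
      exact ⟨fun hp => hp.2, fun hp => ⟨(hXe f hf 1).1, hp⟩⟩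
    have hX1 : ∀ n, BastianiOn n (fun f => X f 1) V := fun n =>
      ((hX 0).bastianiOn n).clm_comp (ContinuousMap.evalCLM ℝ (1 : I01))
    have hVO := (hX1 0).continuousOn.isOpen_inter_preimage hV hO
    refine ⟨V ∩ (fun f => X f 1) ⁻¹' O, fun f hf => (hmem f hf.1).1 hf.2, hVO,
      ⟨hf₀V, (hmem f₀ hf₀V).2 hf₀⟩, fun n => ?_⟩
    refine (hN.comp_bastianiOn hO ((hX1 n).mono inter_subset_left) fun f hf => hf.2).congr hVO
      fun f hf => ?_
    simp only [hval f hf.1]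
  refine ⟨isOpen_iff_mem_nhds.2 fun f hf => ?_, fun n => BastianiOn.of_locally fun f hf => ?_⟩
  · obtain ⟨V, hVU, hV, hfV, -⟩ := key f hf
    exact mem_of_superset (hV.mem_nhds hfV) hVU
  · obtain ⟨V, hVU, hV, hfV, h⟩ := key f hf
    exact ⟨V, hVU, hV, hfV, h n⟩

theorem evol_zero (t : I01) : evol G (0 : SmoothPaths EG) t = 1 := by
  have : IsEvolution (0 : SmoothPaths EG) (fun _ => (1 : G)) :=
    ⟨contMDiffOn_const, rfl, fun t => rlog_const 1 t t.2⟩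
  rw [evol_eq this]

/-- The derivative at `0` of the evolution is the integral, because that is the derivative of the
local solution operator. -/
theorem hasDerivAt_evol (f : SmoothPaths EG) (t : I01) :
    ContinuousAt (fun s : ℝ => evol G (s • f) t) 0 ∧
    HasDerivAt (fun s : ℝ => extChartAt 𝓘(ℝ, EG) (1 : G) (evol G (s • f) t))
      (∫ τ in (0 : ℝ)..t, extPath f τ) 0 := by
  obtain ⟨N, S, hN, h0N, hS0, hSd, hSt, -, hev⟩ := exists_local_evolution EG G
  set k := SmoothPaths.deriv EG 0 f with hk
  have hline : Continuous fun s : ℝ => s • k := by fun_prop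
  have hmem : ∀ᶠ s : ℝ in 𝓝 0, s • k ∈ N :=
    (hline.tendsto 0).eventually (hN.mem_nhds (by simpa using h0N))
  have heq : ∀ᶠ s : ℝ in 𝓝 0, evol G (s • f) t =
      (extChartAt 𝓘(ℝ, EG) (1 : G)).symm (S (s • k) t) := by
    filter_upwards [hmem] with s hs
    have h1 : SmoothPaths.deriv EG 0 (s • f) = s • k := map_smul _ _ _
    have h2 := hev (s • f) (by rw [h1]; exact hs)
    rw [evol_eq h2, h1]
  have hder : HasDerivAt (fun s : ℝ => S (s • k) t) (∫ τ in (0 : ℝ)..t, extPath f τ) 0 := by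
    have h1 : HasDerivAt (fun s : ℝ => s • k) k 0 := by
      simpa using (hasDerivAt_id (0 : ℝ)).smul_const k
    have h2 : HasFDerivAt S (pathPrimitive EG) ((0 : ℝ) • k) := by rwa [zero_smul]
    have h3 := (ContinuousMap.evalCLM ℝ t).hasFDerivAt.comp_hasDerivAt (0 : ℝ)
      (h2.comp_hasDerivAt (0 : ℝ) h1)
    have h4 : pathPrimitive EG k t = ∫ τ in (0 : ℝ)..t, extPath f τ := by
      have h5 : (k : I01 → EG) = f := funext fun s => SmoothPaths.deriv_zero_apply f s
      rw [pathPrimitive_apply, h5]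
    rw [← h4]
    exact h3
  constructor
  · refine ContinuousAt.congr ?_ (heq.mono fun s hs => hs.symm)
    have h1 : ContinuousAt (extChartAt 𝓘(ℝ, EG) (1 : G)).symm (S ((0 : ℝ) • k) t) := by
      rw [zero_smul, hS0]
      exact continuousAt_extChartAt_symm (1 : G)
    exact ContinuousAt.comp (f := fun s : ℝ => S (s • k) t) h1 hder.continuousAt
  · refine hder.congr_of_eventuallyEq ?_
    filter_upwards [heq, hmem] with s hs hsN
    rw [hs]
    exact (extChartAt 𝓘(ℝ, EG) (1 : G)).right_inv (hSt _ hsN t)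

theorem hasMFDerivAt_mul_evol (c : G) (f : SmoothPaths EG) (t : I01) :
    HasMFDerivAt 𝓘(ℝ, ℝ) 𝓘(ℝ, EG) (fun s : ℝ => c * evol G (s • f) t) 0
      (ContinuousLinearMap.toSpanSingleton ℝ
        (leftTranslate c (∫ τ in (0 : ℝ)..t, extPath f τ) : EG) : ℝ →L[ℝ] EG) := by
  obtain ⟨h1, h2⟩ := hasDerivAt_evol (G := G) f t
  generalize (∫ τ in (0 : ℝ)..t, extPath f τ) = y at h2 ⊢
  have h0 : evol G ((0 : ℝ) • f) t = 1 := by rw [zero_smul, evol_zero]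
  have h3 : HasMFDerivAt 𝓘(ℝ, ℝ) 𝓘(ℝ, EG) (fun s : ℝ => evol G (s • f) t) 0
      (ContinuousLinearMap.toSpanSingleton ℝ y : ℝ →L[ℝ] EG) := by
    refine ⟨h1, ?_⟩
    simp only [writtenInExtChartAt, h0, modelWithCornersSelf_coe, range_id]
    exact h2.hasFDerivAt.hasFDerivWithinAt
  have h4 : HasMFDerivAt 𝓘(ℝ, EG) 𝓘(ℝ, EG) (fun x : G => c * x) (evol G ((0 : ℝ) • f) t)
      (tderiv EG EG (fun x : G => c * x) 1) := by
    rw [h0]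
    exact (mdifferentiable_group_mul_left c 1).hasMFDerivAt
  refine (HasMFDerivAt.comp (0 : ℝ) h4 h3).congr_mfderiv ?_
  ext
  change tderiv EG EG (fun x : G => c * x) 1 ((1 : ℝ) • y) =
    (1 : ℝ) • tderiv EG EG (fun x : G => c * x) 1 y
  rw [one_smul, one_smul]

end EvolutionDerivative

/-! ### Connections along sections of the pulled back bundle -/

section BundlePaths

local notation "I01" => unitInterval

variable {EG : Type u} [NormedAddCommGroup EG] [NormedSpace ℝ EG]
  {G : Type*} [TopologicalSpace G] [ChartedSpace EG G] [Group G]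
  {EM : Type*} [NormedAddCommGroup EM] [NormedSpace ℝ EM]
  {M : Type*} [TopologicalSpace M] [ChartedSpace EM M]
  {EP : Type*} [NormedAddCommGroup EP] [NormedSpace ℝ EP]
  {P : Type*} [TopologicalSpace P] [ChartedSpace EP P]

theorem PrincipalBundle.act_injective (ξ : PrincipalBundle EG G EM M EP P) (p : P) :
    Function.Injective (ξ.act p) := by
  intro g h hgh
  obtain ⟨U, -, hxU, s, γ, -, -, h3, h4⟩ := ξ.locally_trivial (ξ.proj p)
  have h5 : ∀ a, γ (ξ.act p a) = γ p * a := fun a => by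
    conv_lhs => rw [← h4 p hxU, ← ξ.act_mul]
    exact (h3 _ hxU _).2
  have := h5 g
  rw [hgh, h5] at this
  exact (mul_left_cancel this).symm

/-- A Lie algebra valued form as a family of maps between the model spaces. -/
def LieForm.toCLM (θ : LieForm EG EP P) (p : P) : EP →L[ℝ] EG := θ p

/-- The velocity of a path, as an element of the model space rather than of a tangent space. -/
def modelVelocity (σ : I01 → P) (t : ℝ) : EP := velocity EP σ t

/-- The fundamental vectors at a point, as a map between the model spaces. -/
def PrincipalBundle.fund (ξ : PrincipalBundle EG G EM M EP P) (p : P) : EG →L[ℝ] EP :=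
  tderiv EG EP (ξ.act p) 1

theorem PrincipalBundle.mdifferentiable_act_right (ξ : PrincipalBundle EG G EM M EP P) (g : G) :
    MDifferentiable 𝓘(ℝ, EP) 𝓘(ℝ, EP) fun q => ξ.act q g := by
  have : ContMDiff 𝓘(ℝ, EP) 𝓘(ℝ, EP) ∞ fun q => ξ.act q g :=
    ξ.smooth_act.comp (contMDiff_id.prodMk contMDiff_const)
  exact this.mdifferentiable (by simp)

section

variable [LieGroup 𝓘(ℝ, EG) ∞ G]

/-- The value of an equivariant form on the velocity of `σ · g`, which is the right translate by
`g t` of `σ̇` plus the fundamental vector of `ġ g⁻¹`. -/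
theorem LieForm.IsEquivariant.exists_velocity_act {ξ : PrincipalBundle EG G EM M EP P}
    [IsManifold 𝓘(ℝ, EP) ∞ P] {θ : LieForm EG EP P}
    (hθ : θ.IsEquivariant ξ) {σ : ℝ → P} {g : ℝ → G} {t : ℝ} {v : EP} (hσ : HasVelocity EP σ v t)
    (hg : MDifferentiableWithinAt 𝓘(ℝ, ℝ) 𝓘(ℝ, EG) g (Icc 0 1) t) :
    ∃ v' : EP, HasVelocity EP (fun s => ξ.act (σ s) (g s)) v' t ∧
      θ.toCLM (ξ.act (σ t) (g t)) v' =
        lieAd (g t)⁻¹ (θ.toCLM (σ t) (v + ξ.fund (σ t) (rlog g t))) := by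
  -- Write `σ · g` as the translate by the constant `g t` of a path through `σ t`.
  have h1 := HasVelocity.comp₂ (F := fun p : P × G => ξ.act p.1 p.2)
    (ξ.smooth_act.mdifferentiableAt (by simp)) hσ (hasVelocity_rlog hg)
  have hid : (fun q => ξ.act q 1) = id := funext ξ.act_one
  simp only [mul_inv_cancel, hid, tderiv_id, ContinuousLinearMap.id_apply] at h1
  have h2 := h1.comp (F := fun q => ξ.act q (g t)) (ξ.mdifferentiable_act_right (g t) _)
  simp only [mul_inv_cancel, ξ.act_one, ← ξ.act_mul, inv_mul_cancel_right] at h2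
  exact ⟨_, h2, hθ (σ t) (g t) (v + ξ.fund (σ t) (rlog g t))⟩

end

variable {ξ : PrincipalBundle EG G EM M EP P} {w : I01 → M}

theorem PullbackSection.ext {σ σ' : PullbackSection ξ w} (h : ∀ t, σ.toFun t = σ'.toFun t) :
    σ = σ' := by
  cases σ; cases σ'
  congr
  exact funext h

theorem PullbackSection.act_ratio (σ σ' : PullbackSection ξ w) (t : I01) :
    ξ.act (σ.toFun t) (σ.ratio σ' t) = σ'.toFun t :=
  ξ.act_div (by rw [σ.proj_eq, σ'.proj_eq])

theorem PullbackSection.ratio_self {w : I01 → M} (σ : PullbackSection ξ w) (t : I01) :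
    σ.ratio σ t = 1 := by
  apply ξ.act_injective (σ.toFun t)
  rw [σ.act_ratio, ξ.act_one]

theorem PullbackSection.chart_apply [LieGroup 𝓘(ℝ, EG) ∞ G] {τ σ : PullbackSection ξ w}
    (h : σ ∈ τ.chartSource) (t : I01) :
    τ.chart σ t = extChartAt 𝓘(ℝ, EG) (1 : G) (τ.ratio σ t) :=
  congrArg (fun f : SmoothPaths EG => (f : I01 → EG) t) (dif_pos h)

/-- The section `σ · g`, for a smooth path `g` in the group. -/
def PullbackSection.translate (σ : PullbackSection ξ w) {g : I01 → G} (hg : IsSmoothPath EG g) :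
    PullbackSection ξ w where
  toFun t := ξ.act (σ.toFun t) (g t)
  smooth := ξ.smooth_act.comp_contMDiffOn (ContMDiffOn.prodMk σ.smooth hg)
  proj_eq t := by rw [ξ.proj_act, σ.proj_eq]

theorem PullbackSection.ratio_translate (σ τ : PullbackSection ξ w) {g : I01 → G}
    (hg : IsSmoothPath EG g) (t : I01) : τ.ratio (σ.translate hg) t = τ.ratio σ t * g t := by
  apply ξ.act_injective (τ.toFun t)
  rw [act_ratio, ξ.act_mul, act_ratio]
  rfl

section Forms

variable [IsManifold 𝓘(ℝ, EP) ∞ P]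

/-- The lift of a path to the tangent bundle, by its velocity. -/
def tangentLift (σ : I01 → P) (t : ℝ) : TangentBundle 𝓘(ℝ, EP) P :=
  ⟨extPath σ t, velocity EP σ t⟩

theorem contMDiffOn_tangentLift {σ : I01 → P} (hσ : IsSmoothPath EP σ) :
    ContMDiffOn 𝓘(ℝ, ℝ) 𝓘(ℝ, EP).tangent ∞ (tangentLift (EP := EP) σ) (Icc 0 1) := by
  have h1 := ContMDiffOn.contMDiffOn_tangentMapWithin (m := ∞) hσ (by simp)
    uniqueMDiffOn_unitInterval
  have h2 : ContMDiff 𝓘(ℝ, ℝ) 𝓘(ℝ, ℝ).tangent ∞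
      (fun t : ℝ => (⟨t, (1 : ℝ)⟩ : TangentBundle 𝓘(ℝ, ℝ) ℝ)) :=
    contMDiff_vectorSpace_iff_contDiff.2 (contDiff_const (c := (1 : ℝ)))
  exact h1.comp h2.contMDiffOn fun t ht => ht

/-- The path `t ↦ θ(σ̇(t))` in the Lie algebra, for a smooth form `θ`. -/
def pullForm (θ : LieForm EG EP P) (hθ : θ.IsSmooth) (σ : PullbackSection ξ w) :
    SmoothPaths EG :=
  ⟨fun t => θ.toCLM (σ.toFun t) (modelVelocity σ.toFun t), by
    have h := hθ.comp_contMDiffOn (contMDiffOn_tangentLift σ.smooth)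
    rw [contMDiffOn_iff_contDiffOn] at h
    refine ContDiffOn.congr h fun t ht => ?_
    rw [extPath_of_mem _ ht, ← extPath_of_mem σ.toFun ht]
    rfl⟩

/-- The path `t ↦ ϑ(σ̇(t))` for a tensorial form `ϑ`. -/
def AdForms.pull (σ : PullbackSection ξ w) : AdForms ξ →ₗ[ℝ] SmoothPaths EG where
  toFun ϑ := pullForm ϑ.form ϑ.2.1 σ
  map_add' _ _ := rfl
  map_smul' _ _ := rfl

theorem Connection.toCLM_fund (A : Connection ξ) (p : P) (X : EG) :
    A.form.toCLM p (ξ.fund p X) = X := by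
  have h := A.form_fundamental p X
  change A.form.toCLM (ξ.act p 1) (ξ.fund p X) = X at h
  rwa [ξ.act_one] at h

theorem isHorizontalLift_iff {A : Connection ξ} {p₀ : P} {σ : PullbackSection ξ w} :
    IsHorizontalLift A p₀ σ ↔ σ.toFun 0 = p₀ ∧
      ∀ t : I01, A.form.toCLM (σ.toFun t) (modelVelocity σ.toFun t) = 0 := by
  have key : ∀ t : I01, A.form.toCLM (σ.toFun t) (modelVelocity σ.toFun t) =
      A.form (extPath σ.toFun t) (velocity EP σ.toFun t) := fun t => by
    conv_lhs => rw [← extPath_coe σ.toFun t]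
    rfl
  constructor
  · rintro ⟨h1, h2⟩
    exact ⟨h1, fun t => (key t).trans (h2 t t.2)⟩
  · rintro ⟨h1, h2⟩
    exact ⟨h1, fun t ht => (key ⟨t, ht⟩).symm.trans (h2 ⟨t, ht⟩)⟩

variable [LieGroup 𝓘(ℝ, EG) ∞ G]

theorem LieForm.IsEquivariant.apply_translate {θ : LieForm EG EP P} (hθ : θ.IsEquivariant ξ)
    (σ : PullbackSection ξ w) {g : I01 → G} (hg : IsSmoothPath EG g) (t : I01) :
    θ.toCLM ((σ.translate hg).toFun t) (modelVelocity (σ.translate hg).toFun t) =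
      lieAd (g t)⁻¹ (θ.toCLM (σ.toFun t)
        (modelVelocity σ.toFun t + ξ.fund (σ.toFun t) (rlog (extPath g) t))) := by
  obtain ⟨v', h1, h2⟩ := hθ.exists_velocity_act (σ.smooth.hasVelocity t.2)
    (hg.mdifferentiableOn t t.2)
  have h3 : v' = modelVelocity (σ.translate hg).toFun t :=
    h1.unique ((σ.translate hg).smooth.hasVelocity t.2) t.2
  rw [← h3]
  simp only [extPath_coe] at h2
  exact h2

/-- The translate `σ · g` is horizontal if and only if `ġ g⁻¹ = -A(σ̇)`. -/
theorem horizontal_translate_iff (A : Connection ξ) (σ : PullbackSection ξ w) {g : I01 → G}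
    (hg : IsSmoothPath EG g) (t : I01) :
    A.form.toCLM ((σ.translate hg).toFun t) (modelVelocity (σ.translate hg).toFun t) = 0 ↔
      rlog (extPath g) t = -A.form.toCLM (σ.toFun t) (modelVelocity σ.toFun t) := by
  rw [A.equivariant.apply_translate σ hg t, map_add, A.toCLM_fund]
  constructor
  · intro h
    have h2 := congrArg (lieAd (g t) : EG → EG) h
    rw [lieAd_apply_inv, map_zero] at h2
    rw [eq_neg_iff_add_eq_zero, add_comm]
    exact h2
  · intro h
    rw [h, add_neg_cancel, map_zero]

/-- Two horizontal lifts differ by a path in the group with vanishing logarithmic derivative. -/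
theorem IsHorizontalLift.unique [T2Space G] {A : Connection ξ} {p₀ : P}
    {σ σ' : PullbackSection ξ w} (h : IsHorizontalLift A p₀ σ) (h' : IsHorizontalLift A p₀ σ') :
    σ = σ' := by
  have := LieGroup.isManifold (EG := EG) (G := G)
  rw [isHorizontalLift_iff] at h h'
  have hg := σ.smooth_ratio σ'
  have hσ' : σ.translate hg = σ' := PullbackSection.ext fun t => σ.act_ratio σ' t
  have hlog : ∀ t ∈ Icc (0 : ℝ) 1, (rlog (extPath (σ.ratio σ')) t : EG) = 0 := fun t ht => by
    have h1 := (horizontal_translate_iff A σ hg ⟨t, ht⟩).1 (by rw [hσ']; exact h'.2 ⟨t, ht⟩)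
    rw [h.2, neg_zero] at h1
    exact h1
  have h0 : σ.ratio σ' 0 = 1 := by
    apply ξ.act_injective (σ.toFun 0)
    rw [σ.act_ratio, ξ.act_one, h.1, h'.1]
  refine PullbackSection.ext fun t => ?_
  have h2 := eq_of_rlog_eq (EG := EG) (g := extPath (σ.ratio σ')) (h := fun _ => σ.ratio σ' 0)
    hg.mdifferentiableOn mdifferentiableOn_const (by
      have := extPath_coe (σ.ratio σ') 0
      rwa [Icc.coe_zero] at this) (fun t ht => by rw [hlog t ht, rlog_const _ _ ht]) t.2
  rw [extPath_coe, h0] at h2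
  rw [← σ.act_ratio σ' t, h2, ξ.act_one]

section Evolution

variable [CompleteSpace EG] [CompactSpace G]

/-- A horizontal lift is obtained from an arbitrary section with the right starting point. -/
theorem exists_isHorizontalLift_of_section (A : Connection ξ) {p₀ : P} (σ : PullbackSection ξ w)
    (hσ : σ.toFun 0 = p₀) : ∃ σ' : PullbackSection ξ w, IsHorizontalLift A p₀ σ' := by
  obtain ⟨g, hg⟩ := exists_isEvolution (G := G) (-pullForm A.form A.smooth σ)
  refine ⟨σ.translate hg.smooth, isHorizontalLift_iff.2 ⟨?_, fun t => ?_⟩⟩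
  · change ξ.act (σ.toFun 0) (g 0) = p₀
    rw [hg.start, ξ.act_one, hσ]
  · rw [horizontal_translate_iff, hg.rlog_eq]
    rfl

/-- The horizontal lift with respect to `A + ϑ` is the translate of the horizontal lift `σ` with
respect to `A` by the evolution of `ϑ(σ̇)`. -/
theorem IsHorizontalLift.translate_evol {A : Connection ξ} {p₀ : P} {σ : PullbackSection ξ w}
    (h : IsHorizontalLift A p₀ σ) (ϑ : AdForms ξ) :
    IsHorizontalLift (A + ϑ) p₀
      (σ.translate (isEvolution_evol (G := G) (AdForms.pull σ ϑ)).smooth) := by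
  have hg := isEvolution_evol (G := G) (AdForms.pull σ ϑ)
  rw [isHorizontalLift_iff] at h ⊢
  refine ⟨?_, fun t => ?_⟩
  · change ξ.act (σ.toFun 0) (evol G (AdForms.pull σ ϑ) 0) = p₀
    rw [hg.start, ξ.act_one, h.1]
  · rw [horizontal_translate_iff, hg.rlog_eq]
    have h1 : (A + ϑ).form.toCLM (σ.toFun t) (modelVelocity σ.toFun t) =
        A.form.toCLM (σ.toFun t) (modelVelocity σ.toFun t) -
          ϑ.form.toCLM (σ.toFun t) (modelVelocity σ.toFun t) := rfl
    rw [h1, h.2, zero_sub, neg_neg]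
    rfl

end Evolution

end Forms

end BundlePaths

/-! ### Sections of the pulled back bundle -/

section GlobalSection

local notation "I01" => unitInterval

/-- A smooth function that equals `t` for `t ≤ a` and takes values in `[a, b]` for `t ≥ a`. -/
theorem exists_contDiff_cutoff {a b : ℝ} (hab : a < b) : ∃ χ : ℝ → ℝ, ContDiff ℝ ∞ χ ∧
    (∀ t ≤ a, χ t = t) ∧ ∀ t, a ≤ t → χ t ∈ Icc a b := by
  refine ⟨fun t => t + Real.smoothTransition ((t - a) / (b - a)) * (b - t), ?_, ?_, ?_⟩
  · exact contDiff_id.add ((Real.smoothTransition.contDiff.comp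
      ((contDiff_id.sub contDiff_const).div_const _)).mul (contDiff_const.sub contDiff_id))
  · intro t ht
    simp [Real.smoothTransition.zero_of_nonpos
      (div_nonpos_of_nonpos_of_nonneg (sub_nonpos.2 ht) (sub_pos.2 hab).le)]
  · intro t ht
    rcases le_total t b with h | h
    · have h0 := Real.smoothTransition.nonneg ((t - a) / (b - a))
      have h1 := Real.smoothTransition.le_one ((t - a) / (b - a))
      constructor <;> dsimp only <;> nlinarith
    · simp [Real.smoothTransition.one_of_one_le
        ((one_le_div (sub_pos.2 hab)).2 (sub_le_sub_right h a)), hab.le]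

variable {EG : Type u} [NormedAddCommGroup EG] [NormedSpace ℝ EG]
  {G : Type*} [TopologicalSpace G] [ChartedSpace EG G] [Group G]
  {EM : Type*} [NormedAddCommGroup EM] [NormedSpace ℝ EM]
  {M : Type*} [TopologicalSpace M] [ChartedSpace EM M]
  {EP : Type*} [NormedAddCommGroup EP] [NormedSpace ℝ EP]
  {P : Type*} [TopologicalSpace P] [ChartedSpace EP P]
  {ξ : PrincipalBundle EG G EM M EP P} {w : ℝ → M}

variable (ξ w) in
/-- `σ` is a smooth lift of the path `w` on the interval `[0, b]`, starting at `p₀`. -/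
structure IsLiftUpTo (p₀ : P) (b : ℝ) (σ : ℝ → P) : Prop where
  smooth : ContMDiffOn 𝓘(ℝ, ℝ) 𝓘(ℝ, EP) ∞ σ (Icc 0 b)
  proj_eq : ∀ t ∈ Icc 0 b, ξ.proj (σ t) = w t
  start : σ 0 = p₀

/-- The path `t ↦ s (w t) · g t`, where `s` is a local section over `U`. -/
theorem contMDiffOn_act_section {U : Set M} {s : M → P} {g : ℝ → G} {J : Set ℝ}
    (hs : ContMDiffOn 𝓘(ℝ, EM) 𝓘(ℝ, EP) ∞ s U) (hw : ContMDiffOn 𝓘(ℝ, ℝ) 𝓘(ℝ, EM) ∞ w J)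
    (hwU : MapsTo w J U) (hg : ContMDiffOn 𝓘(ℝ, ℝ) 𝓘(ℝ, EG) ∞ g J) :
    ContMDiffOn 𝓘(ℝ, ℝ) 𝓘(ℝ, EP) ∞ (fun t => ξ.act (s (w t)) (g t)) J :=
  ξ.smooth_act.comp_contMDiffOn (ContMDiffOn.prodMk (hs.comp hw hwU) hg)

/-- A lift up to `b` extends within a trivializing open set: past a time `a < b` it is replaced by
`s (w t) · g (χ t)`, where `g` is its component in the group and `χ` stops the time before `b`. -/
theorem IsLiftUpTo.exists_extension {p₀ : P} {a b b' : ℝ} {σ : ℝ → P}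
    (h : IsLiftUpTo ξ w p₀ b σ) (ha : 0 ≤ a) (hab : a < b)
    (hw : ContMDiffOn 𝓘(ℝ, ℝ) 𝓘(ℝ, EM) ∞ w (Icc 0 b')) {U : Set M} {s : M → P} {γ : P → G}
    (hs : ContMDiffOn 𝓘(ℝ, EM) 𝓘(ℝ, EP) ∞ s U)
    (hγ : ContMDiffOn 𝓘(ℝ, EP) 𝓘(ℝ, EG) ∞ γ (ξ.proj ⁻¹' U))
    (h3 : ∀ y ∈ U, ∀ g, ξ.proj (ξ.act (s y) g) = y ∧ γ (ξ.act (s y) g) = g)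
    (h4 : ∀ p ∈ ξ.proj ⁻¹' U, ξ.act (s (ξ.proj p)) (γ p) = p)
    (hU : ∀ t, a < t → t ≤ max b b' → w t ∈ U) : ∃ σ', IsLiftUpTo ξ w p₀ b' σ' := by
  obtain ⟨a₁, ha₁, hb⟩ := exists_between hab
  obtain ⟨a₂, ha₂, hb₂⟩ := exists_between hb
  obtain ⟨χ, hχ, hχ1, hχ2⟩ := exists_contDiff_cutoff ha₂
  have hχ3 : ∀ t, a < t → χ t ∈ Ioc a b := fun t ht => by
    rcases le_total t a₁ with h' | h'
    · rw [hχ1 t h']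
      exact ⟨ht, h'.trans hb.le⟩
    · exact ⟨ha₁.trans_le (hχ2 t h').1, (hχ2 t h').2.trans hb₂.le⟩
  have hσU : ∀ t ∈ Ioc a b, ξ.proj (σ t) ∈ U := fun t ht => by
    rw [h.proj_eq t ⟨ha.trans ht.1.le, ht.2⟩]
    exact hU t ht.1 (ht.2.trans (le_max_left _ _))
  set τ : ℝ → P := fun t => ξ.act (s (w t)) (γ (σ (χ t))) with hτ
  have hτσ : ∀ t, a < t → t ≤ a₁ → τ t = σ t := fun t ht ht' => by
    have hm : t ∈ Ioc a b := ⟨ht, ht'.trans hb.le⟩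
    rw [hτ]
    dsimp only
    rw [hχ1 t ht', ← h.proj_eq t ⟨ha.trans hm.1.le, hm.2⟩, h4 _ (hσU t hm)]
  have hτs : ContMDiffOn 𝓘(ℝ, ℝ) 𝓘(ℝ, EP) ∞ τ (Icc 0 b' ∩ Ioi a) := by
    refine contMDiffOn_act_section hs (hw.mono inter_subset_left)
      (fun t ht => hU t ht.2 (ht.1.2.trans (le_max_right _ _))) ?_
    refine hγ.comp ((h.smooth.mono ?_).comp hχ.contMDiff.contMDiffOn
      (t := Ioc a b) fun t ht => hχ3 t ht.2) fun t ht => hσU _ (hχ3 t ht.2)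
    exact fun t ht => ⟨ha.trans ht.1.le, ht.2⟩
  have h0 : (0 : ℝ) ≤ a₁ := ha.trans ha₁.le
  refine ⟨fun t => if t ≤ a₁ then σ t else τ t, fun t ht => ?_, fun t ht => ?_, ?_⟩
  · rcases lt_or_ge t a₁ with h' | h'
    · have h5 : ContMDiffWithinAt 𝓘(ℝ, ℝ) 𝓘(ℝ, EP) ∞ σ (Icc 0 b') t := by
        refine (h.smooth t ⟨ht.1, h'.le.trans hb.le⟩).mono_of_mem_nhdsWithin ?_
        filter_upwards [self_mem_nhdsWithin, mem_nhdsWithin_of_mem_nhds (Iio_mem_nhds h')]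
          with r hr hr'
        exact ⟨hr.1, (le_of_lt hr').trans hb.le⟩
      refine h5.congr_of_eventuallyEq ?_ (if_pos h'.le)
      filter_upwards [mem_nhdsWithin_of_mem_nhds (Iio_mem_nhds h')] with r hr
      exact if_pos (le_of_lt hr)
    · have ha' : a < t := ha₁.trans_le h'
      have h6 : ∀ r, a < r → (if r ≤ a₁ then σ r else τ r) = τ r := fun r hr => by
        split_ifs with hr'
        · exact (hτσ r hr hr').symm
        · rfl
      have h5 : ContMDiffWithinAt 𝓘(ℝ, ℝ) 𝓘(ℝ, EP) ∞ τ (Icc 0 b') t :=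
        (hτs t ⟨ht, ha'⟩).mono_of_mem_nhdsWithin
          (inter_mem self_mem_nhdsWithin (mem_nhdsWithin_of_mem_nhds (Ioi_mem_nhds ha')))
      refine h5.congr_of_eventuallyEq ?_ (h6 t ha')
      filter_upwards [mem_nhdsWithin_of_mem_nhds (Ioi_mem_nhds ha')] with r hr
      exact h6 r hr
  · split_ifs with h'
    · exact h.proj_eq t ⟨ht.1, h'.trans hb.le⟩
    · exact (h3 _ (hU t (ha₁.trans (not_le.1 h')) (ht.2.trans (le_max_right _ _))) _).1
  · rw [if_pos h0, h.start]

/-- Every smooth path in the base has a smooth lift with a given starting point: the supremum of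
the times up to which there is a lift is `1`, and it is attained. -/
theorem exists_isLiftUpTo_one (hw : ContMDiffOn 𝓘(ℝ, ℝ) 𝓘(ℝ, EM) ∞ w (Icc 0 1))
    (hc : Continuous w) {p₀ : P} (hp₀ : ξ.proj p₀ = w 0) : ∃ σ, IsLiftUpTo ξ w p₀ 1 σ := by
  set S : Set ℝ := {b | b ∈ Icc (0 : ℝ) 1 ∧ ∃ σ, IsLiftUpTo ξ w p₀ b σ} with hS
  have hS0 : (0 : ℝ) ∈ S := by
    refine ⟨⟨le_rfl, zero_le_one⟩, fun _ => p₀, contMDiffOn_const, fun t ht => ?_, rfl⟩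
    rw [hp₀, le_antisymm ht.1 ht.2]
  have hbdd : BddAbove S := ⟨1, fun b hb => hb.1.2⟩
  set c := sSup S with hcdef
  have hc1 : c ≤ 1 := csSup_le ⟨0, hS0⟩ fun b hb => hb.1.2
  have hc0 : 0 ≤ c := le_csSup hbdd hS0
  obtain ⟨U, hUo, hcU, s, γ, hs, hγ, h3, h4⟩ := ξ.locally_trivial (w c)
  obtain ⟨ε, hε, hball⟩ := Metric.mem_nhds_iff.1 (hc.continuousAt (hUo.mem_nhds hcU))
  have hU : ∀ t, c - ε < t → t < c + ε → w t ∈ U := fun t h h' =>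
    hball (by rw [Metric.mem_ball, Real.dist_eq, abs_lt]; constructor <;> linarith)
  set b' := min 1 (c + ε / 2) with hb'
  have hb'1 : b' ≤ 1 := min_le_left _ _
  have hb'0 : 0 ≤ b' := le_min zero_le_one (by linarith)
  have hb'c : b' < c + ε := (min_le_right _ _).trans_lt (by linarith)
  have hwb := hw.mono (Icc_subset_Icc_right hb'1)
  have key : ∃ σ, IsLiftUpTo ξ w p₀ b' σ := by
    rcases lt_or_ge (c - ε) 0 with h | h
    · have hU' : MapsTo w (Icc 0 b') U := fun t ht =>
        hU t (h.trans_le ht.1) (ht.2.trans_lt hb'c)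
      refine ⟨fun t => ξ.act (s (w t)) (γ p₀),
        contMDiffOn_act_section hs hwb hU' contMDiffOn_const,
        fun t ht => (h3 _ (hU' ht) _).1, ?_⟩
      have h0 : w 0 ∈ U := hU' ⟨le_rfl, hb'0⟩
      rw [← hp₀] at h0 ⊢
      exact h4 _ h0
    · obtain ⟨b, ⟨hb1, σ, hσ⟩, hb⟩ := exists_lt_of_lt_csSup ⟨0, hS0⟩
        (show c - ε < sSup S by rw [← hcdef]; linarith)
      have hbc : b ≤ c := le_csSup hbdd ⟨hb1, σ, hσ⟩
      exact hσ.exists_extension h hb hwb hs hγ h3 h4 fun t ht ht' =>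
        hU t ht (ht'.trans_lt (max_lt (by linarith) hb'c))
  have h1 : b' ≤ c := le_csSup hbdd ⟨⟨hb'0, hb'1⟩, key⟩
  have h2 : b' = 1 := by
    rcases min_choice 1 (c + ε / 2) with h | h
    · exact h
    · rw [← hb'] at h
      linarith
  rwa [h2] at key

theorem PullbackSection.exists_of_start {w : I01 → M} (hw : IsSmoothPath EM w) {p₀ : P}
    (hp₀ : ξ.proj p₀ = w 0) : ∃ σ : PullbackSection ξ w, σ.toFun 0 = p₀ := by
  have hc : Continuous w := by
    have h : Continuous fun t : I01 => extPath w t :=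
      hw.continuousOn.comp_continuous continuous_subtype_val fun t => t.2
    simpa only [extPath_coe] using h
  obtain ⟨σ, hσ⟩ := exists_isLiftUpTo_one (ξ := ξ) hw hc.Icc_extend'
    (hp₀.trans (extPath_coe w 0).symm)
  refine ⟨⟨fun t => σ t, hσ.smooth.congr fun t ht => ?_, fun t => ?_⟩, hσ.start⟩
  · rw [extPath_of_mem _ ht]
  · rw [hσ.proj_eq t t.2, extPath_coe]

end GlobalSection

/-! ### Continuity of the pullback of forms to a section -/

section ContinuityPull

local notation "I01" => unitInterval

/-- The derivatives of `g ∘ f` near a time `t₀` are bounded by those of `g` on a compact set,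
uniformly in `g`. -/
theorem exists_bound_iteratedDerivWithin_comp {F W : Type*} [NormedAddCommGroup F]
    [NormedSpace ℝ F] [NormedAddCommGroup W] [NormedSpace ℝ W] {f : ℝ → F} {O : Set ℝ} {T : Set F}
    (hO : IsOpen O) (hT : IsOpen T) (hf : ContDiffOn ℝ ∞ f (Icc 0 1 ∩ O))
    (hfT : MapsTo f (Icc 0 1 ∩ O) T) {t₀ : ℝ} (ht₀ : t₀ ∈ O) (k : ℕ) :
    ∃ V ∈ 𝓝[Icc 0 1] t₀, ∃ K ⊆ T, IsCompact K ∧ ∃ C : ℝ, 0 < C ∧ ∀ (g : F → W) (h : ℝ → W) (B : ℝ),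
      ContDiffOn ℝ ∞ g T → EqOn h (g ∘ f) (Icc 0 1 ∩ O) →
      (∀ i ≤ k, ∀ y ∈ K, ‖iteratedFDeriv ℝ i g y‖ ≤ B) →
      ∀ s ∈ V, ‖iteratedDerivWithin k h (Icc 0 1) s‖ ≤ C * B := by
  obtain ⟨δ, hδ, hball⟩ := Metric.nhds_basis_closedBall.mem_iff.1 (hO.mem_nhds ht₀)
  set S := Icc (0 : ℝ) 1 ∩ O
  set J := Icc (0 : ℝ) 1 ∩ Metric.closedBall t₀ δ
  have hJS : J ⊆ S := inter_subset_inter_right _ hball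
  have hJ : IsCompact J := isCompact_Icc.inter (isCompact_closedBall _ _)
  have hS : UniqueDiffOn ℝ S := uniqueDiffOn_unitInterval.inter hO
  have hD : ∀ i : ℕ, ∃ D, ∀ s ∈ J, ‖iteratedFDerivWithin ℝ i f S s‖ ≤ D := fun i =>
    hJ.exists_bound_of_continuousOn
      ((hf.continuousOn_iteratedFDerivWithin (by exact_mod_cast le_top) hS).mono hJS)
  choose D hD using hD
  set D' : ℝ := 1 + ∑ i ∈ Finset.range (k + 1), |D i|
  have hD'1 : 1 ≤ D' := le_add_of_nonneg_right (Finset.sum_nonneg fun i _ => abs_nonneg _)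
  have hDD' : ∀ i ≤ k, D i ≤ D' := fun i hi =>
    (le_abs_self _).trans ((Finset.single_le_sum (f := fun i => |D i|) (fun i _ => abs_nonneg _)
      (Finset.mem_range.2 (Nat.lt_succ_of_le hi))).trans (le_add_of_nonneg_left zero_le_one))
  refine ⟨J, inter_mem_nhdsWithin _ (Metric.closedBall_mem_nhds _ hδ), f '' J,
    (hfT.mono_left hJS).image_subset, hJ.image_of_continuousOn (hf.continuousOn.mono hJS),
    k.factorial * D' ^ k, by positivity, fun g h B hg hh hB s hs => ?_⟩
  have hsS := hJS hs
  rw [← norm_iteratedFDerivWithin_eq_norm_iteratedDerivWithin,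
    ← iteratedFDerivWithin_inter_open hO hsS.2, iteratedFDerivWithin_congr hh hsS]
  refine (norm_iteratedFDerivWithin_comp_le (C := B) (D := D') hg hf (by exact_mod_cast le_top)
    hT.uniqueDiffOn hS hfT hsS (fun i hi => ?_) fun i hi1 hi => ?_).trans_eq (by ring)
  · rw [iteratedFDerivWithin_of_isOpen i hT (hfT hsS)]
    exact hB i hi _ (mem_image_of_mem f hs)
  · exact (hD i s hs).trans ((hDD' i hi).trans (le_self_pow₀ hD'1 (by omega)))

variable {EG : Type u} [NormedAddCommGroup EG] [NormedSpace ℝ EG]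
  {G : Type*} [TopologicalSpace G] [ChartedSpace EG G] [Group G]
  {EM : Type*} [NormedAddCommGroup EM] [NormedSpace ℝ EM]
  {M : Type*} [TopologicalSpace M] [ChartedSpace EM M]
  {EP : Type*} [NormedAddCommGroup EP] [NormedSpace ℝ EP]
  {P : Type*} [TopologicalSpace P] [ChartedSpace EP P] [IsManifold 𝓘(ℝ, EP) ∞ P]
  {ξ : PrincipalBundle EG G EM M EP P} {w : I01 → M}

/-- The local representative of a form on `P` in a chart of `TP`. -/
def AdForms.localRep (x : TangentBundle 𝓘(ℝ, EP) P) (ϑ : AdForms ξ) : EP × EP → EG :=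
  ϑ.form.onTangent ∘ (extChartAt 𝓘(ℝ, EP).tangent x).symm

theorem AdForms.contDiffOn_localRep (x : TangentBundle 𝓘(ℝ, EP) P) (ϑ : AdForms ξ) :
    ContDiffOn ℝ ∞ (ϑ.localRep x) (extChartAt 𝓘(ℝ, EP).tangent x).target := by
  rw [← contMDiffOn_iff_contDiffOn]
  exact (show ϑ.form.IsSmooth from ϑ.2.1).comp_contMDiffOn (contMDiffOn_extChartAt_symm x)

/-- Convergence of forms, unfolded: local representatives converge with all derivatives on compact
subsets of charts of `TP`. -/
theorem AdForms.tendstoUniformlyOn_iteratedFDeriv (x : TangentBundle 𝓘(ℝ, EP) P) (k : ℕ)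
    {K : Set (EP × EP)} (hK : IsCompact K) (hKx : K ⊆ (extChartAt 𝓘(ℝ, EP).tangent x).target)
    (ϑ₀ : AdForms ξ) :
    TendstoUniformlyOn (fun ϑ : AdForms ξ => iteratedFDeriv ℝ k (ϑ.localRep x))
      (iteratedFDeriv ℝ k (ϑ₀.localRep x)) (𝓝 ϑ₀) K := by
  have h : Continuous fun ϑ : AdForms ξ => UniformOnFun.ofFun
      {K : Set (EP × EP) | IsCompact K ∧ K ⊆ (extChartAt 𝓘(ℝ, EP).tangent x).target}
      (iteratedFDeriv ℝ k (ϑ.localRep x)) := by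
    rw [continuous_iff_le_induced]
    refine (induced_mono (iInf_le_of_le x (iInf_le _ k))).trans_eq ?_
    rw [induced_compose]
    rfl
  exact UniformOnFun.tendsto_iff_tendstoUniformlyOn.1 h.continuousAt K ⟨hK, hKx⟩

theorem AdForms.eventually_norm_iteratedFDeriv_sub_le (x : TangentBundle 𝓘(ℝ, EP) P) (k : ℕ)
    {K : Set (EP × EP)} (hK : IsCompact K) (hKx : K ⊆ (extChartAt 𝓘(ℝ, EP).tangent x).target)
    (ϑ₀ : AdForms ξ) {ε : ℝ} (hε : 0 < ε) :
    ∀ᶠ ϑ in 𝓝 ϑ₀, ∀ i ≤ k, ∀ y ∈ K, ‖iteratedFDeriv ℝ i ((ϑ - ϑ₀).localRep x) y‖ ≤ ε := by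
  have h : ∀ᶠ ϑ in 𝓝 ϑ₀, ∀ i ∈ Finset.range (k + 1), ∀ y ∈ K,
      dist (iteratedFDeriv ℝ i (ϑ₀.localRep x) y) (iteratedFDeriv ℝ i (ϑ.localRep x) y) < ε :=
    (Finset.eventually_all _).2 fun i _ =>
      Metric.tendstoUniformlyOn_iff.1 (tendstoUniformlyOn_iteratedFDeriv x i hK hKx ϑ₀) ε hε
  filter_upwards [h] with ϑ hϑ i hi y hy
  have h1 := hϑ i (Finset.mem_range.2 (Nat.lt_succ_of_le hi)) y hy
  have hs : ∀ η : AdForms ξ, ContDiffAt ℝ i (η.localRep x) y := fun η =>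
    ((η.contDiffOn_localRep x).contDiffAt ((isOpen_extChartAt_target x).mem_nhds (hKx hy))).of_le
      (by exact_mod_cast le_top)
  have h2 : (ϑ - ϑ₀).localRep x = ϑ.localRep x - ϑ₀.localRep x := rfl
  rw [h2, iteratedFDeriv_sub_apply (hs ϑ) (hs ϑ₀), ← dist_eq_norm, dist_comm]
  exact h1.le

variable (σ : PullbackSection ξ w)

theorem extPath_pull (ϑ : AdForms ξ) {t : ℝ} (ht : t ∈ Icc (0 : ℝ) 1) :
    extPath (AdForms.pull σ ϑ) t = ϑ.form.onTangent (tangentLift σ.toFun t) := by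
  rw [extPath_of_mem _ ht]
  have := extPath_of_mem σ.toFun ht
  change ϑ.form.toCLM (σ.toFun ⟨t, ht⟩) _ = ϑ.form.toCLM (extPath σ.toFun t) _
  rw [this]
  rfl

theorem lineIntegral_eq_integral_pull {w : I01 → M} (ϑ : AdForms ξ) (σ : PullbackSection ξ w)
    (t : I01) :
    lineIntegral ϑ σ.toFun t = ∫ τ in (0 : ℝ)..t, extPath (AdForms.pull σ ϑ) τ := by
  refine intervalIntegral.integral_congr fun τ hτ => ?_
  rw [uIcc_of_le t.2.1] at hτ
  exact (extPath_pull σ ϑ ⟨hτ.1, hτ.2.trans t.2.2⟩).symm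

/-- The interval is covered by finitely many pieces whose velocity stays in one chart of `TP`; on
each of them the chain rule bounds the derivatives of the pullback. -/
theorem AdForms.continuous_pull : Continuous (AdForms.pull σ) := by
  rw [SmoothPaths.isInducing_jet.continuous_iff, continuous_pi_iff]
  intro k
  rw [isInducing_toUniformFun.continuous_iff, continuous_iff_continuousAt]
  intro ϑ₀
  refine UniformFun.tendsto_iff_tendstoUniformly.2 (Metric.tendstoUniformly_iff.2 fun ε hε => ?_)
  suffices h : ∀ᶠ ϑ in 𝓝 ϑ₀, ∀ s ∈ Icc (0 : ℝ) 1,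
      ‖iteratedDerivWithin k (extPath (AdForms.pull σ (ϑ - ϑ₀))) (Icc 0 1) s‖ < ε by
    filter_upwards [h] with ϑ hϑ t
    have h1 : SmoothPaths.jet EG (AdForms.pull σ (ϑ - ϑ₀)) k t =
        SmoothPaths.jet EG (AdForms.pull σ ϑ) k t - SmoothPaths.jet EG (AdForms.pull σ ϑ₀) k t := by
      rw [map_sub, map_sub]
      rfl
    have h2 := hϑ t t.2
    rw [← SmoothPaths.jet_apply, h1, ← dist_eq_norm, dist_comm] at h2
    exact h2
  refine isCompact_Icc.induction_on (p := fun S => ∀ᶠ ϑ in 𝓝 ϑ₀, ∀ s ∈ S,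
    ‖iteratedDerivWithin k (extPath (AdForms.pull σ (ϑ - ϑ₀))) (Icc 0 1) s‖ < ε) ?_ ?_ ?_ ?_
  · simp
  · exact fun S T hST hT => hT.mono fun ϑ h s hs => h s (hST hs)
  · intro S T hS hT
    filter_upwards [hS, hT] with ϑ h1 h2 s hs using hs.elim (h1 s) (h2 s)
  · intro t₀ ht₀
    set e := extChartAt 𝓘(ℝ, EP).tangent (tangentLift (EP := EP) σ.toFun t₀) with he
    have hc := contMDiffOn_tangentLift σ.smooth
    obtain ⟨O, hO, hOe⟩ := (continuousOn_iff'.1 hc.continuousOn) _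
      (isOpen_extChartAt_source (I := 𝓘(ℝ, EP).tangent) (tangentLift (EP := EP) σ.toFun t₀))
    have hmem : ∀ s ∈ Icc (0 : ℝ) 1 ∩ O, tangentLift (EP := EP) σ.toFun s ∈ e.source := fun s hs =>
      (hOe.ge ⟨hs.2, hs.1⟩).1
    have ht₀O : t₀ ∈ O := (hOe.le ⟨mem_extChartAt_source _, ht₀⟩).1
    obtain ⟨V, hV, K, hKT, hK, C, hC, hbound⟩ := exists_bound_iteratedDerivWithin_comp (W := EG)
      (f := fun s => e (tangentLift (EP := EP) σ.toFun s)) hO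
      (isOpen_extChartAt_target (I := 𝓘(ℝ, EP).tangent) (tangentLift (EP := EP) σ.toFun t₀))
      (contMDiffOn_iff_contDiffOn.1
        (contMDiffOn_extChartAt.comp (hc.mono inter_subset_left) fun s hs => by
          have := hmem s hs
          rwa [he, extChartAt_source] at this))
      (fun s hs => e.map_source (hmem s hs)) ht₀O k
    refine ⟨V, hV, ?_⟩
    filter_upwards [AdForms.eventually_norm_iteratedFDeriv_sub_le _ k hK hKT ϑ₀
      (show 0 < ε / (2 * C) by positivity)] with ϑ hϑ s hs
    have h1 := hbound _ (extPath (AdForms.pull σ (ϑ - ϑ₀))) _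
      (AdForms.contDiffOn_localRep _ (ϑ - ϑ₀)) (fun s hs => ?_) hϑ s hs
    · have h2 : C * (ε / (2 * C)) = ε / 2 := by field_simp
      linarith
    · rw [extPath_pull σ _ hs.1]
      change _ = (ϑ - ϑ₀).form.onTangent (e.symm (e (tangentLift (EP := EP) σ.toFun s)))
      rw [e.left_inv (hmem s hs)]

/-- The pullback `ϑ ↦ ϑ(σ̇)` as a continuous linear map. -/
def AdForms.pullCLM : AdForms ξ →L[ℝ] SmoothPaths EG := ⟨AdForms.pull σ, AdForms.continuous_pull σ⟩

end ContinuityPull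

/-! ### The horizontal lift map and the holonomy -/

section LiftMap

local notation "I01" => unitInterval

section Holonomies

variable {EG : Type u} [NormedAddCommGroup EG] [NormedSpace ℝ EG]
  {G : Type*} [TopologicalSpace G] [ChartedSpace EG G] [Group G]
  {EM : Type*} [NormedAddCommGroup EM] [NormedSpace ℝ EM]
  {M : Type*} [TopologicalSpace M] [ChartedSpace EM M]
  {EP : Type*} [NormedAddCommGroup EP] [NormedSpace ℝ EP]
  {P : Type*} [TopologicalSpace P] [ChartedSpace EP P] [IsManifold 𝓘(ℝ, EP) ∞ P]
  {ξ : PrincipalBundle EG G EM M EP P}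
  {ι : Type*} {w : ι → I01 → M} {Hor : ∀ i, Connection ξ → PullbackSection ξ (w i)}

/-- The holonomies along a family of loops whose horizontal lifts are `Hor`. -/
def holonomies (p₀ : P) (Hor : ∀ i, Connection ξ → PullbackSection ξ (w i)) (A : Connection ξ)
    (i : ι) : G :=
  ξ.div p₀ ((Hor i A).toFun 1)

theorem act_holonomies {p₀ : P} (hw : ∀ i, w i 1 = ξ.proj p₀) (A : Connection ξ) (i : ι) :
    ξ.act p₀ (holonomies p₀ Hor A i) = (Hor i A).toFun 1 :=
  ξ.act_div (by rw [(Hor i A).proj_eq, hw])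

theorem isHolonomy_iff [LieGroup 𝓘(ℝ, EG) ∞ G] [T2Space G] {p₀ : P}
    (hHor : ∀ i A, IsHorizontalLift A p₀ (Hor i A)) (hw : ∀ i, w i 1 = ξ.proj p₀) (A : Connection ξ) (i : ι) (g : G) :
    IsHolonomy A p₀ (w i) g ↔ g = holonomies p₀ Hor A i := by
  constructor
  · rintro ⟨σ, hσ, hg⟩
    apply ξ.act_injective p₀
    rw [act_holonomies hw, hg, hσ.unique (hHor i A)]
  · rintro rfl
    exact ⟨Hor i A, hHor i A, act_holonomies hw A i⟩

end Holonomies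

variable {EG : Type u} [NormedAddCommGroup EG] [NormedSpace ℝ EG] [CompleteSpace EG]
  {G : Type*} [TopologicalSpace G] [ChartedSpace EG G] [Group G] [LieGroup 𝓘(ℝ, EG) ∞ G]
  [CompactSpace G]
  {EM : Type*} [NormedAddCommGroup EM] [NormedSpace ℝ EM]
  {M : Type*} [TopologicalSpace M] [ChartedSpace EM M]
  {EP : Type*} [NormedAddCommGroup EP] [NormedSpace ℝ EP]
  {P : Type*} [TopologicalSpace P] [ChartedSpace EP P]
  {ξ : PrincipalBundle EG G EM M EP P}

/-- The smooth section `σ · g` of the pulled back bundle, where `g` is the evolution of `f`. -/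
def PullbackSection.evolve {w : I01 → M} (σ : PullbackSection ξ w) (f : SmoothPaths EG) :
    PullbackSection ξ w :=
  σ.translate (isEvolution_evol (G := G) f).smooth

theorem PullbackSection.ratio_evolve {w : I01 → M} (σ τ : PullbackSection ξ w)
    (f : SmoothPaths EG) (t : I01) : τ.ratio (σ.evolve f) t = τ.ratio σ t * evol G f t :=
  σ.ratio_translate τ _ t

theorem exists_isHorizontalLift [IsManifold 𝓘(ℝ, EP) ∞ P] {w : I01 → M}
    (hw : IsSmoothPath EM w) {p₀ : P} (hp₀ : ξ.proj p₀ = w 0) (A : Connection ξ) :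
    ∃ σ : PullbackSection ξ w, IsHorizontalLift A p₀ σ := by
  obtain ⟨σ, hσ⟩ := PullbackSection.exists_of_start (ξ := ξ) hw hp₀
  exact exists_isHorizontalLift_of_section A σ hσ

variable [T2Space G]

/-- The map `f ↦ σ · evol f` into the manifold of sections is smooth. -/
theorem PullbackSection.bastianiOn_evolve {w : I01 → M} (σ τ : PullbackSection ξ w) :
    IsOpen {f : SmoothPaths EG | σ.evolve f ∈ τ.chartSource} ∧
      ∀ n, BastianiOn n (fun f : SmoothPaths EG => τ.chart (σ.evolve f))
        {f | σ.evolve f ∈ τ.chartSource} := by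
  have h : {f : SmoothPaths EG | σ.evolve f ∈ τ.chartSource} =
      {f | ∀ t, τ.ratio σ t * evol G f t ∈ (chartAt EG (1 : G)).source} := by
    ext f
    refine forall_congr' fun t => ?_
    rw [σ.ratio_evolve τ]
  obtain ⟨h1, h2⟩ := bastianiOn_evol (τ.smooth_ratio σ) (1 : G)
  rw [h]
  refine ⟨h1, h2 _ fun f hf t => ?_⟩
  rw [PullbackSection.chart_apply (h.ge hf), σ.ratio_evolve τ]

/-- The derivative at `0` of `f ↦ σ · evol f` is the primitive of `f`. It exists by smoothness, and
evaluation at each time identifies it. -/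
theorem PullbackSection.hasDirDeriv_evolve {w : I01 → M} (σ : PullbackSection ξ w)
    (f : SmoothPaths EG) : ∃ y : SmoothPaths EG,
      (∀ t : I01, y t = ∫ τ in (0 : ℝ)..t, extPath f τ) ∧
      HasDirDeriv (fun f : SmoothPaths EG => σ.chart (σ.evolve f)) 0 f y := by
  obtain ⟨h1, h2⟩ := σ.bastianiOn_evolve σ
  have hratio : ∀ (k : SmoothPaths EG) t, σ.ratio (σ.evolve k) t = evol G k t := fun k t => by
    rw [σ.ratio_evolve, σ.ratio_self, one_mul]
  have h0 : (0 : SmoothPaths EG) ∈ {f : SmoothPaths EG | σ.evolve f ∈ σ.chartSource} := by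
    intro t
    rw [hratio, evol_zero]
    exact mem_chart_source EG (1 : G)
  obtain ⟨-, df, hdf, -⟩ := h2 1
  refine ⟨df (0, f), fun t => ?_, hdf 0 h0 f⟩
  have h3 := (hdf 0 h0 f).clm_comp ((ContinuousMap.evalCLM ℝ t).comp (SmoothPaths.deriv EG 0))
  rw [hasDirDeriv_iff_hasDerivAt] at h3
  have h4 := h3.congr_of_eventuallyEq
    (f₁ := fun s : ℝ => extChartAt 𝓘(ℝ, EG) (1 : G) (evol G (s • f) t)) ?_
  · have h5 := h4.unique (hasDerivAt_evol (G := G) f t).2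
    rw [← h5]
    exact (SmoothPaths.deriv_zero_apply _ t).symm
  · have hline : Continuous fun s : ℝ => s • f := by fun_prop
    have hmem := (hline.tendsto 0).eventually (h1.mem_nhds (by rw [zero_smul]; exact h0))
    filter_upwards [hmem] with s hs
    refine Eq.symm ((SmoothPaths.deriv_zero_apply _ t).trans ?_)
    rw [zero_add, PullbackSection.chart_apply hs, hratio]

variable [IsManifold 𝓘(ℝ, EP) ∞ P] {p₀ : P} {w : I01 → M}
  {Hor : Connection ξ → PullbackSection ξ w}

/-- Horizontal lifts with respect to `A + ϑ` arise from those with respect to `A` by the evolution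
of `ϑ(σ̇)`. -/
theorem horizontalLift_add (hHor : ∀ A, IsHorizontalLift A p₀ (Hor A)) (A : Connection ξ)
    (ϑ : AdForms ξ) : Hor (A + ϑ) = (Hor A).evolve (AdForms.pullCLM (Hor A) ϑ) :=
  (hHor (A + ϑ)).unique ((hHor A).translate_evol ϑ)

theorem smoothOnConnections_horizontalLift (hHor : ∀ A, IsHorizontalLift A p₀ (Hor A)) :
    SmoothOnConnections ξ PullbackSection.chartSource PullbackSection.chart Hor := by
  intro A τ
  obtain ⟨h1, h2⟩ := (Hor A).bastianiOn_evolve τ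
  have h : (fun ϑ : AdForms ξ => Hor (A + ϑ)) =
      fun ϑ => (Hor A).evolve (AdForms.pullCLM (Hor A) ϑ) := funext (horizontalLift_add hHor A)
  rw [h]
  refine ⟨h1.preimage (AdForms.pullCLM (Hor A)).continuous, fun n => ?_⟩
  exact (h2 n).comp_clm (AdForms.pullCLM (Hor A))

theorem exists_hasDirDeriv_horizontalLift (hHor : ∀ A, IsHorizontalLift A p₀ (Hor A))
    (A : Connection ξ) (ϑ : AdForms ξ) : ∃ f : SmoothPaths EG,
      (∀ t : I01, f t = lineIntegral ϑ (Hor A).toFun t) ∧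
      HasDirDeriv (fun η : AdForms ξ => (Hor A).chart (Hor (A + η))) 0 ϑ f := by
  obtain ⟨f, hf, hd⟩ := (Hor A).hasDirDeriv_evolve (AdForms.pull (Hor A) ϑ)
  refine ⟨f, fun t => (hf t).trans (lineIntegral_eq_integral_pull ϑ (Hor A) t).symm, ?_⟩
  simp only [HasDirDeriv, horizontalLift_add hHor, map_add, map_smul, map_zero]
  exact hd

section Holonomy

variable {ι : Type*} {w : ι → I01 → M}
  {Hor : ∀ i, Connection ξ → PullbackSection ξ (w i)}

theorem holonomies_add (hHor : ∀ i A, IsHorizontalLift A p₀ (Hor i A))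
    (hw : ∀ i, w i 1 = ξ.proj p₀) (A : Connection ξ) (ϑ : AdForms ξ) (i : ι) :
    holonomies p₀ Hor (A + ϑ) i =
      holonomies p₀ Hor A i * evol G (AdForms.pullCLM (Hor i A) ϑ) 1 := by
  apply ξ.act_injective p₀
  rw [act_holonomies hw, horizontalLift_add (hHor i), ξ.act_mul, act_holonomies hw]
  rfl

theorem smoothOnConnections_holonomies [Fintype ι] (hHor : ∀ i A, IsHorizontalLift A p₀ (Hor i A))
    (hw : ∀ i, w i 1 = ξ.proj p₀) :
    SmoothOnConnections ξ
      (fun a => (extChartAt (ModelWithCorners.pi fun _ : ι => 𝓘(ℝ, EG)) a).source)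
      (fun a => extChartAt (ModelWithCorners.pi fun _ : ι => 𝓘(ℝ, EG)) a)
      (holonomies (G := G) p₀ Hor) := by
  intro A a
  have h1 := fun i => bastianiOn_evol_end (EG := EG) (G := G) (holonomies p₀ Hor A i) (a i)
  have hpre : (fun ϑ : AdForms ξ => holonomies p₀ Hor (A + ϑ)) ⁻¹'
      (extChartAt (ModelWithCorners.pi fun _ : ι => 𝓘(ℝ, EG)) a).source =
      ⋂ i, AdForms.pullCLM (Hor i A) ⁻¹'
        {f | holonomies p₀ Hor A i * evol G f 1 ∈ (chartAt EG (a i)).source} := by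
    ext ϑ
    rw [mem_preimage, extChartAt_source, mem_iInter]
    refine mem_univ_pi.trans (forall_congr' fun i => ?_)
    rw [holonomies_add hHor hw]
    rfl
  dsimp only
  rw [hpre]
  refine ⟨isOpen_iInter_of_finite fun i => (h1 i).1.preimage (AdForms.pullCLM (Hor i A)).continuous,
    fun n => BastianiOn.pi fun i => ?_⟩
  refine BastianiOn.mono ?_ (iInter_subset _ i)
  have h2 : (fun ϑ : AdForms ξ => extChartAt (ModelWithCorners.pi fun _ : ι => 𝓘(ℝ, EG)) a
      (holonomies p₀ Hor (A + ϑ)) i) = fun ϑ => extChartAt 𝓘(ℝ, EG) (a i)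
        (holonomies p₀ Hor A i * evol G (AdForms.pullCLM (Hor i A) ϑ) 1) := by
    funext ϑ
    rw [← holonomies_add hHor hw]
    rfl
  rw [h2]
  exact ((h1 i).2 n).comp_clm (AdForms.pullCLM (Hor i A))

theorem hasMFDerivAt_holonomies [Fintype ι] (hHor : ∀ i A, IsHorizontalLift A p₀ (Hor i A))
    (hw : ∀ i, w i 1 = ξ.proj p₀) (A : Connection ξ) (ϑ : AdForms ξ) :
    HasMFDerivAt 𝓘(ℝ, ℝ) (ModelWithCorners.pi fun _ : ι => 𝓘(ℝ, EG))
      (fun s : ℝ => holonomies (G := G) p₀ Hor (A + s • ϑ)) 0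
      (ContinuousLinearMap.toSpanSingleton ℝ
        (fun i => leftTranslate (holonomies p₀ Hor A i) (lineIntegral ϑ (Hor i A).toFun 1) :
          ι → EG)) := by
  have hcoord : ∀ i, HasMFDerivAt 𝓘(ℝ, ℝ) 𝓘(ℝ, EG)
      (fun s : ℝ => holonomies p₀ Hor (A + s • ϑ) i) 0
      (ContinuousLinearMap.toSpanSingleton ℝ
        (leftTranslate (holonomies p₀ Hor A i) (lineIntegral ϑ (Hor i A).toFun 1) : EG) :
          ℝ →L[ℝ] EG) := fun i => by
    have h1 := hasMFDerivAt_mul_evol (holonomies p₀ Hor A i) (AdForms.pull (Hor i A) ϑ) 1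
    rw [← lineIntegral_eq_integral_pull ϑ (Hor i A) 1] at h1
    refine h1.congr_of_eventuallyEq (Eventually.of_forall fun s => ?_)
    dsimp only
    rw [holonomies_add hHor hw, map_smul]
    rfl
  refine ⟨continuousAt_pi.2 fun i => (hcoord i).1, hasFDerivWithinAt_pi'.2 fun i => ?_⟩
  exact (hcoord i).2

end Holonomy

end LiftMap

end

theorem mainTheorem3
    {EG : Type*} [NormedAddCommGroup EG] [NormedSpace ℝ EG] [FiniteDimensional ℝ EG]
    {G : Type*} [TopologicalSpace G] [ChartedSpace EG G] [Group G] [LieGroup 𝓘(ℝ, EG) ∞ G]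
    [T2Space G] [CompactSpace G] [ConnectedSpace G]
    {EM : Type*} [NormedAddCommGroup EM] [NormedSpace ℝ EM] [FiniteDimensional ℝ EM]
    {M : Type*} [TopologicalSpace M] [ChartedSpace EM M] [IsManifold 𝓘(ℝ, EM) ∞ M]
    [T2Space M] [SecondCountableTopology M] [ConnectedSpace M]
    {EP : Type*} [NormedAddCommGroup EP] [NormedSpace ℝ EP] [FiniteDimensional ℝ EP]
    {P : Type*} [TopologicalSpace P] [ChartedSpace EP P] [IsManifold 𝓘(ℝ, EP) ∞ P]
    [T2Space P] [SecondCountableTopology P]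
    (ξ : PrincipalBundle EG G EM M EP P) (p₀ : P) :
    -- horizontal lifts of a smooth loop in an arbitrary connected base manifold
    (∀ w : unitInterval → M, IsSmoothLoop EM w (ξ.proj p₀) →
      ∃ Hor : Connection ξ → PullbackSection ξ w,
        (∀ A σ, IsHorizontalLift A p₀ σ ↔ σ = Hor A) ∧
        SmoothOnConnections ξ PullbackSection.chartSource PullbackSection.chart Hor ∧
        ∀ (A : Connection ξ) (ϑ : AdForms ξ), ∃ f : SmoothPaths EG,
          (∀ t : unitInterval, f t = lineIntegral ϑ (Hor A).toFun t) ∧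
          HasDirDeriv (fun η : AdForms ξ => (Hor A).chart (Hor (A + η))) 0 ϑ f) ∧
    -- the Wilson loop mapping of a closed surface
    (CompactSpace M → Module.finrank ℝ EM = 2 → ∀ ℓ : ℕ, 1 ≤ ℓ →
      ∀ u v : Fin ℓ → unitInterval → M, IsCanonicalSystem EM (ξ.proj p₀) u v →
      ∃ ρ : Connection ξ → Fin ℓ × Fin 2 → G,
        IsWilsonLoopMap p₀ u v ρ ∧
        SmoothOnConnections ξ
          (fun a => (extChartAt (ModelWithCorners.pi fun _ : Fin ℓ × Fin 2 => 𝓘(ℝ, EG)) a).source)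
          (fun a => extChartAt (ModelWithCorners.pi fun _ : Fin ℓ × Fin 2 => 𝓘(ℝ, EG)) a) ρ ∧
        ∀ (A : Connection ξ) (ϑ : AdForms ξ)
          (σ : ∀ i : Fin ℓ × Fin 2, PullbackSection ξ (interleave u v i)),
          (∀ i, IsHorizontalLift A p₀ (σ i)) →
          HasMFDerivAt 𝓘(ℝ, ℝ) (ModelWithCorners.pi fun _ : Fin ℓ × Fin 2 => 𝓘(ℝ, EG))
            (fun s : ℝ => ρ (A + s • ϑ)) 0
            (ContinuousLinearMap.toSpanSingleton ℝ
              (fun i => leftTranslate (ρ A i) (lineIntegral ϑ (σ i).toFun 1) :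
                Fin ℓ × Fin 2 → EG))) := by
  have : CompleteSpace EG := FiniteDimensional.complete ℝ EG
  have lift : ∀ w : unitInterval → M, IsSmoothLoop EM w (ξ.proj p₀) →
      ∃ Hor : Connection ξ → PullbackSection ξ w, ∀ A, IsHorizontalLift A p₀ (Hor A) :=
    fun w hw => ⟨_, fun A => (exists_isHorizontalLift hw.smooth hw.start.symm A).choose_spec⟩
  constructor
  · intro w hw
    obtain ⟨Hor, hHor⟩ := lift w hw
    exact ⟨Hor, fun A σ => ⟨fun h => h.unique (hHor A), fun h => h ▸ hHor A⟩,
      smoothOnConnections_horizontalLift hHor, exists_hasDirDeriv_horizontalLift hHor⟩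
  · intro _ _ ℓ _ u v huv
    have hloop : ∀ i, IsSmoothLoop EM (interleave u v i) (ξ.proj p₀) := by
      rintro ⟨j, k⟩
      fin_cases k
      · exact huv.loop_u j
      · exact huv.loop_v j
    choose Hor hHor using fun i => lift _ (hloop i)
    have hend := fun i => (hloop i).finish
    refine ⟨holonomies p₀ Hor, fun A i => isHolonomy_iff hHor hend A i,
      smoothOnConnections_holonomies hHor hend, fun A ϑ σ hσ => ?_⟩
    obtain rfl : σ = fun i => Hor i A := funext fun i => (hσ i).unique (hHor i A)
    exact hasMFDerivAt_holonomies hHor hend A ϑ
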